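/- Let $2\omega_1,2\omega_3\in\mathbb C$ be linearly independent over $\mathbb R$, let $\wp$ be the Weierstrass function with period lattice $\Lambda=2\omega_1\mathbb Z+2\omega_3\mathbb Z$, and put $\omega_0=0$, $\omega_2=-\omega_1-\omega_3$, $e_i=\wp(\omega_i)$ $(i=1,2,3)$, $g_2=-4(e_1e_2+e_2e_3+e_3e_1)$, $g_3=4e_1e_2e_3$. Let $l_0,l_1,l_2,l_3\in\mathbb Z_{\ge 0}$, $M\in\mathbb Z_{\ge0}$, $r_1,\dots,r_M\in\mathbb Z_{>0}$, $E,s_1,\dots,s_M\in\mathbb C$, and let $\delta_1,\dots,\delta_M\in\mathbb C$ with $2\delta_{i'}\notin\Lambda$ be such that the numbers $b_{i'}=\wp(\delta_{i'})$ are pairwise distinct. Put $$v(x)=\sum_{i=0}^3 l_i(l_i+1)\wp(x+\omega_i)+\sum_{i'=1}^M\left(\frac{r_{i'}}2\Big(\frac{r_{i'}}2+1\Big)\big(\wp(x-\delta_{i'})+\wp(x+\delta_{i'})\big)+\frac{s_{i'}}{\wp(x)-\wp(\delta_{i'})}\right),$$ $N=\sum_{i=0}^3 l_i+\sum_{i'=1}^M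 r_{i'}$, $$o_{i'}=-s_{i'}+r_{i'}\Big\{\tfrac18 r_{i'}(12b_{i'}^2-g_2)+\tfrac12(4b_{i'}^3-g_2b_{i'}-g_3)\sum_{i''\ne i'}\frac{r_{i''}}{b_{i'}-b_{i''}}+2\big(l_1(b_{i'}-e_2)(b_{i'}-e_3)+l_2(b_{i'}-e_1)(b_{i'}-e_3)+l_3(b_{i'}-e_1)(b_{i'}-e_2)\big)\Big\},$$ $$p=E+\sum_{i=1}^3e_il_i^2-2(l_1l_2e_3+l_2l_3e_1+l_3l_1e_2)-\tfrac12\sum_{i'=1}^M b_{i'}r_{i'}^2+2\sum_{i'=1}^M\sum_{i=1}^3 l_ir_{i'}(e_i+b_{i'})+2\Big(\sum_{i'=1}^M b_{i'}r_{i'}\Big)\Big(\sum_{i'=1}^M r_{i'}\Big).$$ Consider the Fuchsian equation $$\left\{\frac{d^2}{dz^2}+\left(\sum_{i=1}^3\frac{\frac12-l_i}{z-e_i}+\sum_{i'=1}^M\frac{-r_{i'}}{z-b_{i'}}\right)\frac{d}{dz}+\frac{N(N-2l_0-1)z+p+\sum_{i'=1}^M\frac{o_{i'}}{z-b_{i'}}}{4(z-e_1)(z-e_2)(z-e_3)}\right\}\tilde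 f(z)=0 ,$$ to which the equation $-f''(x)+v(x)f(x)=Ef(x)$ is equivalent through $z=\wp(x)$ and $f(x)=\tilde f(z)\prod_{i=1}^3(z-e_i)^{-l_i/2}\prod_{i'=1}^M(z-b_{i'})^{-r_{i'}/2}$. Assume that each regular singular point $z=b_{i'}$ of it is apparent, that is, the exponents at $b_{i'}$ are integers and the equation has no logarithmic solution at $b_{i'}$ (no solution $g(z)+h(z)\log(z-b_{i'})$ near $b_{i'}$ with $g,h$ meromorphic at $b_{i'}$ and $h\not\equiv0$). Then the equation $$\left\{\frac{d^3}{dx^3}-4\big(v(x)-E\big)\frac{d}{dx}-2\frac{dv(x)}{dx}\right\}\Xi(x)=0$$ has a nonzero meromorphic solution $\Xi$ on $\mathbb C$ that is even and doubly periodic ($\Xi(x+2\omega_1)=\Xi(x+2\omega_3)=\Xi(x)$) and has the expansion $$\Xi(x)=c_0+\sum_{i=0}^3\sum_{j=0}^{l_i-1}b^{(i)}_j\,\wp(x+\omega_i)^{l_i-j}+\sum_{i'=1}^M\sum_{j=0}^{r_{i'}-1}\frac{d^{(i')}_j}{(\wp(x)-\wp(\delta_{i'}))^{r_{i'}-j}}$$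 with constants $c_0,b^{(i)}_j,d^{(i')}_j\in\mathbb C$. -/

import Mathlib

open Filter Topology

noncomputable section

namespace TakemuraHeun

/-! ### Second-order linear equations `f'' + P f' + Q f = 0` and apparent singularities -/

/-- `f` satisfies `f'' + P f' + Q f = 0` at the point `z`. -/
def SolvesAt (P Q f : ℂ → ℂ) (z : ℂ) : Prop :=
  deriv (deriv f) z + P z * deriv f z + Q z * f z = 0

/-- The point `a` is regular (in the sense of Fuchs) for `f'' + P f' + Q f = 0`:
`P` has at most a simple pole and `Q` at most a double pole at `a`. -/
def IsRegularPoint (P Q : ℂ → ℂ) (a : ℂ) : Prop :=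
  MeromorphicAt P a ∧ MeromorphicAt Q a ∧
    ((-1 : ℤ) : WithTop ℤ) ≤ meromorphicOrderAt P a ∧
    ((-2 : ℤ) : WithTop ℤ) ≤ meromorphicOrderAt Q a

/-- `t` is an exponent of `f'' + P f' + Q f = 0` at `a`: a root of the characteristic polynomial
`t ^ 2 + (p₀ - 1) t + q₀`, with `p₀ = lim (z - a) P(z)` and `q₀ = lim (z - a)² Q(z)`. -/
def IsExponent (P Q : ℂ → ℂ) (a t : ℂ) : Prop :=
  ∃ p₀ q₀ : ℂ,
    Tendsto (fun z => (z - a) * P z) (𝓝[≠] a) (𝓝 p₀) ∧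
    Tendsto (fun z => (z - a) ^ 2 * Q z) (𝓝[≠] a) (𝓝 q₀) ∧
    t ^ 2 + (p₀ - 1) * t + q₀ = 0

/-- `f'' + P f' + Q f = 0` has a logarithmic solution at `a` (when the exponents are integers):
a solution `g(z) + h(z) log (z - a)` near `a`, off a branch cut, where `g` and `h` are Laurent
series at `a` with finitely many negative powers, and `h` is not identically zero. -/
def HasLogarithmicSolution (P Q : ℂ → ℂ) (a : ℂ) : Prop :=
  ∃ g h : ℂ → ℂ, MeromorphicAt g a ∧ MeromorphicAt h a ∧ ¬ (∀ᶠ z in 𝓝[≠] a, h z = 0) ∧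
    ∀ᶠ z in 𝓝[≠] a, z - a ∈ Complex.slitPlane →
      SolvesAt P Q (fun w => g w + h w * Complex.log (w - a)) z

/-- The regular singular point `a` of `f'' + P f' + Q f = 0` is apparent: the exponents
at `a` are integers, and there is no logarithmic solution at `a`. -/
def IsApparent (P Q : ℂ → ℂ) (a : ℂ) : Prop :=
  IsRegularPoint P Q a ∧ (∀ t : ℂ, IsExponent P Q a t → ∃ n : ℤ, t = n) ∧
    ¬ HasLogarithmicSolution P Q a

/-! ### The Fuchsian equation

The triple `(e₁, e₂, e₃)` is stored as `e 1, e 2, e 3`; the value `e 0` is never used. -/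

/-- The coefficient of `d/dz` in the Fuchsian equation. -/
def fuchsP (e : Fin 4 → ℂ) (l : Fin 4 → ℕ) {M : ℕ} (r : Fin M → ℕ) (b : Fin M → ℂ) (z : ℂ) : ℂ :=
  ((1 / 2 - l 1) / (z - e 1) + (1 / 2 - l 2) / (z - e 2) + (1 / 2 - l 3) / (z - e 3))
    + ∑ k, (-(r k : ℂ)) / (z - b k)

/-- The zeroth-order coefficient of the Fuchsian equation, with accessory parameters
`p` and `o k`. -/
def fuchsQ (e : Fin 4 → ℂ) (l : Fin 4 → ℕ) {M : ℕ} (r : Fin M → ℕ) (b : Fin M → ℂ)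
    (p : ℂ) (o : Fin M → ℂ) (z : ℂ) : ℂ :=
  let N : ℂ := ∑ i, (l i : ℂ) + ∑ k, (r k : ℂ)
  (N * (N - 2 * l 0 - 1) * z + p + ∑ k, o k / (z - b k)) /
    (4 * (z - e 1) * (z - e 2) * (z - e 3))

/-! ### The elliptic form

A period pair `L` has the periods `(2ω₁, 2ω₃) = (L.ω₁, L.ω₂)`. -/

/-- The half periods `ω₀ = 0`, `ω₁`, `ω₂ = -ω₁ - ω₃`, `ω₃`. -/
def halfPeriod (L : PeriodPair) : Fin 4 → ℂ :=
  ![0, L.ω₁ / 2, -(L.ω₁ / 2) - L.ω₂ / 2, L.ω₂ / 2]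

/-- `e i = ℘(ω_i)` (meaningful for `i = 1, 2, 3`). -/
def halfValue (L : PeriodPair) (i : Fin 4) : ℂ := L.weierstrassP (halfPeriod L i)

/-- The potential
`v(x) = ∑ l_i (l_i+1) ℘(x+ω_i) + ∑ (r_k/2)(r_k/2+1)(℘(x-δ_k)+℘(x+δ_k)) + s_k/(℘(x)-℘(δ_k))`. -/
def potential (L : PeriodPair) (l : Fin 4 → ℕ) {M : ℕ} (r : Fin M → ℕ) (δ s : Fin M → ℂ)
    (x : ℂ) : ℂ :=
  ∑ i, (l i : ℂ) * (l i + 1) * L.weierstrassP (x + halfPeriod L i)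
    + ∑ k, ((r k : ℂ) / 2 * ((r k : ℂ) / 2 + 1) *
          (L.weierstrassP (x - δ k) + L.weierstrassP (x + δ k))
        + s k / (L.weierstrassP x - L.weierstrassP (δ k)))

/-- The accessory parameters `o k` of the Fuchsian equation that corresponds to the elliptic
equation `-f'' + v f = E f`; here `b k = ℘(δ k)`. -/
def accessoryO (e : Fin 4 → ℂ) (l : Fin 4 → ℕ) {M : ℕ} (r : Fin M → ℕ) (b s : Fin M → ℂ)
    (k : Fin M) : ℂ :=
  let g₂ : ℂ := -4 * (e 1 * e 2 + e 2 * e 3 + e 3 * e 1)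
  let g₃ : ℂ := 4 * e 1 * e 2 * e 3;
  (-s k) + r k *
    (1 / 8 * r k * (12 * b k ^ 2 - g₂)
      + 1 / 2 * (4 * b k ^ 3 - g₂ * b k - g₃) *
          (∑ m ∈ Finset.univ.erase k, (r m : ℂ) / (b k - b m))
      + 2 * (l 1 * (b k - e 2) * (b k - e 3) + l 2 * (b k - e 1) * (b k - e 3)
          + l 3 * (b k - e 1) * (b k - e 2)))

/-- The accessory parameter `p` of the Fuchsian equation that corresponds to the elliptic
equation `-f'' + v f = E f`; here `b k = ℘(δ k)`. -/
def accessoryP (e : Fin 4 → ℂ) (l : Fin 4 → ℕ) {M : ℕ} (r : Fin M → ℕ) (b : Fin M → ℂ)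
    (E : ℂ) : ℂ :=
  E + (e 1 * l 1 ^ 2 + e 2 * l 2 ^ 2 + e 3 * l 3 ^ 2)
    - 2 * (l 1 * l 2 * e 3 + l 2 * l 3 * e 1 + l 3 * l 1 * e 2)
    - 1 / 2 * ∑ k, b k * (r k : ℂ) ^ 2
    + 2 * ∑ k, ((l 1 : ℂ) * r k * (e 1 + b k) + (l 2 : ℂ) * r k * (e 2 + b k)
        + (l 3 : ℂ) * r k * (e 3 + b k))
    + 2 * (∑ k, b k * (r k : ℂ)) * (∑ k, (r k : ℂ))

/-- The points congruent to some `ω_i` or some `±δ_k` modulo the period lattice. -/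
def singularSet (L : PeriodPair) {M : ℕ} (δ : Fin M → ℂ) : Set ℂ :=
  {x | (∃ i, x - halfPeriod L i ∈ L.lattice) ∨
    ∃ k, x - δ k ∈ L.lattice ∨ x + δ k ∈ L.lattice}

/-- The expansion
`c₀ + ∑_i ∑_{j<l_i} β_{i,j} ℘(x+ω_i)^{l_i-j} + ∑_k ∑_{j<r_k} d_{k,j} / (℘(x)-℘(δ_k))^{r_k-j}`. -/
def expansion (L : PeriodPair) (l : Fin 4 → ℕ) {M : ℕ} (r : Fin M → ℕ) (δ : Fin M → ℂ)
    (c₀ : ℂ) (β : Fin 4 → ℕ → ℂ) (d : Fin M → ℕ → ℂ) (x : ℂ) : ℂ :=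
  c₀ + ∑ i, ∑ j ∈ Finset.range (l i), β i j * L.weierstrassP (x + halfPeriod L i) ^ (l i - j)
    + ∑ k, ∑ j ∈ Finset.range (r k),
        d k j / (L.weierstrassP x - L.weierstrassP (δ k)) ^ (r k - j)

end TakemuraHeun

end

/-! In the coordinate $z=\wp(x)$ the third-order equation becomes $Df=0$ with
$D=2w\,d^3+3w'd^2+(w''+8u)d+4u'$, where $w=4(z-e_1)(z-e_2)(z-e_3)$ and $u=E-v$. Up to a factor, $D$
is the symmetric square of $w\,d^2+\frac12w'd+u$. A function of $\wp$ is even and doubly periodic,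
so it suffices to find a nonzero rational $f$ with $Df=0$ whose poles have order at most $l_0$ at
$\infty$, $l_i$ at $e_i$ and $r_k$ at $b_k$. The rational functions with these poles form a space
$U$ of dimension $N+1$, where $N=\sum l_i+\sum r_k$.

The operator is skew-adjoint: $f\,Dg+g\,Df$ is a derivative (`mul_symOp_add_mul_symOp`). Hence
$(f,g)\mapsto\mathrm{res}(f\,Dg\,dz)$ is a skew form on Laurent series at each point. Let $n$ be the
permitted pole order there. Since $D$ has a suitable highest exponent, the form on series of order
at least $-n$ only sees a finite window of coefficients, of length $2n+1$ at $\infty$ and $e_i$ and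
$2n+2$ at $b_k$.

In every case the rank is at most $2n$. A skew form on an odd-dimensional space is degenerate, which
settles $\infty$ and $e_i$ (`one_le_finrank_radical`). At $b_k$ the absence of logarithms gives
series solutions $F,G$ of the Fuchsian equation with exponents $0$ and $r_k+1$
(`exists_formal_solutions`). With the gauge factor $\Phi=\prod(z-e_i)^{-l_i}\prod(z-b_k)^{-r_k}$,
the products $\Phi F^2$ and $\Phi FG$ are killed by $D$ (`symOp_mul_mul_eq_zero`) and give two
independent vectors of the radical (`exists_localData_inr`).

By the residue theorem (`sum_residues_eq_zero`), $U$ is isotropic for the orthogonal sum of the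
local forms. That sum has rank at most $2N<2\dim U$, so some nonzero $f\in U$ lies in the radical at
every point (`exists_ne_zero_mem_radical`). Then $Df$ has no finite pole and vanishes at $\infty$,
so $Df=0$ (`exists_symOp_eq_zero`).

What remains is the dictionary with elliptic functions: `fuchs_identity` matches the accessory
parameters with the potential, `potential_eq` expresses $v$ rationally in $\wp$,
`third_order_equation` returns to the variable $x$, and `evalAt_ofParts_eq_expansion` turns partial
fractions in $z$ into the required expansion. -/

noncomputable section

namespace TakemuraHeun

/-! ### Laurent series: leading terms and the derivation -/

open HahnSeries

/-- The coefficientwise `ℂ`-algebra structure on Laurent series, preferred over the one that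
passes through power series. -/
instance laurentSeriesAlgebra : Algebra ℂ (LaurentSeries ℂ) :=
  HahnSeries.instAlgebra

/-- The Laurent series `f` is `c t ^ n` plus higher order terms (`c = 0` is allowed). -/
def HasLead (n : ℤ) (c : ℂ) (f : LaurentSeries ℂ) : Prop :=
  (∀ m < n, f.coeff m = 0) ∧ f.coeff n = c

theorem coeff_coe_of_neg (F : PowerSeries ℂ) {n : ℤ} (hn : n < 0) :
    (F : LaurentSeries ℂ).coeff n = 0 := by
  rw [HahnSeries.ofPowerSeries_apply]
  apply HahnSeries.embDomain_of_notMem_range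
  rintro ⟨k, hk⟩
  have : (k : ℤ) = n := hk
  omega

theorem hasLead_single_mul (n : ℤ) (F : PowerSeries ℂ) :
    HasLead n (PowerSeries.constantCoeff F) (single n 1 * (F : LaurentSeries ℂ)) := by
  refine ⟨fun m hm => ?_, ?_⟩
  · rw [coeff_single_mul, coeff_coe_of_neg F (by omega), mul_zero]
  · rw [coeff_single_mul, sub_self, one_mul]
    simpa using LaurentSeries.coeff_coe_powerSeries F 0

theorem hasLead_coe (F : PowerSeries ℂ) :
    HasLead 0 (PowerSeries.constantCoeff F) (F : LaurentSeries ℂ) := by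
  simpa using hasLead_single_mul 0 F

/-- Reduces products, inverses and the Leibniz rule for Laurent series to power series. -/
theorem HasLead.exists_eq {n : ℤ} {c : ℂ} {f : LaurentSeries ℂ} (h : HasLead n c f) :
    ∃ F : PowerSeries ℂ, PowerSeries.constantCoeff F = c ∧
      f = single n 1 * (F : LaurentSeries ℂ) := by
  refine ⟨PowerSeries.mk fun k => f.coeff (n + k), ?_, ?_⟩
  · rw [← PowerSeries.coeff_zero_eq_constantCoeff_apply, PowerSeries.coeff_mk]
    simpa using h.2
  · ext m
    rw [coeff_single_mul, one_mul]
    rcases lt_or_ge m n with hm | hm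
    · rw [h.1 m hm, coeff_coe_of_neg _ (by omega)]
    · obtain ⟨k, hk⟩ := Int.eq_ofNat_of_zero_le (sub_nonneg.2 hm)
      rw [hk, LaurentSeries.coeff_coe_powerSeries, PowerSeries.coeff_mk]
      congr 1
      omega

theorem HasLead.mul {n m : ℤ} {c d : ℂ} {f g : LaurentSeries ℂ} (hf : HasLead n c f)
    (hg : HasLead m d g) : HasLead (n + m) (c * d) (f * g) := by
  obtain ⟨F, rfl, rfl⟩ := hf.exists_eq
  obtain ⟨G, rfl, rfl⟩ := hg.exists_eq
  have : single n (1 : ℂ) * (F : LaurentSeries ℂ) * (single m 1 * (G : LaurentSeries ℂ))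
      = single (n + m) 1 * ((F * G : PowerSeries ℂ) : LaurentSeries ℂ) := by
    rw [PowerSeries.coe_mul, show (single (n + m) (1 : ℂ) : LaurentSeries ℂ)
      = single n 1 * single m 1 by rw [single_mul_single, mul_one]]
    ring
  rw [this]
  simpa using hasLead_single_mul (n + m) (F * G)

theorem HasLead.add {n : ℤ} {c d : ℂ} {f g : LaurentSeries ℂ} (hf : HasLead n c f)
    (hg : HasLead n d g) : HasLead n (c + d) (f + g) :=
  ⟨fun m hm => by rw [coeff_add, hf.1 m hm, hg.1 m hm, add_zero], by
    rw [coeff_add, hf.2, hg.2]⟩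

theorem HasLead.sub {n : ℤ} {c d : ℂ} {f g : LaurentSeries ℂ} (hf : HasLead n c f)
    (hg : HasLead n d g) : HasLead n (c - d) (f - g) :=
  ⟨fun m hm => by rw [coeff_sub, hf.1 m hm, hg.1 m hm, sub_zero], by
    rw [coeff_sub, hf.2, hg.2]⟩

theorem HasLead.mono {n m : ℤ} {c : ℂ} {f : LaurentSeries ℂ} (hf : HasLead n c f) (h : m < n) :
    HasLead m 0 f :=
  ⟨fun k hk => hf.1 k (hk.trans h), hf.1 m h⟩

theorem HasLead.exists_of_le {n m : ℤ} {c : ℂ} {f : LaurentSeries ℂ} (hf : HasLead n c f)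
    (h : m ≤ n) : ∃ d, HasLead m d f :=
  ⟨_, fun k hk => hf.1 k (hk.trans_le h), rfl⟩

theorem hasLead_zero (n : ℤ) : HasLead n 0 (0 : LaurentSeries ℂ) :=
  ⟨fun _ _ => coeff_zero, coeff_zero⟩

theorem hasLead_single (n : ℤ) (c : ℂ) : HasLead n c (single n c) :=
  ⟨fun m hm => by rw [coeff_single_of_ne hm.ne], by rw [coeff_single_same]⟩

theorem algebraMap_eq_single (c : ℂ) :
    algebraMap ℂ (LaurentSeries ℂ) c = single 0 c := by
  rw [Algebra.algebraMap_eq_smul_one, ← single_zero_one]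
  ext n
  rw [coeff_smul, coeff_single, coeff_single]
  split_ifs <;> simp

theorem hasLead_algebraMap (c : ℂ) : HasLead 0 c (algebraMap ℂ (LaurentSeries ℂ) c) := by
  rw [algebraMap_eq_single]
  exact hasLead_single 0 c

theorem HasLead.inv {n : ℤ} {c : ℂ} {f : LaurentSeries ℂ} (hf : HasLead n c f) (hc : c ≠ 0) :
    HasLead (-n) c⁻¹ f⁻¹ := by
  obtain ⟨F, hF, rfl⟩ := hf.exists_eq
  have h1 : F * F⁻¹ = 1 := PowerSeries.mul_inv_cancel F (by rwa [hF])
  have : (single n (1 : ℂ) * (F : LaurentSeries ℂ))⁻¹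
      = single (-n) 1 * ((F⁻¹ : PowerSeries ℂ) : LaurentSeries ℂ) := by
    refine (eq_inv_of_mul_eq_one_right ?_).symm
    calc _ = (single n (1 : ℂ) * single (-n) 1)
          * ((F * F⁻¹ : PowerSeries ℂ) : LaurentSeries ℂ) := by
          rw [PowerSeries.coe_mul]; ring
      _ = 1 := by rw [h1, single_mul_single]; simp
  rw [this]
  have h2 := hasLead_single_mul (-n) F⁻¹
  rwa [PowerSeries.constantCoeff_inv, hF] at h2

theorem HasLead.pow {n : ℤ} {c : ℂ} {f : LaurentSeries ℂ} (hf : HasLead n c f) (k : ℕ) :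
    HasLead (k * n) (c ^ k) (f ^ k) := by
  induction k with
  | zero => simpa using hasLead_algebraMap 1
  | succ k ih =>
    have := ih.mul hf
    rw [pow_succ, pow_succ]
    convert! this using 1
    push_cast; ring

theorem HasLead.sum {ι : Type*} (s : Finset ι) {n : ℤ} {c : ι → ℂ} {f : ι → LaurentSeries ℂ}
    (hf : ∀ i ∈ s, HasLead n (c i) (f i)) : HasLead n (∑ i ∈ s, c i) (∑ i ∈ s, f i) := by
  classical
  induction s using Finset.induction_on with
  | empty => simpa using hasLead_zero n
  | insert a s ha ih =>
    rw [Finset.sum_insert ha, Finset.sum_insert ha]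
    exact (hf a (by simp)).add (ih fun i hi => hf i (by simp [hi]))

theorem HasLead.ne_zero {n : ℤ} {c : ℂ} {f : LaurentSeries ℂ} (hf : HasLead n c f) (hc : c ≠ 0) :
    f ≠ 0 := by
  rintro rfl
  exact hc (hf.2.symm.trans coeff_zero)

theorem derivative_coeff (f : LaurentSeries ℂ) (n : ℤ) :
    (LaurentSeries.derivative ℂ f).coeff n = (n + 1) * f.coeff (n + 1) := by
  rw [LaurentSeries.derivative_apply, LaurentSeries.hasseDeriv_coeff]
  simp

theorem derivative_single_mul (n : ℤ) (F : PowerSeries ℂ) :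
    LaurentSeries.derivative ℂ (single n 1 * (F : LaurentSeries ℂ))
      = (n : ℂ) • (single (n - 1) 1 * (F : LaurentSeries ℂ))
        + single n 1 * ((PowerSeries.derivative ℂ F : PowerSeries ℂ) : LaurentSeries ℂ) := by
  ext m
  rw [derivative_coeff, coeff_add, coeff_smul, coeff_single_mul, coeff_single_mul,
    coeff_single_mul, show m + 1 - n = m - n + 1 by ring, show m - (n - 1) = m - n + 1 by ring,
    one_mul, one_mul, smul_eq_mul]
  obtain ⟨j, rfl⟩ : ∃ j, m = n + j := ⟨m - n, by ring⟩
  rw [show n + j - n = j by ring]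
  rcases lt_trichotomy j (-1) with hj | rfl | hj
  · rw [coeff_coe_of_neg F (by omega), coeff_coe_of_neg _ (by omega)]; simp
  · rw [coeff_coe_of_neg (PowerSeries.derivative ℂ F) (by omega)]; push_cast; ring
  · obtain ⟨k, rfl⟩ := Int.eq_ofNat_of_zero_le (show 0 ≤ j by omega)
    rw [LaurentSeries.coeff_coe_powerSeries, ← Nat.cast_succ, LaurentSeries.coeff_coe_powerSeries,
      PowerSeries.coeff_derivative]
    push_cast; ring

/-- Differentiation of Laurent series, as a derivation. -/
def lsDeriv : Derivation ℂ (LaurentSeries ℂ) (LaurentSeries ℂ) :=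
  Derivation.mk'
    { toFun := fun f => LaurentSeries.derivative ℂ f
      map_add' := fun f g => map_add _ f g
      map_smul' := fun c f => by
        ext n
        rw [derivative_coeff, RingHom.id_apply, coeff_smul, coeff_smul, derivative_coeff,
          smul_eq_mul, smul_eq_mul, mul_left_comm] } fun f g => by
    change LaurentSeries.derivative ℂ (f * g) = f • LaurentSeries.derivative ℂ g
      + g • LaurentSeries.derivative ℂ f
    -- The Leibniz rule is known for power series, so both factors are written as $t^nF$ and
    -- $(t^nF)'=nt^{n-1}F+t^nF'$ is used.
    obtain ⟨n, c, hf⟩ : ∃ n c, HasLead n c f :=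
      ⟨f.order, _, fun m hm => coeff_eq_zero_of_lt_order hm, rfl⟩
    obtain ⟨m, d, hg⟩ : ∃ n c, HasLead n c g :=
      ⟨g.order, _, fun m hm => coeff_eq_zero_of_lt_order hm, rfl⟩
    obtain ⟨F, -, rfl⟩ := hf.exists_eq
    obtain ⟨G, -, rfl⟩ := hg.exists_eq
    have key : single n (1 : ℂ) * (F : LaurentSeries ℂ) * (single m 1 * (G : LaurentSeries ℂ))
      = single (n + m) 1 * ((F * G : PowerSeries ℂ) : LaurentSeries ℂ) := by
      rw [PowerSeries.coe_mul, show (single (n + m) (1 : ℂ) : LaurentSeries ℂ)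
        = single n 1 * single m 1 by rw [single_mul_single, mul_one]]
      ring
    rw [key, derivative_single_mul, derivative_single_mul, derivative_single_mul,
      Derivation.leibniz, show (single (n + m) (1 : ℂ) : LaurentSeries ℂ)
        = single n 1 * single m 1 by rw [single_mul_single, mul_one],
      show (single (n + m - 1) (1 : ℂ) : LaurentSeries ℂ)
        = single (-1) 1 * (single n 1 * single m 1) by
          rw [single_mul_single, single_mul_single]; congr 1 <;> ring_nf,
      show (single (n - 1) (1 : ℂ) : LaurentSeries ℂ)
        = single (-1) 1 * single n 1 by rw [single_mul_single]; congr 1 <;> ring_nf,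
      show (single (m - 1) (1 : ℂ) : LaurentSeries ℂ)
        = single (-1) 1 * single m 1 by rw [single_mul_single]; congr 1 <;> ring_nf]
    simp only [Algebra.smul_def, smul_eq_mul, PowerSeries.coe_mul, PowerSeries.coe_add,
      Algebra.algebraMap_self, RingHom.id_apply]
    push_cast
    ring

theorem lsDeriv_coeff (f : LaurentSeries ℂ) (n : ℤ) :
    (lsDeriv f).coeff n = (n + 1) * f.coeff (n + 1) :=
  derivative_coeff f n

theorem lsDeriv_coe (F : PowerSeries ℂ) :
    lsDeriv (F : LaurentSeries ℂ) = ((PowerSeries.derivative ℂ F : PowerSeries ℂ) :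
      LaurentSeries ℂ) := by
  have := derivative_single_mul 0 F
  rw [single_zero_one, one_mul, one_mul, Int.cast_zero, zero_smul, zero_add] at this
  exact this

theorem lsDeriv_single (n : ℤ) (c : ℂ) : lsDeriv (single n c) = single (n - 1) (n * c) := by
  ext m
  rw [lsDeriv_coeff, coeff_single, coeff_single]
  by_cases h : m + 1 = n
  · rw [if_pos h, if_pos (by omega), ← h]; push_cast; ring
  · rw [if_neg h, if_neg (by omega), mul_zero]

theorem HasLead.deriv {n : ℤ} {c : ℂ} {f : LaurentSeries ℂ} (hf : HasLead n c f) :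
    HasLead (n - 1) (n * c) (lsDeriv f) := by
  refine ⟨fun m hm => ?_, ?_⟩
  · rw [lsDeriv_coeff, hf.1 _ (by omega), mul_zero]
  · rw [lsDeriv_coeff, sub_add_cancel, hf.2]; push_cast; ring

end TakemuraHeun

end

noncomputable section

namespace TakemuraHeun

/-! ### The third-order operator and its residue form -/

open HahnSeries

section SymOp

variable {A : Type*} [CommRing A] [Algebra ℂ A]

/-- Twice the operator `w d³ + (3/2) w' d² + (w''/2 + 4 u) d + 2 u'`, the symmetric square of
`w d² + (w'/2) d + u`. -/
def symOp (d : Derivation ℂ A A) (w u f : A) : A :=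
  2 * w * d (d (d f)) + 3 * d w * d (d f) + d (d w) * d f + 8 * u * d f + 4 * d u * f

theorem symOp_add (d : Derivation ℂ A A) (w u f g : A) :
    symOp d w u (f + g) = symOp d w u f + symOp d w u g := by
  simp only [symOp, map_add]
  ring

theorem symOp_smul (d : Derivation ℂ A A) (w u : A) (c : ℂ) (f : A) :
    symOp d w u (c • f) = c • symOp d w u f := by
  simp only [symOp, Derivation.map_smul]
  simp only [Algebra.smul_def]
  ring

/-- The operator is skew-adjoint. -/
theorem mul_symOp_add_mul_symOp (d : Derivation ℂ A A) (w u f g : A) :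
    f * symOp d w u g + g * symOp d w u f
      = d (f * (2 * w * d (d g) + d w * d g) + g * (2 * w * d (d f) + d w * d f)
        - 2 * w * (d f * d g) + 8 * u * (f * g)) := by
  have h2 : d (2 : A) = 0 := by simpa using d.map_natCast 2
  have h8 : d (8 : A) = 0 := by simpa using d.map_natCast 8
  simp only [symOp, map_add, map_sub, Derivation.leibniz, smul_eq_mul, h2, h8]
  ring

/-- Formally put $\Phi=\phi^2$. The conditions `hP` and `hQ` say that $f=\phi F$ and $g=\phi G$
solve $wy''+\frac12w'y'+uy=0$, and $D$ kills products of such solutions. Only $\Phi$ enters, since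
$\phi$ would involve half-integral powers. -/
theorem symOp_mul_mul_eq_zero {A : Type*} [Field A] [Algebra ℂ A] (d : Derivation ℂ A A)
    {w u P Q θ Φ F G : A}
    (hF : d (d F) + P * d F + Q * F = 0) (hG : d (d G) + P * d G + Q * G = 0)
    (hΦ : d Φ = θ * Φ) (hP : 2 * w * P = 2 * w * θ + d w)
    (hQ : 4 * w * Q = 2 * w * d θ + w * θ ^ 2 + θ * d w + 4 * u) :
    symOp d w u (Φ * F * G) = 0 := by
  set y := Φ * F * G with hy
  set m := Φ * (d F * G + F * d G) with hm
  set k := Φ * (d F * d G) with hk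
  have hy' : d y = θ * y + m := by
    simp only [hy, hm, Derivation.leibniz, smul_eq_mul, hΦ]; ring
  have hF2 : d (d F) = -(P * d F + Q * F) := by linear_combination hF
  have hG2 : d (d G) = -(P * d G + Q * G) := by linear_combination hG
  have hm' : d m = θ * m + 2 * k - P * m - 2 * Q * y := by
    simp only [hm, hy, hk, Derivation.leibniz, smul_eq_mul, hΦ, map_add, hF2, hG2]; ring
  have hk' : d k = θ * k - 2 * P * k - Q * m := by
    simp only [hm, hk, Derivation.leibniz, smul_eq_mul, hΦ, hF2, hG2]; ring
  -- In the formal notation, $n=4f'g'$ and $y=fg$. The identities `key1` and `key2` express $y''$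
  -- and $n'$ through $y,y',n$; differentiating the first and inserting the second eliminates $n$.
  set n := 4 * k + 2 * θ * m + θ ^ 2 * y with hn
  have h2 : d (2 : A) = 0 := by simpa using d.map_natCast 2
  have h4 : d (4 : A) = 0 := by simpa using d.map_natCast 4
  have hy'' : d (d y) = d θ * y + θ * (θ * y + m) + (θ * m + 2 * k - P * m - 2 * Q * y) := by
    rw [hy', map_add, Derivation.leibniz, hy', hm']; simp only [smul_eq_mul]; ring
  have hn' : d n = 4 * (θ * k - 2 * P * k - Q * m) + 2 * d θ * m
      + 2 * θ * (θ * m + 2 * k - P * m - 2 * Q * y) + 2 * θ * d θ * y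
      + θ ^ 2 * (θ * y + m) := by
    simp only [hn, map_add, Derivation.leibniz, smul_eq_mul, h2, h4, hk', hm', hy',
      Derivation.leibniz_pow]
    simp only [nsmul_eq_mul]
    push_cast
    ring
  have key1 : 2 * w * d (d y) + d w * d y + 4 * u * y = w * n := by
    rw [hy'', hy', hn]
    linear_combination (-m) * hP - y * hQ
  have key2 : w * d n = - d w * n - 4 * u * d y := by
    rw [hn', hn, hy']
    linear_combination (-4 * k - m * θ) * hP - (m + θ * y) * hQ
  have key3 := congrArg d key1
  simp only [map_add, Derivation.leibniz, smul_eq_mul, h2, h4] at key3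
  rw [symOp]
  linear_combination key3 + key2

/-- Change of the independent variable in the operator: `δ` differentiates with respect to a
coordinate `z`, and `d` with respect to a coordinate `t` with `q = dz/dt`. -/
theorem symOp_change {A B : Type*} [CommRing A] [Algebra ℂ A] [Field B] [Algebra ℂ B]
    (δ : Derivation ℂ A A) (d : Derivation ℂ B B) (ι : A →ₐ[ℂ] B) (q : B) (hq : q ≠ 0)
    (h : ∀ a, d (ι a) = q * ι (δ a)) (w u f : A) :
    symOp d (ι w / q ^ 2) (ι u) (ι f) = q * ι (symOp δ w u f) := by
  set v := ι w / q ^ 2 with hv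
  have hw : ι w = v * q ^ 2 := by rw [hv]; field_simp
  have hw1 : q * ι (δ w) = d v * q ^ 2 + 2 * v * q * d q := by
    rw [← h, hw]
    simp only [Derivation.leibniz, Derivation.leibniz_pow, smul_eq_mul, nsmul_eq_mul]
    push_cast
    ring
  have hw1' : ι (δ w) = d v * q + 2 * v * d q := by
    apply mul_left_cancel₀ hq
    rw [hw1]; ring
  have h2 : d (2 : B) = 0 := by simpa using d.map_natCast 2
  have hw2 : q * ι (δ (δ w)) = d (d v) * q + 3 * d v * d q + 2 * v * d (d q) := by
    rw [← h, hw1']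
    simp only [map_add, Derivation.leibniz, smul_eq_mul, h2]
    ring
  simp only [symOp, map_add, map_mul, map_ofNat, h, Derivation.leibniz, smul_eq_mul, hw, hw1']
  linear_combination (-ι (δ f)) * hw2

end SymOp

/-! ### The residue form -/

/-- The bilinear form `(f, g) ↦ res (f D g)`. -/
def resForm (w u : LaurentSeries ℂ) : LinearMap.BilinForm ℂ (LaurentSeries ℂ) :=
  LinearMap.mk₂ ℂ (fun f g => (f * symOp lsDeriv w u g).coeff (-1))
    (fun f f' g => by rw [add_mul, coeff_add])
    (fun c f g => by
      rw [← single_zero_mul_eq_smul, mul_assoc, single_zero_mul_eq_smul, coeff_smul])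
    (fun f g g' => by rw [symOp_add, mul_add, coeff_add])
    (fun c f g => by
      change (f * symOp lsDeriv w u (c • g)).coeff (-1) = _
      rw [symOp_smul]
      change (f * (c • _ : LaurentSeries ℂ)).coeff (-1) = _
      rw [← single_zero_mul_eq_smul, mul_left_comm, single_zero_mul_eq_smul, coeff_smul])

theorem resForm_apply (w u f g : LaurentSeries ℂ) :
    resForm w u f g = (f * symOp lsDeriv w u g).coeff (-1) := rfl

/-- By skew-adjointness the sum of the two sides is the residue of a derivative, and a derivative
has no $t^{-1}$ term. -/
theorem resForm_skew (w u f g : LaurentSeries ℂ) : resForm w u f g = - resForm w u g f := by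
  rw [eq_neg_iff_add_eq_zero, resForm_apply, resForm_apply, ← coeff_add,
    mul_symOp_add_mul_symOp, lsDeriv_coeff]
  simp

/-- The characteristic polynomial: `D t ^ k` has the leading term
`indicial α w₀ u₀ k * t ^ (k + α - 3)`. -/
def indicial (α : ℤ) (w₀ u₀ : ℂ) (k : ℤ) : ℂ :=
  2 * w₀ * (k * (k - 1) * (k - 2)) + 3 * (α * w₀) * (k * (k - 1)) + α * (α - 1) * w₀ * k
    + 8 * u₀ * k + 4 * (α - 2) * u₀

theorem HasLead.symOp {α k : ℤ} {w₀ u₀ c : ℂ} {w u f : LaurentSeries ℂ} (hw : HasLead α w₀ w)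
    (hu : HasLead (α - 2) u₀ u) (hf : HasLead k c f) :
    HasLead (k + α - 3) (c * indicial α w₀ u₀ k) (symOp lsDeriv w u f) := by
  have hn (n : ℕ) [n.AtLeastTwo] :
      HasLead 0 (OfNat.ofNat n : ℂ) (OfNat.ofNat n : LaurentSeries ℂ) := by
    have := hasLead_algebraMap (OfNat.ofNat n : ℂ)
    rwa [map_ofNat] at this
  have h1 := ((hn 2).mul hw).mul hf.deriv.deriv.deriv
  have h2 := ((hn 3).mul hw.deriv).mul hf.deriv.deriv
  have h3 := hw.deriv.deriv.mul hf.deriv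
  have h4 := ((hn 8).mul hu).mul hf.deriv
  have h5 := ((hn 4).mul hu.deriv).mul hf
  rw [show (0 : ℤ) + α + (k - 1 - 1 - 1) = k + α - 3 by ring] at h1
  rw [show (0 : ℤ) + (α - 1) + (k - 1 - 1) = k + α - 3 by ring] at h2
  rw [show (α - 1 - 1) + (k - 1) = k + α - 3 by ring] at h3
  rw [show (0 : ℤ) + (α - 2) + (k - 1) = k + α - 3 by ring] at h4
  rw [show (0 : ℤ) + (α - 2 - 1) + k = k + α - 3 by ring] at h5
  have := (((h1.add h2).add h3).add h4).add h5
  convert! this using 1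
  rw [indicial]
  push_cast
  ring

/-- The data of the operator at a singular point: `w` vanishes to order `α`, the pole of `u`
has order at most `2 - α`, and `-n`, `n + 2 - α` are characteristic exponents. -/
structure LocalData where
  /-- The coefficient `w`. -/
  w : LaurentSeries ℂ
  /-- The coefficient `u`. -/
  u : LaurentSeries ℂ
  /-- The order of vanishing of `w`. -/
  α : ℤ
  /-- The leading coefficient of `w`. -/
  w₀ : ℂ
  /-- The leading coefficient of `u`. -/
  u₀ : ℂ
  /-- Minus the lowest exponent. -/
  n : ℕ
  /-- The number of powers of `t` between the lowest and the highest exponent. -/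
  size : ℕ
  lead_w : HasLead α w₀ w
  lead_u : HasLead (α - 2) u₀ u
  size_eq : (size : ℤ) = 2 * n + 2 - α
  indicial_eq : indicial α w₀ u₀ (size - n) = 0

namespace LocalData

variable (S : LocalData)

/-- The product $f\,Dg$ begins at $t^{-1}$, and its coefficient there contains the characteristic
polynomial at `size - n`, which is an exponent. -/
theorem resForm_eq_zero {c c' : ℂ} {f g : LaurentSeries ℂ} (hf : HasLead (-S.n) c f)
    (hg : HasLead (S.size - S.n) c' g) : resForm S.w S.u f g = 0 := by
  have h := hf.mul (HasLead.symOp S.lead_w S.lead_u hg)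
  rw [S.indicial_eq, mul_zero, mul_zero] at h
  have := h.2
  rw [show -(S.n : ℤ) + (S.size - S.n + S.α - 3) = -1 by rw [S.size_eq]; ring] at this
  exact this

/-- The truncation of Laurent series to the powers `t ^ (-n), …, t ^ (size - n - 1)`. -/
def trunc : LaurentSeries ℂ →ₗ[ℂ] (Fin S.size → ℂ) where
  toFun f i := f.coeff (-S.n + i)
  map_add' _ _ := rfl
  map_smul' _ _ := rfl

/-- The Laurent polynomial with the given coefficients at `t ^ (-n), …, t ^ (size - n - 1)`. -/
def embed : (Fin S.size → ℂ) →ₗ[ℂ] LaurentSeries ℂ where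
  toFun v := ∑ i : Fin S.size, single (-S.n + i : ℤ) (v i)
  map_add' v v' := by simp [Finset.sum_add_distrib]
  map_smul' c v := by
    simp only [Pi.smul_apply, RingHom.id_apply, Finset.smul_sum]
    refine Finset.sum_congr rfl fun i _ => ?_
    ext n
    rw [coeff_smul, coeff_single, coeff_single]
    split_ifs <;> simp

theorem embed_apply (v : Fin S.size → ℂ) :
    S.embed v = ∑ i : Fin S.size, single (-S.n + i : ℤ) (v i) := rfl

theorem trunc_apply (f : LaurentSeries ℂ) (i : Fin S.size) :
    S.trunc f i = f.coeff (-S.n + i) := rfl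

theorem coeff_embed (v : Fin S.size → ℂ) (i : Fin S.size) :
    (S.embed v).coeff (-S.n + i) = v i := by
  rw [embed_apply, coeff_sum, Finset.sum_eq_single i]
  · simp
  · intro j _ hj
    rw [coeff_single_of_ne]
    intro h
    exact hj (Fin.ext (by omega))
  · simp

theorem hasLead_embed (v : Fin S.size → ℂ) : ∃ c, HasLead (-S.n) c (S.embed v) := by
  refine ⟨_, fun m hm => ?_, rfl⟩
  rw [embed_apply, coeff_sum]
  exact Finset.sum_eq_zero fun i _ => coeff_single_of_ne (by omega)

theorem hasLead_sub_embed {c : ℂ} {f : LaurentSeries ℂ} (hf : HasLead (-S.n) c f) :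
    ∃ c', HasLead (S.size - S.n) c' (f - S.embed (S.trunc f)) := by
  refine ⟨_, fun m hm => ?_, rfl⟩
  rw [coeff_sub]
  rcases lt_or_ge m (-S.n : ℤ) with h | h
  · rw [hf.1 m h, S.hasLead_embed _ |>.choose_spec.1 m h, sub_zero]
  · obtain ⟨i, hi⟩ := Int.eq_ofNat_of_zero_le (show 0 ≤ m + S.n by omega)
    have hi' : i < S.size := by omega
    obtain rfl : m = -S.n + (⟨i, hi'⟩ : Fin S.size) := by simp only; omega
    rw [coeff_embed, trunc_apply, sub_self]

/-- The residue form on truncated Laurent series. -/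
def form : LinearMap.BilinForm ℂ (Fin S.size → ℂ) :=
  (resForm S.w S.u).compl₁₂ S.embed S.embed

theorem form_apply (v v' : Fin S.size → ℂ) :
    S.form v v' = resForm S.w S.u (S.embed v) (S.embed v') := rfl

theorem form_skew (v v' : Fin S.size → ℂ) : S.form v v' = - S.form v' v :=
  resForm_skew _ _ _ _

/-- The tail discarded by truncation starts at the highest exponent, where `resForm_eq_zero`
applies; so the residue form descends to the finite window. -/
theorem resForm_embed_trunc {c c' : ℂ} {f g : LaurentSeries ℂ} (hf : HasLead (-S.n) c f)
    (hg : HasLead (-S.n) c' g) :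
    resForm S.w S.u f (S.embed (S.trunc g)) = resForm S.w S.u f g := by
  obtain ⟨_, h⟩ := S.hasLead_sub_embed hg
  have := S.resForm_eq_zero hf h
  rw [map_sub, sub_eq_zero] at this
  exact this.symm

theorem form_trunc {c c' : ℂ} {f g : LaurentSeries ℂ} (hf : HasLead (-S.n) c f)
    (hg : HasLead (-S.n) c' g) : S.form (S.trunc f) (S.trunc g) = resForm S.w S.u f g := by
  rw [form_apply, S.resForm_embed_trunc (S.hasLead_embed _).choose_spec hg, resForm_skew,
    S.resForm_embed_trunc hg hf, ← resForm_skew]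

/-- The radical of the residue form on truncated Laurent series. -/
def radical : Submodule ℂ (Fin S.size → ℂ) := LinearMap.ker S.form.flip

theorem mem_radical {v : Fin S.size → ℂ} : v ∈ S.radical ↔ ∀ v', S.form v' v = 0 := by
  rw [radical, LinearMap.mem_ker, LinearMap.ext_iff]
  rfl

theorem trunc_mem_radical {c : ℂ} {f : LaurentSeries ℂ} (hf : HasLead (-S.n) c f)
    (h : symOp lsDeriv S.w S.u f = 0) : S.trunc f ∈ S.radical := by
  rw [mem_radical]
  intro v
  rw [form_apply, S.resForm_embed_trunc (S.hasLead_embed _).choose_spec hf, resForm_apply, h,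
    mul_zero, coeff_zero]

/-- If the truncation of `f` is in the radical, then `D f` vanishes to order `n`. -/
theorem hasLead_symOp_of_mem_radical {c : ℂ} {f : LaurentSeries ℂ} (hf : HasLead (-S.n) c f)
    (h : S.trunc f ∈ S.radical) : ∃ c', HasLead S.n c' (symOp lsDeriv S.w S.u f) := by
  refine ⟨_, fun m hm => ?_, rfl⟩
  -- Pairing with $t^{-1-m}$ reads off the coefficient of $Df$ at $t^m$. This monomial has order at
  -- least $-n$ exactly because $m<n$.
  have key : resForm S.w S.u (single (-1 - m) 1) f = 0 := by
    obtain ⟨d, hd⟩ := (hasLead_single (-1 - m) 1).exists_of_le (m := -S.n) (by omega)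
    rw [← S.form_trunc hd hf]
    exact S.mem_radical.1 h _
  rw [resForm_apply, coeff_single_mul, one_mul] at key
  rw [← key]
  congr 1
  ring

/-- A skew matrix $A$ of odd size satisfies $\det A=\det A^{T}=-\det A$, so it is singular. -/
theorem one_le_finrank_radical (h : Odd S.size) : 1 ≤ Module.finrank ℂ S.radical := by
  set A : Matrix (Fin S.size) (Fin S.size) ℂ := LinearMap.BilinForm.toMatrix' S.form with hA
  have hT : A.transpose = -A := by
    ext i j
    simp only [hA, Matrix.transpose_apply, Matrix.neg_apply, LinearMap.BilinForm.toMatrix'_apply]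
    exact S.form_skew _ _
  have hdet : A.det = 0 := by
    have h1 := A.det_transpose
    rw [hT, Matrix.det_neg, Fintype.card_fin, h.neg_one_pow] at h1
    linear_combination (-1 / 2 : ℂ) * h1
  obtain ⟨v, hv, hv0⟩ := Matrix.exists_mulVec_eq_zero_iff.2 hdet
  have hmem : v ∈ S.radical := by
    rw [mem_radical]
    intro v'
    have : S.form v' v = v' ⬝ᵥ (A.mulVec v) := by
      rw [hA, ← Matrix.toBilin'_apply', Matrix.toBilin'_toMatrix']
    rw [this, hv0, dotProduct_zero]
  rw [Nat.one_le_iff_ne_zero, ← Nat.pos_iff_ne_zero, Module.finrank_pos_iff_exists_ne_zero]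
  exact ⟨⟨v, hmem⟩, fun h => hv (congrArg Subtype.val h)⟩

/-- Solutions pair to zero with everything, and two of them with different leading exponents inside
the window stay independent after truncation. -/
theorem two_le_finrank_radical {f g : LaurentSeries ℂ} {m : ℤ} {x y : ℂ} (hx : x ≠ 0)
    (hy : y ≠ 0) (hf : HasLead (-S.n) x f) (hg : HasLead m y g) (hm : -(S.n : ℤ) < m)
    (hm' : m < S.size - S.n) (h : symOp lsDeriv S.w S.u f = 0)
    (h' : symOp lsDeriv S.w S.u g = 0) : 2 ≤ Module.finrank ℂ S.radical := by
  obtain ⟨c, hg'⟩ := hg.exists_of_le hm.le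
  have hind : LinearIndependent ℂ ![(⟨S.trunc f, S.trunc_mem_radical hf h⟩ : S.radical),
      ⟨S.trunc g, S.trunc_mem_radical hg' h'⟩] := by
    rw [LinearIndependent.pair_iff]
    intro a b hab
    have hab' : ∀ i : Fin S.size, a * f.coeff (-S.n + i) + b * g.coeff (-S.n + i) = 0 :=
      fun i => congrFun (congrArg Subtype.val hab) i
    have h0 := hab' ⟨0, by omega⟩
    obtain ⟨j, hj⟩ := Int.eq_ofNat_of_zero_le (show 0 ≤ m + S.n by omega)
    have h1 := hab' ⟨j, by omega⟩
    simp only [Nat.cast_zero, add_zero] at h0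
    rw [hf.2, hg.1 _ hm] at h0
    have ha : a = 0 := by simpa [hx] using h0
    rw [show -(S.n : ℤ) + (j : ℤ) = m by omega, hg.2, ha] at h1
    exact ⟨ha, by simpa [hy] using h1⟩
  simpa using hind.fintype_card_le_finrank

end LocalData

end TakemuraHeun

end

noncomputable section

namespace TakemuraHeun

/-! ### Isotropic subspaces of a direct sum -/

/-- An isotropic subspace whose dimension exceeds half of the rank of a skew-symmetric form meets
the radical. -/
theorem exists_ne_zero_mem_radical {I U : Type*} [Fintype I] {V : I → Type*}
    [∀ i, AddCommGroup (V i)] [∀ i, Module ℂ (V i)] [∀ i, FiniteDimensional ℂ (V i)]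
    [AddCommGroup U] [Module ℂ U] [FiniteDimensional ℂ U]
    (B : ∀ i, LinearMap.BilinForm ℂ (V i)) (hB : ∀ i x y, B i x y = - B i y x)
    (n : I → ℕ)
    (hn : ∀ i, Module.finrank ℂ (V i)
      ≤ 2 * n i + Module.finrank ℂ (LinearMap.ker (B i).flip))
    (hU : ∑ i, n i < Module.finrank ℂ U) (φ : U →ₗ[ℂ] (∀ i, V i))
    (hφ : ∀ x y, ∑ i, B i (φ x i) (φ y i) = 0) :
    ∃ x ≠ 0, ∀ i, φ x i ∈ LinearMap.ker (B i).flip := by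
  classical
  by_contra! hcon
  set T : LinearMap.BilinForm ℂ (∀ i, V i) :=
    ∑ i, (B i).compl₁₂ (LinearMap.proj i) (LinearMap.proj i) with hT
  have hTa : ∀ x y, T x y = ∑ i, B i (x i) (y i) := fun x y => by
    simp [hT, LinearMap.sum_apply]
  have hTs : ∀ x y, T x y = - T y x := fun x y => by
    rw [hTa, hTa, ← Finset.sum_neg_distrib]
    exact Finset.sum_congr rfl fun i _ => hB i _ _
  have hrefl : T.IsRefl := fun x y h => by rw [hTs, h, neg_zero]
  set R := fun i => LinearMap.ker (B i).flip with hR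
  have hRm : ∀ i (y : V i), y ∈ R i ↔ ∀ x, B i x y = 0 := fun i y => by
    rw [hR, LinearMap.mem_ker, LinearMap.ext_iff]; rfl
  -- If $U$ avoided the radical, then $U$ and the radicals together would embed as an isotropic $W$.
  -- But $2\dim W\le\dim W+\dim W^\perp=\dim V+\dim(W\cap V^\perp)$, and the rank bound `hn` makes
  -- the right side too small.
  let ψ : (U × (∀ i, R i)) →ₗ[ℂ] (∀ i, V i) :=
    φ.coprod (LinearMap.pi fun i => (R i).subtype.comp (LinearMap.proj i))
  have hψ : ∀ p i, ψ p i = φ p.1 i + p.2 i := fun p i => by simp [ψ]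
  have hinj : Function.Injective ψ := by
    rw [injective_iff_map_eq_zero]
    rintro ⟨x, ρ⟩ h
    have h' : ∀ i, φ x i + ρ i = 0 := fun i => by rw [← hψ (x, ρ) i, h]; rfl
    have hx : x = 0 := by
      by_contra hx
      obtain ⟨i, hi⟩ := hcon x hx
      refine hi ?_
      rw [eq_neg_of_add_eq_zero_left (h' i)]
      exact (R i).neg_mem (ρ i).2
    subst hx
    refine Prod.ext rfl (funext fun i => Subtype.ext ?_)
    simpa using h' i
  set W := LinearMap.range ψ with hW
  have hdW : Module.finrank ℂ W = Module.finrank ℂ U + ∑ i, Module.finrank ℂ (R i) := by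
    rw [hW, LinearMap.finrank_range_of_inj hinj, Module.finrank_prod, Module.finrank_pi_fintype]
  have hiso : W ≤ T.orthogonal W := by
    rintro _ ⟨p, rfl⟩ _ ⟨q, rfl⟩
    change T (ψ q) (ψ p) = 0
    rw [hTa, ← hφ q.1 p.1]
    refine Finset.sum_congr rfl fun i _ => ?_
    rw [hψ, hψ, map_add, (hRm i _).1 (p.2 i).2, add_zero, hB, map_add, (hRm i _).1 (q.2 i).2,
      add_zero, ← hB]
  have hrad : Module.finrank ℂ (W ⊓ T.orthogonal ⊤ : Submodule ℂ (∀ i, V i))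
      ≤ ∑ i, Module.finrank ℂ (R i) := by
    rw [← Module.finrank_pi_fintype ℂ]
    have : ∀ x ∈ (W ⊓ T.orthogonal ⊤ : Submodule ℂ (∀ i, V i)), ∀ i, x i ∈ R i := by
      intro x hx i
      rw [hRm]
      intro y
      -- Testing against vectors supported in one summand shows that the radical of the sum lies in
      -- the product of the radicals.
      have h := hx.2 (Pi.single i y) trivial
      change T _ _ = 0 at h
      rw [hTa, Finset.sum_eq_single i] at h
      · simpa using h
      · intro j _ hj
        rw [Pi.single_eq_of_ne hj, map_zero, LinearMap.zero_apply]
      · simp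
    refine LinearMap.finrank_le_finrank_of_injective (f := LinearMap.pi fun i =>
      ((LinearMap.proj i).comp (Submodule.subtype _)).codRestrict (R i) fun x => this x x.2 i) ?_
    intro x y h
    refine Subtype.ext (funext fun i => ?_)
    exact congrArg Subtype.val (congrFun h i)
  have h1 := T.finrank_add_finrank_orthogonal hrefl W
  have h2 := Submodule.finrank_mono hiso
  have h3 : Module.finrank ℂ (∀ i, V i) ≤ 2 * ∑ i, n i + ∑ i, Module.finrank ℂ (R i) := by
    rw [Module.finrank_pi_fintype, Finset.mul_sum, ← Finset.sum_add_distrib]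
    exact Finset.sum_le_sum fun i _ => hn i
  omega

end TakemuraHeun

end

noncomputable section

namespace TakemuraHeun

/-! ### Rational functions with prescribed poles -/

open HahnSeries

section PoleRing

variable {κ : Type} (c : κ → ℂ)

/-- Polynomials in a coordinate `z` (the variable `none`) and in the functions `1 / (z - c j)`
(the variables `some j`). -/
abbrev PoleRing (κ : Type) : Type := MvPolynomial (Option κ) ℂ

/-- Evaluation at the element `ζ` of a field. -/
def evalAt {A : Type} [Field A] [Algebra ℂ A] (ζ : A) : PoleRing κ →ₐ[ℂ] A :=
  MvPolynomial.aeval fun o => o.elim ζ fun j => (ζ - algebraMap ℂ A (c j))⁻¹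

/-- The derivation `d/dz`. -/
def poleDeriv : Derivation ℂ (PoleRing κ) (PoleRing κ) :=
  MvPolynomial.mkDerivation ℂ fun o => o.elim 1 fun j => -(MvPolynomial.X (some j)) ^ 2

section

variable {A : Type} [Field A] [Algebra ℂ A] (ζ : A)

@[simp]
theorem evalAt_X_none : evalAt c ζ (MvPolynomial.X none) = ζ := by simp [evalAt]

@[simp]
theorem evalAt_X_some (j : κ) :
    evalAt c ζ (MvPolynomial.X (some j)) = (ζ - algebraMap ℂ A (c j))⁻¹ := by simp [evalAt]

@[simp]
theorem evalAt_C (a : ℂ) : evalAt c ζ (MvPolynomial.C a) = algebraMap ℂ A a := by simp [evalAt]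

@[simp]
theorem poleDeriv_X_none : poleDeriv (MvPolynomial.X (none : Option κ)) = 1 := by
  simp [poleDeriv]

@[simp]
theorem poleDeriv_X_some (j : κ) :
    poleDeriv (MvPolynomial.X (some j)) = -(MvPolynomial.X (some j)) ^ 2 := by
  simp [poleDeriv]

/-- The chain rule, verified on generators. With `lsDeriv` it says that local expansions commute
with $d/dz$ up to the factor $dz/dt$. -/
theorem derivation_evalAt (d : Derivation ℂ A A) (h : PoleRing κ) :
    d (evalAt c ζ h) = d ζ * evalAt c ζ (poleDeriv h) := by
  induction h using MvPolynomial.induction_on with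
  | C a =>
    have : poleDeriv (MvPolynomial.C a : PoleRing κ) = 0 := MvPolynomial.derivation_C _ a
    rw [this]; simp
  | add p q hp hq => simp only [map_add, hp, hq]; ring
  | mul_X p o hp =>
    rw [map_mul, Derivation.leibniz, Derivation.leibniz, hp]
    cases o with
    | none => simp; ring
    | some j => simp [Derivation.leibniz_inv]; ring

end

theorem hasDerivAt_evalAt {z : ℂ} (hz : ∀ j, z ≠ c j) (h : PoleRing κ) :
    HasDerivAt (fun z => evalAt c z h) (evalAt c z (poleDeriv h)) z := by
  induction h using MvPolynomial.induction_on with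
  | C a =>
    have : poleDeriv (MvPolynomial.C a : PoleRing κ) = 0 := MvPolynomial.derivation_C _ a
    rw [this]; simpa using hasDerivAt_const z a
  | add p q hp hq => simpa only [map_add] using hp.fun_add hq
  | mul_X p o hp =>
    simp only [map_mul, Derivation.leibniz]
    have : HasDerivAt (fun z => evalAt c z (MvPolynomial.X o))
        (evalAt c z (poleDeriv (MvPolynomial.X o))) z := by
      cases o with
      | none => simpa using hasDerivAt_id' z
      | some j =>
        have := ((hasDerivAt_id' z).sub_const (c j)).fun_inv (sub_ne_zero.2 (hz j))
        simpa [neg_div] using this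
    convert! hp.fun_mul this using 1
    simp; ring

/-- `h` and `g` define the same function away from the points `c j`. -/
def SameFunction (h g : PoleRing κ) : Prop :=
  ∀ (A : Type) [Field A] [Algebra ℂ A] (ζ : A), (∀ j, ζ ≠ algebraMap ℂ A (c j)) →
    evalAt c ζ h = evalAt c ζ g

variable {c}

theorem SameFunction.trans {f g h : PoleRing κ} (h1 : SameFunction c f g)
    (h2 : SameFunction c g h) : SameFunction c f h := fun A _ _ ζ hζ =>
  (h1 A ζ hζ).trans (h2 A ζ hζ)

theorem SameFunction.add {f g f' g' : PoleRing κ} (h1 : SameFunction c f g)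
    (h2 : SameFunction c f' g') : SameFunction c (f + f') (g + g') := fun A _ _ ζ hζ => by
  rw [map_add, map_add, h1 A ζ hζ, h2 A ζ hζ]

theorem SameFunction.mul {f g f' g' : PoleRing κ} (h1 : SameFunction c f g)
    (h2 : SameFunction c f' g') : SameFunction c (f * f') (g * g') := fun A _ _ ζ hζ => by
  rw [map_mul, map_mul, h1 A ζ hζ, h2 A ζ hζ]

theorem SameFunction.refl (f : PoleRing κ) : SameFunction c f f := fun _ _ _ _ _ => rfl

variable (κ) in
/-- The span of the powers of the generators. -/
def partialFractions : Submodule ℂ (PoleRing κ) :=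
  Submodule.span ℂ (Set.range fun p : Option κ × ℕ => MvPolynomial.X p.1 ^ p.2)

theorem X_pow_mem_partialFractions (o : Option κ) (n : ℕ) :
    (MvPolynomial.X o ^ n : PoleRing κ) ∈ partialFractions κ :=
  Submodule.subset_span ⟨(o, n), rfl⟩

variable (c) in
/-- `h` has a partial fraction decomposition. -/
def HasPartialFractions (h : PoleRing κ) : Prop :=
  ∃ g ∈ partialFractions κ, SameFunction c h g

theorem HasPartialFractions.of_mem {g : PoleRing κ} (h : g ∈ partialFractions κ) :
    HasPartialFractions c g := ⟨g, h, .refl g⟩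

theorem HasPartialFractions.congr {f g : PoleRing κ} (h : HasPartialFractions c g)
    (hfg : SameFunction c f g) : HasPartialFractions c f :=
  let ⟨k, hk, hgk⟩ := h
  ⟨k, hk, hfg.trans hgk⟩

theorem HasPartialFractions.add {f g : PoleRing κ} (hf : HasPartialFractions c f)
    (hg : HasPartialFractions c g) : HasPartialFractions c (f + g) :=
  let ⟨k, hk, hfk⟩ := hf
  let ⟨l, hl, hgl⟩ := hg
  ⟨k + l, Submodule.add_mem _ hk hl, hfk.add hgl⟩

theorem HasPartialFractions.C_mul {f : PoleRing κ} (a : ℂ) (hf : HasPartialFractions c f) :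
    HasPartialFractions c (MvPolynomial.C a * f) :=
  let ⟨k, hk, hfk⟩ := hf
  ⟨MvPolynomial.C a * k, by
    rw [← MvPolynomial.smul_eq_C_mul]
    exact Submodule.smul_mem _ a hk, (SameFunction.refl _).mul hfk⟩

/-- The generators are free variables, so the relations between $z$ and the $1/(z-c_j)$ hold only
after evaluation. This one and `sameFunction_X_some_mul` suffice for partial fractions. -/
theorem sameFunction_X_none_mul (j : κ) :
    SameFunction c (MvPolynomial.X none * MvPolynomial.X (some j))
      (1 + MvPolynomial.C (c j) * MvPolynomial.X (some j)) := fun A _ _ ζ hζ => by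
  have := sub_ne_zero.2 (hζ j)
  simp only [map_mul, map_add, map_one, evalAt_X_none, evalAt_X_some, evalAt_C]
  field_simp
  ring

theorem sameFunction_X_some_mul {j k : κ} (h : c j ≠ c k) :
    SameFunction c (MvPolynomial.X (some j) * MvPolynomial.X (some k))
      (MvPolynomial.C (c j - c k)⁻¹ * (MvPolynomial.X (some j))
        + MvPolynomial.C (-(c j - c k)⁻¹) * MvPolynomial.X (some k)) := fun A _ _ ζ hζ => by
  have hj := sub_ne_zero.2 (hζ j)
  have hk := sub_ne_zero.2 (hζ k)
  have hjk : algebraMap ℂ A (c j) - algebraMap ℂ A (c k) ≠ 0 :=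
    sub_ne_zero.2 fun e => h ((algebraMap ℂ A).injective e)
  simp only [map_mul, map_add, evalAt_X_some, evalAt_C, map_neg, map_inv₀, map_sub]
  field_simp
  ring

/-- Each use of a product relation replaces the mixed monomial by pure powers and a mixed monomial
with a smaller exponent $n$. -/
theorem hasPartialFractions_X_mul_X_pow (hc : Function.Injective c) (o o' : Option κ) (n : ℕ) :
    HasPartialFractions c (MvPolynomial.X o * MvPolynomial.X o' ^ n) := by
  rcases eq_or_ne o o' with rfl | hne
  · rw [← pow_succ']
    exact .of_mem (X_pow_mem_partialFractions _ _)
  induction n with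
  | zero =>
    have := X_pow_mem_partialFractions o 1
    simp only [pow_zero, mul_one, pow_one] at this ⊢
    exact .of_mem this
  | succ n ih =>
    rcases o with - | j <;> rcases o' with - | k
    · exact absurd rfl hne
    · refine HasPartialFractions.congr (g := MvPolynomial.X (some k) ^ n
        + MvPolynomial.C (c k) * MvPolynomial.X (some k) ^ (n + 1)) ?_ ?_
      · exact .of_mem (Submodule.add_mem _ (X_pow_mem_partialFractions _ _) (by
          rw [← MvPolynomial.smul_eq_C_mul]
          exact Submodule.smul_mem _ _ (X_pow_mem_partialFractions _ _)))
      · have := (sameFunction_X_none_mul (c := c) k).mul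
          (.refl (MvPolynomial.X (some k) ^ n))
        convert! this using 1 <;> ring
    · refine HasPartialFractions.congr (g := MvPolynomial.X none ^ n
        + MvPolynomial.C (c j) * (MvPolynomial.X (some j) * MvPolynomial.X none ^ n)) ?_ ?_
      · exact (HasPartialFractions.of_mem (X_pow_mem_partialFractions _ _)).add (ih.C_mul _)
      · have := (sameFunction_X_none_mul (c := c) j).mul (.refl (MvPolynomial.X none ^ n))
        convert! this using 1 <;> ring
    · have hjk : c j ≠ c k := fun e => hne (by rw [hc e])
      refine HasPartialFractions.congr (g := MvPolynomial.C (c j - c k)⁻¹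
          * (MvPolynomial.X (some j) * MvPolynomial.X (some k) ^ n)
        + MvPolynomial.C (-(c j - c k)⁻¹) * MvPolynomial.X (some k) ^ (n + 1)) ?_ ?_
      · exact (ih.C_mul _).add
          ((HasPartialFractions.of_mem (X_pow_mem_partialFractions _ _)).C_mul _)
      · have := (sameFunction_X_some_mul hjk).mul (.refl (MvPolynomial.X (some k) ^ n))
        convert! this using 1 <;> ring

theorem hasPartialFractions (hc : Function.Injective c) (h : PoleRing κ) :
    HasPartialFractions c h := by
  induction h using MvPolynomial.induction_on with
  | C a =>
    have := (HasPartialFractions.of_mem (c := c) (X_pow_mem_partialFractions none 0)).C_mul a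
    simpa using this
  | add p q hp hq => exact hp.add hq
  | mul_X p o hp =>
    obtain ⟨g, hg, hpg⟩ := hp
    refine HasPartialFractions.congr ?_ (hpg.mul (.refl _))
    clear hpg
    induction hg using Submodule.span_induction with
    | mem x hx =>
      obtain ⟨⟨o', n⟩, rfl⟩ := hx
      rw [mul_comm]
      exact hasPartialFractions_X_mul_X_pow hc o o' n
    | zero =>
      rw [zero_mul]
      exact .of_mem (Submodule.zero_mem _)
    | add x y _ _ hx hy =>
      rw [add_mul]
      exact hx.add hy
    | smul a x _ hx =>
      rw [smul_mul_assoc, MvPolynomial.smul_eq_C_mul]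
      exact hx.C_mul a

variable (c) in
/-- The coordinate `z` in terms of a local parameter `t` at the point `o` of the sphere: `1 / t` at
infinity and `c k + t` at `c k`. -/
def coord (o : Option κ) : LaurentSeries ℂ :=
  o.elim (single (-1) 1) fun k => single 1 1 + algebraMap ℂ _ (c k)

theorem lsDeriv_coord_none : lsDeriv (coord c none) = single (-2) (-1) := by
  simp [coord, lsDeriv_single]

theorem lsDeriv_coord_some (k : κ) : lsDeriv (coord c (some k)) = 1 := by
  simp [coord, lsDeriv_single]

theorem lsDeriv_coord_ne_zero (o : Option κ) : lsDeriv (coord c o) ≠ 0 := by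
  cases o with
  | none => rw [lsDeriv_coord_none]; exact (hasLead_single _ _).ne_zero (by norm_num)
  | some k => rw [lsDeriv_coord_some]; exact one_ne_zero

theorem coord_ne (o : Option κ) (j : κ) : coord c o ≠ algebraMap ℂ _ (c j) := by
  intro h
  apply lsDeriv_coord_ne_zero (c := c) o
  rw [h]
  exact lsDeriv.map_algebraMap _

theorem evalAt_coord_self (o : Option κ) :
    evalAt c (coord c o) (MvPolynomial.X o) = single (-1) 1 := by
  cases o with
  | none => simp [coord]
  | some k =>
    rw [evalAt_X_some]
    simp [coord]

theorem hasLead_coord_sub (k j : κ) :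
    HasLead 0 (c k - c j) (coord c (some k) - algebraMap ℂ _ (c j)) := by
  have := ((hasLead_single 1 1).mono zero_lt_one).add (hasLead_algebraMap (c k))
  simpa [coord] using this.sub (hasLead_algebraMap (c j))

theorem hasLead_evalAt_coord (hc : Function.Injective c) {o o' : Option κ} (h : o ≠ o') :
    ∃ d, HasLead 0 d (evalAt c (coord c o) (MvPolynomial.X o')) := by
  rcases o with - | k <;> rcases o' with - | j
  · exact absurd rfl h
  · rw [evalAt_X_some]
    have h1 : HasLead (-1) 1 (coord c none - algebraMap ℂ _ (c j)) := by
      simpa [coord] using (hasLead_single (-1) 1).sub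
        ((hasLead_algebraMap (c j)).mono (show (-1 : ℤ) < 0 by norm_num))
    exact (h1.inv one_ne_zero).exists_of_le (by norm_num)
  · rw [evalAt_X_none]
    have := ((hasLead_single 1 1).mono zero_lt_one).add (hasLead_algebraMap (c k))
    exact ⟨_, this⟩
  · rw [evalAt_X_some]
    exact ⟨_, (hasLead_coord_sub k j).inv
      (sub_ne_zero.2 fun e => h (by rw [hc e]))⟩

/-- The sum of the residues of a rational differential form vanishes. -/
theorem sum_residues_eq_zero [Fintype κ] (hc : Function.Injective c) (h : PoleRing κ) :
    ∑ o, (lsDeriv (coord c o) * evalAt c (coord c o) h).coeff (-1) = 0 := by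
  classical
  obtain ⟨g, hg, hhg⟩ := hasPartialFractions hc h
  simp only [hhg _ _ (coord_ne _)]
  clear hhg
  induction hg using Submodule.span_induction with
  | zero => simp
  | add x y _ _ hx hy => simp only [map_add, mul_add, coeff_add, Finset.sum_add_distrib, hx, hy,
      add_zero]
  | smul a x _ hx =>
    have : ∀ o, (lsDeriv (coord c o) * evalAt c (coord c o) (a • x)).coeff (-1)
        = a * (lsDeriv (coord c o) * evalAt c (coord c o) x).coeff (-1) := fun o => by
      rw [MvPolynomial.smul_eq_C_mul, map_mul, evalAt_C, algebraMap_eq_single, mul_left_comm,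
        coeff_single_mul, sub_zero]
    simp only [this, ← Finset.mul_sum, hx, mul_zero]
  | mem x hx =>
    obtain ⟨⟨o', n⟩, rfl⟩ := hx
    simp only [map_pow]
    -- By partial fractions only powers of one generator matter, and their residues can be nonzero
    -- only at infinity and at the generator's own pole. For $z^n$ the form at infinity is
    -- $-t^{-n-2}dt$, without residue; for $(z-c_j)^{-n}$ only $n=1$ contributes, with residues $1$
    -- at $c_j$ and $-1$ at infinity.
    have hreg : ∀ k : κ, some k ≠ o' → (lsDeriv (coord c (some k))
        * evalAt c (coord c (some k)) (MvPolynomial.X o') ^ n).coeff (-1) = 0 := fun k hk => by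
      obtain ⟨d, hd⟩ := hasLead_evalAt_coord hc hk
      rw [lsDeriv_coord_some, one_mul]
      exact (hd.pow n).1 _ (by simp)
    rw [Fintype.sum_option]
    rcases o' with - | j
    · rw [Finset.sum_eq_zero fun k _ => hreg k (by simp), add_zero, evalAt_coord_self,
        lsDeriv_coord_none, single_pow, single_mul_single, coeff_single_of_ne]
      simp only [nsmul_eq_mul]; omega
    · rw [Finset.sum_eq_single j (fun k _ hk => hreg k (by simpa using hk)) (by simp),
        evalAt_coord_self, lsDeriv_coord_some, one_mul, lsDeriv_coord_none, single_pow,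
        coeff_single_mul, one_pow, evalAt_X_some]
      have h1 : HasLead (-1) 1 (coord c none - algebraMap ℂ _ (c j)) := by
        simpa [coord] using (hasLead_single (-1) 1).sub
          ((hasLead_algebraMap (c j)).mono (show (-1 : ℤ) < 0 by norm_num))
      have h2 := (h1.inv one_ne_zero).pow n
      rw [coeff_single]
      rcases lt_trichotomy n 1 with hn | rfl | hn
      · obtain rfl : n = 0 := by omega
        simp
      · have := h2.2
        simp at this ⊢
        rw [this]; norm_num
      · rw [h2.1 _ (by push_cast; omega), if_neg (by simp; omega)]
        simp

end PoleRing

end TakemuraHeun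

end

noncomputable section

namespace TakemuraHeun

/-! ### Existence of a rational solution of the third-order equation -/

open HahnSeries

section Core

variable {κ : Type} [Fintype κ] {c : κ → ℂ}

/-- The partial fraction `c₀ + ∑ o, X o * p o (X o)`. -/
def ofParts (κ : Type) [Fintype κ] : (ℂ × (Option κ → Polynomial ℂ)) →ₗ[ℂ] PoleRing κ where
  toFun q := MvPolynomial.C q.1
    + ∑ o, Polynomial.aeval (MvPolynomial.X o) (Polynomial.X * q.2 o)
  map_add' q q' := by
    simp only [Prod.fst_add, Prod.snd_add, Pi.add_apply, map_add, mul_add,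
      Finset.sum_add_distrib]
    ring
  map_smul' a q := by
    simp only [Prod.smul_fst, Prod.smul_snd, Pi.smul_apply, RingHom.id_apply, smul_add,
      Finset.smul_sum, mul_smul_comm, map_smul, smul_eq_mul, MvPolynomial.C_mul,
      MvPolynomial.smul_eq_C_mul]

theorem ofParts_apply (q : ℂ × (Option κ → Polynomial ℂ)) :
    ofParts κ q = MvPolynomial.C q.1
      + ∑ o, Polynomial.aeval (MvPolynomial.X o) (Polynomial.X * q.2 o) := rfl

theorem evalAt_ofParts {A : Type} [Field A] [Algebra ℂ A] (ζ : A)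
    (q : ℂ × (Option κ → Polynomial ℂ)) :
    evalAt c ζ (ofParts κ q) = algebraMap ℂ A q.1
      + ∑ o, Polynomial.aeval (evalAt c ζ (MvPolynomial.X o)) (Polynomial.X * q.2 o) := by
  simp only [ofParts_apply, map_add, evalAt_C, map_sum, Polynomial.aeval_algHom_apply]

theorem exists_sameFunction_ofParts (hc : Function.Injective c) (h : PoleRing κ) :
    ∃ q, SameFunction c h (ofParts κ q) := by
  classical
  obtain ⟨g, hg, hhg⟩ := hasPartialFractions hc h
  suffices partialFractions κ ≤ LinearMap.range (ofParts κ) by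
    obtain ⟨q, rfl⟩ := this hg
    exact ⟨q, hhg⟩
  rw [partialFractions, Submodule.span_le]
  rintro _ ⟨⟨o, n⟩, rfl⟩
  cases n with
  | zero => exact ⟨(1, 0), by simp [ofParts_apply]⟩
  | succ n =>
    refine ⟨(0, Pi.single o (Polynomial.X ^ n)), ?_⟩
    simp only [ofParts_apply, map_zero, zero_add]
    rw [Finset.sum_eq_single o]
    · simp [pow_succ']
    · intro o' _ ho'
      simp [Pi.single_eq_of_ne ho']
    · simp

theorem hasLead_aeval {f : LaurentSeries ℂ} {d : ℂ} (hf : HasLead 0 d f) (p : Polynomial ℂ) :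
    ∃ d', HasLead 0 d' (Polynomial.aeval f p) := by
  induction p using Polynomial.induction_on' with
  | add p q hp hq =>
    obtain ⟨a, ha⟩ := hp
    obtain ⟨b, hb⟩ := hq
    rw [map_add]
    exact ⟨_, ha.add hb⟩
  | monomial n a =>
    rw [Polynomial.aeval_monomial]
    have := (hasLead_algebraMap a).mul (hf.pow n)
    simp only [mul_zero, zero_add] at this
    exact ⟨_, this⟩

theorem aeval_single_coeff (p : Polynomial ℂ) (m : ℤ) :
    (Polynomial.aeval (single (-1) 1 : LaurentSeries ℂ) p).coeff m
      = if m ≤ 0 then p.coeff (-m).toNat else 0 := by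
  rw [Polynomial.aeval_eq_sum_range, coeff_sum]
  have : ∀ i : ℕ, (p.coeff i • (single (-1) 1 : LaurentSeries ℂ) ^ i).coeff m
      = if i = -m then p.coeff i else 0 := fun i => by
    rw [← single_zero_mul_eq_smul, single_pow, single_mul_single, coeff_single]
    simp only [nsmul_eq_mul, one_pow, mul_one, zero_add]
    exact if_congr (by omega) rfl rfl
  simp only [this]
  split_ifs with hm
  · obtain ⟨k, rfl⟩ : ∃ k : ℕ, m = -k := ⟨(-m).toNat, by omega⟩
    simp only [neg_neg, Nat.cast_inj, Int.toNat_natCast]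
    rw [Finset.sum_ite_eq']
    split_ifs with h
    · rfl
    · exact (Polynomial.coeff_eq_zero_of_natDegree_lt (by simpa using h)).symm
  · exact Finset.sum_eq_zero fun i _ => if_neg (by omega)

/-- Every generator other than that of `o` is regular at `o`, and so is the constant; the polar part
at `o` therefore comes from the single part `q.2 o`. -/
theorem exists_hasLead_sub_ofParts (hc : Function.Injective c)
    (q : ℂ × (Option κ → Polynomial ℂ)) (o : Option κ) :
    ∃ d, HasLead 0 d (evalAt c (coord c o) (ofParts κ q)
      - Polynomial.aeval (single (-1) 1) (Polynomial.X * q.2 o)) := by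
  classical
  have hsum : ∃ d, HasLead 0 d (∑ o' ∈ Finset.univ.erase o,
      Polynomial.aeval (evalAt c (coord c o) (MvPolynomial.X o')) (Polynomial.X * q.2 o')) := by
    have : ∀ o' ∈ Finset.univ.erase o, ∃ d, HasLead 0 d (Polynomial.aeval
        (evalAt c (coord c o) (MvPolynomial.X o')) (Polynomial.X * q.2 o')) := fun o' ho' => by
      obtain ⟨d, hd⟩ := hasLead_evalAt_coord hc (Finset.ne_of_mem_erase ho').symm
      exact hasLead_aeval hd _
    choose! d hd using this
    exact ⟨_, HasLead.sum _ hd⟩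
  obtain ⟨d, hd⟩ := hsum
  refine ⟨_, (congrArg (HasLead 0 _) ?_).mp ((hasLead_algebraMap q.1).add hd)⟩
  rw [evalAt_ofParts, ← Finset.add_sum_erase _ _ (Finset.mem_univ o), evalAt_coord_self]
  ring

theorem coeff_evalAt_ofParts (hc : Function.Injective c)
    (q : ℂ × (Option κ → Polynomial ℂ)) (o : Option κ) (m : ℕ) :
    (evalAt c (coord c o) (ofParts κ q)).coeff (-(m + 1)) = (q.2 o).coeff m := by
  obtain ⟨d, hd⟩ := exists_hasLead_sub_ofParts hc q o
  have := hd.1 (-(m + 1)) (by omega)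
  rw [coeff_sub, sub_eq_zero, aeval_single_coeff, if_pos (by omega)] at this
  rw [this, show (-(-((m : ℤ) + 1))).toNat = m + 1 by omega, Polynomial.coeff_X_mul]

/-- A function without poles which vanishes at infinity is zero. -/
theorem eq_zero_of_hasLead (hc : Function.Injective c) {h : PoleRing κ} {d₀ : ℂ}
    {d : κ → ℂ} (h0 : HasLead 1 d₀ (evalAt c (coord c none) h))
    (hk : ∀ k, HasLead 0 (d k) (evalAt c (coord c (some k)) h)) : SameFunction c h 0 := by
  obtain ⟨⟨a, p⟩, hq⟩ := exists_sameFunction_ofParts hc h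
  rw [hq _ _ (coord_ne _)] at h0
  simp only [hq _ _ (coord_ne _)] at hk
  obtain rfl : p = 0 := by
    funext o
    ext m
    rw [← coeff_evalAt_ofParts hc (a, p) o m]
    cases o with
    | none => exact h0.1 _ (by omega)
    | some k => exact (hk k).1 _ (by omega)
  have ha := h0.1 0 (by norm_num)
  rw [evalAt_ofParts, algebraMap_eq_single] at ha
  obtain rfl : a = 0 := by simpa using ha
  intro A _ _ ζ hζ
  rw [hq A ζ hζ, show ((0, 0) : ℂ × (Option κ → Polynomial ℂ)) = 0 from rfl, map_zero]

/-- Clearing denominators, with one numerator valid for all fields at once; this is what lets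
information pass from complex values to Laurent expansions. -/
theorem exists_polynomial (h : PoleRing κ) :
    ∃ (N : ℕ) (P : Polynomial ℂ), ∀ (A : Type) [Field A] [Algebra ℂ A] (ζ : A),
      (∀ j, ζ ≠ algebraMap ℂ A (c j)) →
      evalAt c ζ h * (∏ j, (ζ - algebraMap ℂ A (c j))) ^ N = Polynomial.aeval ζ P := by
  classical
  set W : Polynomial ℂ := ∏ j, (Polynomial.X - Polynomial.C (c j)) with hW
  have hWa : ∀ (A : Type) [Field A] [Algebra ℂ A] (ζ : A),
      ∏ j, (ζ - algebraMap ℂ A (c j)) = Polynomial.aeval ζ W := fun A _ _ ζ => by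
    simp [hW, map_prod]
  simp only [hWa]
  induction h using MvPolynomial.induction_on with
  | C a => exact ⟨0, Polynomial.C a, fun A _ _ ζ _ => by simp⟩
  | add p q hp hq =>
    obtain ⟨N, P, h1⟩ := hp
    obtain ⟨M, Q, h2⟩ := hq
    refine ⟨N + M, P * W ^ M + Q * W ^ N, fun A _ _ ζ hζ => ?_⟩
    simp only [map_add, map_mul, map_pow, ← h1 A ζ hζ, ← h2 A ζ hζ]
    ring
  | mul_X p o hp =>
    obtain ⟨N, P, h1⟩ := hp
    cases o with
    | none =>
      refine ⟨N, P * Polynomial.X, fun A _ _ ζ hζ => ?_⟩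
      simp only [map_mul, evalAt_X_none, Polynomial.aeval_X, ← h1 A ζ hζ]
      ring
    | some j =>
      refine ⟨N + 1, P * ∏ k ∈ Finset.univ.erase j, (Polynomial.X - Polynomial.C (c k)),
        fun A _ _ ζ hζ => ?_⟩
      have h2 := sub_ne_zero.2 (hζ j)
      rw [map_mul, map_mul, ← h1 A ζ hζ, evalAt_X_some, pow_succ,
        show Polynomial.aeval ζ W = (ζ - algebraMap ℂ A (c j)) * Polynomial.aeval ζ
          (∏ k ∈ Finset.univ.erase j, (Polynomial.X - Polynomial.C (c k))) by
          rw [hW, ← Finset.mul_prod_erase _ _ (Finset.mem_univ j)]; simp]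
      field_simp

/-- The numerator from `exists_polynomial` has infinitely many complex zeros, hence is the zero
polynomial, and the evaluation vanishes in every field. -/
theorem sameFunction_zero_of_eval {h : PoleRing κ}
    (hz : ∀ z : ℂ, (∀ j, z ≠ c j) → evalAt c z h = 0) : SameFunction c h 0 := by
  obtain ⟨N, P, hP⟩ := exists_polynomial (c := c) h
  have hP0 : P = 0 := by
    refine Polynomial.eq_zero_of_infinite_isRoot P
      (((Set.finite_range c).infinite_compl).mono fun z hz' => ?_)
    have hz'' : ∀ j, z ≠ c j := fun j e => hz' ⟨j, e.symm⟩
    have := hP ℂ z hz''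
    rw [hz z hz'', zero_mul] at this
    simpa using this.symm
  intro A _ _ ζ hζ
  have := hP A ζ hζ
  rw [hP0, map_zero] at this
  rw [map_zero]
  refine (mul_eq_zero.1 this).resolve_right (pow_ne_zero _ ?_)
  exact Finset.prod_ne_zero_iff.2 fun j _ => sub_ne_zero.2 (hζ j)

/-- The existence of a rational solution of the third-order equation, from the dimensions of the
radicals of the local residue forms. -/
theorem exists_symOp_eq_zero (hc : Function.Injective c) (w u : PoleRing κ)
    (S : Option κ → LocalData)
    (hw : ∀ o, (S o).w = evalAt c (coord c o) w / lsDeriv (coord c o) ^ 2)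
    (hu : ∀ o, (S o).u = evalAt c (coord c o) u)
    (hrad : ∀ o, (S o).size ≤ 2 * (S o).n + Module.finrank ℂ (S o).radical) :
    ∃ q : ℂ × (Option κ → Polynomial ℂ), (∀ o m, (S o).n ≤ m → (q.2 o).coeff m = 0) ∧
      (∃ z : ℂ, (∀ j, z ≠ c j) ∧ evalAt c z (ofParts κ q) ≠ 0) ∧
      ∀ z : ℂ, (∀ j, z ≠ c j) → evalAt c z (symOp poleDeriv w u (ofParts κ q)) = 0 := by
  classical
  -- A constant together with $n_o$ polar coefficients at each point: dimension $1+\sum n_o$. The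
  -- extra $1$ is what beats half the rank.
  let U := ℂ × (∀ o, Fin (S o).n → ℂ)
  let toParts : U →ₗ[ℂ] ℂ × (Option κ → Polynomial ℂ) :=
    LinearMap.prodMap LinearMap.id (LinearMap.pi fun o =>
      (∑ j : Fin (S o).n, (Polynomial.monomial (j : ℕ)).comp (LinearMap.proj j)).comp
        (LinearMap.proj o))
  have htp : ∀ x o m, ((toParts x).2 o).coeff m
      = if h : m < (S o).n then x.2 o ⟨m, h⟩ else 0 := fun x o m => by
    have : (toParts x).2 o = ∑ j : Fin (S o).n, Polynomial.monomial (j : ℕ) (x.2 o j) := by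
      change (∑ j : Fin (S o).n, (Polynomial.monomial (R := ℂ) (j : ℕ)).comp
        (LinearMap.proj j)) (x.2 o) = _
      rw [LinearMap.sum_apply]
      rfl
    rw [this, Polynomial.finsetSum_coeff]
    simp only [Polynomial.coeff_monomial]
    split_ifs with h
    · rw [Finset.sum_eq_single ⟨m, h⟩]
      · simp
      · intro b _ hb
        rw [if_neg]
        intro e
        exact hb (Fin.ext e)
      · simp
    · exact Finset.sum_eq_zero fun j _ => if_neg (by have := j.2; omega)
  let F : U →ₗ[ℂ] PoleRing κ := (ofParts κ).comp toParts
  let ι := fun o => evalAt c (coord c o)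
  have hlead : ∀ x o, ∃ d, HasLead (-(S o).n) d (ι o (F x)) := fun x o => by
    refine ⟨_, fun m hm => ?_, rfl⟩
    obtain ⟨k, rfl⟩ : ∃ k : ℕ, m = -((k : ℤ) + 1) := ⟨(-m - 1).toNat, by omega⟩
    have := coeff_evalAt_ofParts hc (toParts x) o k
    rw [htp, dif_neg (by omega)] at this
    exact this
  have hop : ∀ o f, symOp lsDeriv (S o).w (S o).u (ι o f)
      = lsDeriv (coord c o) * ι o (symOp poleDeriv w u f) := fun o f => by
    rw [hw, hu]
    exact symOp_change _ _ (evalAt c (coord c o)) _ (lsDeriv_coord_ne_zero o)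
      (fun a => derivation_evalAt c _ _ a) w u f
  let φ : U →ₗ[ℂ] (∀ o, Fin (S o).size → ℂ) :=
    LinearMap.pi fun o => (S o).trunc.comp ((ι o).toLinearMap.comp F)
  have hφ : ∀ x o, φ x o = (S o).trunc (ι o (F x)) := fun x o => rfl
  obtain ⟨x, hx, hxr⟩ := exists_ne_zero_mem_radical (fun o => (S o).form)
    (fun o => (S o).form_skew) (fun o => (S o).n)
    (fun o => by rw [Module.finrank_fin_fun]; exact hrad o)
    (by
      simp only [U, Module.finrank_prod, Module.finrank_self, Module.finrank_pi_fintype,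
        Finset.sum_const, Finset.card_univ, Fintype.card_fin, smul_eq_mul, mul_one]
      omega) φ
    (fun x y => by
      -- Isotropy is the residue theorem for the form $f\,Dg\,dz$; by `symOp_change`, the local
      -- operator in the parameter $t$ carries the factor $dz/dt$.
      rw [← sum_residues_eq_zero hc (F x * symOp poleDeriv w u (F y))]
      refine Finset.sum_congr rfl fun o _ => ?_
      obtain ⟨d, hd⟩ := hlead x o
      obtain ⟨e, he⟩ := hlead y o
      rw [hφ, hφ, (S o).form_trunc hd he, resForm_apply, hop, map_mul]
      congr 1
      ring)
  refine ⟨toParts x, fun o m hm => ?_, ?_, ?_⟩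
  · rw [htp, dif_neg (by omega)]
  · by_contra! hcon
    have h0 := sameFunction_zero_of_eval hcon
    apply hx
    have h2 : x.2 = 0 := by
      funext o j
      have := coeff_evalAt_ofParts hc (toParts x) o j
      rw [h0 _ _ (coord_ne _), htp, dif_pos j.2, map_zero, coeff_zero] at this
      exact this.symm
    have h1 : x.1 = 0 := by
      have hp : (toParts x).2 = 0 := by
        funext o; ext m; rw [htp]; simp [h2]
      have h3 := h0 _ _ (coord_ne none)
      rw [evalAt_ofParts, hp] at h3
      have h4 : (toParts x).1 = x.1 := rfl
      simpa [h4] using h3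
    exact Prod.ext h1 h2
  · intro z hz
    -- Membership in all radicals leaves $Df$ without finite poles. At infinity, division by
    -- $dz/dt=-t^{-2}$ raises the order to at least $n+2\ge1$, so $Df$ vanishes there as well.
    have hvan : ∀ o, ∃ d, HasLead (S o).n d (symOp lsDeriv (S o).w (S o).u (ι o (F x))) :=
      fun o => (S o).hasLead_symOp_of_mem_radical (hlead x o).choose_spec (hxr o)
    have hnone : ∃ d, HasLead 1 d (ι none (symOp poleDeriv w u (F x))) := by
      obtain ⟨d, hd⟩ := hvan none
      rw [hop, lsDeriv_coord_none] at hd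
      have := ((hasLead_single (-2) (-1)).inv (by norm_num)).mul hd
      rw [inv_mul_cancel_left₀ ((hasLead_single _ _).ne_zero (by norm_num))] at this
      exact this.exists_of_le (by omega)
    have hsome : ∀ k, ∃ d, HasLead 0 d (ι (some k) (symOp poleDeriv w u (F x))) := fun k => by
      obtain ⟨d, hd⟩ := hvan (some k)
      rw [hop, lsDeriv_coord_some, one_mul] at hd
      exact hd.exists_of_le (by omega)
    choose d hd using hsome
    have := eq_zero_of_hasLead hc hnone.choose_spec hd ℂ z hz
    rwa [map_zero] at this

end Core

end TakemuraHeun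

end

noncomputable section

namespace TakemuraHeun

/-! ### Taylor series -/

/-- The Taylor series of `g` at `b`. -/
def taylor (b : ℂ) (g : ℂ → ℂ) : PowerSeries ℂ :=
  PowerSeries.mk fun n => iteratedDeriv n g b / n.factorial

theorem coeff_taylor (b : ℂ) (g : ℂ → ℂ) (n : ℕ) :
    PowerSeries.coeff n (taylor b g) = iteratedDeriv n g b / n.factorial :=
  PowerSeries.coeff_mk _ _

theorem constantCoeff_taylor (b : ℂ) (g : ℂ → ℂ) :
    PowerSeries.constantCoeff (taylor b g) = g b := by
  rw [← PowerSeries.coeff_zero_eq_constantCoeff_apply, coeff_taylor]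
  simp

theorem taylor_congr {b : ℂ} {f g : ℂ → ℂ} (h : f =ᶠ[𝓝 b] g) : taylor b f = taylor b g := by
  ext n
  rw [coeff_taylor, coeff_taylor, h.iteratedDeriv_eq]

theorem taylor_add {b : ℂ} {f g : ℂ → ℂ} (hf : AnalyticAt ℂ f b) (hg : AnalyticAt ℂ g b) :
    taylor b (fun z => f z + g z) = taylor b f + taylor b g := by
  ext n
  rw [map_add, coeff_taylor, coeff_taylor, coeff_taylor,
    iteratedDeriv_fun_add hf.contDiffAt hg.contDiffAt, add_div]

theorem taylor_mul {b : ℂ} {f g : ℂ → ℂ} (hf : AnalyticAt ℂ f b) (hg : AnalyticAt ℂ g b) :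
    taylor b (fun z => f z * g z) = taylor b f * taylor b g := by
  ext n
  rw [PowerSeries.coeff_mul, coeff_taylor, show (fun z => f z * g z) = f * g from rfl,
    iteratedDeriv_mul hf.contDiffAt hg.contDiffAt,
    Finset.Nat.sum_antidiagonal_eq_sum_range_succ_mk, Finset.sum_div]
  refine Finset.sum_congr rfl fun i hi => ?_
  rw [coeff_taylor, coeff_taylor,
    Nat.cast_choose ℂ (Nat.lt_succ_iff.1 (Finset.mem_range.1 hi))]
  have := n.factorial_ne_zero
  field_simp

theorem taylor_const (b c : ℂ) : taylor b (fun _ => c) = PowerSeries.C c := by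
  ext n
  rw [coeff_taylor, iteratedDeriv_const, PowerSeries.coeff_C]
  split_ifs with h
  · simp [h]
  · simp

theorem taylor_deriv (b : ℂ) (g : ℂ → ℂ) :
    taylor b (deriv g) = PowerSeries.derivative ℂ (taylor b g) := by
  ext n
  rw [PowerSeries.coeff_derivative, coeff_taylor, coeff_taylor, iteratedDeriv_succ',
    Nat.factorial_succ]
  have := n.factorial_ne_zero
  push_cast
  field_simp

theorem taylor_sub_id (b : ℂ) : taylor b (fun z => z - b) = PowerSeries.X := by
  have h : PowerSeries.derivative ℂ (taylor b (fun z => z - b))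
      = PowerSeries.derivative ℂ PowerSeries.X := by
    rw [← taylor_deriv, PowerSeries.derivative_X, show deriv (fun z : ℂ => z - b) = fun _ => 1 by
      funext z; simp, taylor_const, map_one]
  refine PowerSeries.derivative.ext h ?_
  rw [constantCoeff_taylor]; simp

theorem hasFPowerSeriesAt_taylor {b : ℂ} {g : ℂ → ℂ} (hg : AnalyticAt ℂ g b) :
    HasFPowerSeriesAt g (FormalMultilinearSeries.ofScalars ℂ
      fun n => PowerSeries.coeff n (taylor b g)) b := by
  simp only [coeff_taylor]
  exact hg.hasFPowerSeriesAt

theorem eventually_eq_zero_of_taylor {b : ℂ} {g : ℂ → ℂ} (hg : AnalyticAt ℂ g b)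
    (h : taylor b g = 0) : ∀ᶠ z in 𝓝 b, g z = 0 := by
  have h1 := hasFPowerSeriesAt_taylor hg
  rw [h] at h1
  have : FormalMultilinearSeries.ofScalars ℂ
      (fun n => PowerSeries.coeff n (0 : PowerSeries ℂ)) = 0 := by
    rw [FormalMultilinearSeries.ofScalars_series_eq_zero]
    funext n
    simp
  rw [this] at h1
  exact h1.eventually_eq_zero

/-- The coefficients of `F` grow at most geometrically. -/
def GeomBound (F : PowerSeries ℂ) : Prop :=
  ∃ B : ℝ, 1 ≤ B ∧ ∀ n, ‖PowerSeries.coeff n F‖ ≤ B ^ (n + 1)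

/-- The Taylor series has positive radius of convergence, which bounds its coefficients by
$C/\rho^n$; one base $B$ absorbs both constants. -/
theorem geomBound_taylor {b : ℂ} {g : ℂ → ℂ} (hg : AnalyticAt ℂ g b) :
    GeomBound (taylor b g) := by
  have h := hasFPowerSeriesAt_taylor hg
  obtain ⟨r, r0, hr⟩ := ENNReal.lt_iff_exists_nnreal_btwn.1 h.radius_pos
  obtain ⟨C, C0, hC⟩ := FormalMultilinearSeries.norm_le_div_pow_of_pos_of_lt_radius _
    (by exact_mod_cast r0) hr
  have hr0 : (0 : ℝ) < r := by exact_mod_cast r0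
  refine ⟨max 1 (max C (1 / r)), le_max_left _ _, fun n => ?_⟩
  have h1 := hC n
  rw [FormalMultilinearSeries.ofScalars_norm] at h1
  refine h1.trans ?_
  rw [pow_succ', div_eq_mul_one_div, ← one_div_pow]
  gcongr
  · exact (le_max_left _ _).trans (le_max_right _ _)
  · exact (le_max_right _ _).trans (le_max_right _ _)

/-- A geometric bound forces a positive radius. This turns formal solutions into functions, as
required to produce a logarithmic solution. -/
theorem GeomBound.exists_taylor_eq {F : PowerSeries ℂ} (hF : GeomBound F) (b : ℂ) :
    ∃ g, AnalyticAt ℂ g b ∧ taylor b g = F := by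
  obtain ⟨B, hB, h⟩ := hF
  have hB0 : 0 < B := by linarith
  set p := FormalMultilinearSeries.ofScalars ℂ fun n => PowerSeries.coeff n F with hp
  have hrad : 0 < p.radius := by
    have : ((Real.toNNReal (1 / B) : NNReal) : ENNReal) ≤ p.radius := by
      refine p.le_radius_of_bound B fun n => ?_
      rw [hp, FormalMultilinearSeries.ofScalars_norm,
        Real.coe_toNNReal _ (by positivity), div_pow, one_pow]
      rw [mul_one_div, div_le_iff₀ (by positivity), ← pow_succ']
      exact h n
    refine lt_of_lt_of_le ?_ this
    simp only [ENNReal.coe_pos, Real.toNNReal_pos]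
    positivity
  have hs := (p.hasFPowerSeriesOnBall hrad).hasFPowerSeriesAt
  have hs' : HasFPowerSeriesAt (fun z => p.sum (z - b)) p b := by
    simpa using hs.comp_sub b
  refine ⟨fun z => p.sum (z - b), hs'.analyticAt, ?_⟩
  have h1 := (hasFPowerSeriesAt_taylor hs'.analyticAt).eq_formalMultilinearSeries hs'
  rw [hp, FormalMultilinearSeries.ofScalars_series_eq_iff] at h1
  ext n
  exact congrFun h1 n

/-! ### The method of Frobenius -/

/-- The operator `t d² + p d + q` on power series. -/
def frobOp (p q F : PowerSeries ℂ) : PowerSeries ℂ :=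
  PowerSeries.X * PowerSeries.derivative ℂ (PowerSeries.derivative ℂ F)
    + p * PowerSeries.derivative ℂ F + q * F

theorem frobOp_add (p q F G : PowerSeries ℂ) :
    frobOp p q (F + G) = frobOp p q F + frobOp p q G := by
  simp only [frobOp, map_add]; ring

/-- The part of the `n`-th coefficient of `t a'' + p a' + q a` that does not contain
`a (n + 1)`. -/
def frobTail (p q : PowerSeries ℂ) (n : ℕ) (a : ℕ → ℂ) : ℂ :=
  ∑ j ∈ Finset.range n, PowerSeries.coeff (n - j) p * ((j + 1) * a (j + 1))
    + ∑ j ∈ Finset.range (n + 1), PowerSeries.coeff (n - j) q * a j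

theorem frobTail_congr (p q : PowerSeries ℂ) {n : ℕ} {a a' : ℕ → ℂ}
    (h : ∀ m ≤ n, a m = a' m) : frobTail p q n a = frobTail p q n a' := by
  unfold frobTail
  congr 1 <;> refine Finset.sum_congr rfl fun j hj => ?_
  · rw [h (j + 1) (by have := Finset.mem_range.1 hj; omega)]
  · rw [h j (by have := Finset.mem_range.1 hj; omega)]

/-- The recursion of the Frobenius method. When $p(0)=-r$, the factor of the new coefficient
vanishes only at $n=r$, the resonance between the exponents $0$ and $r+1$. -/
theorem coeff_frobOp (p q F : PowerSeries ℂ) (n : ℕ) :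
    PowerSeries.coeff n (frobOp p q F)
      = (n + 1) * (n + PowerSeries.constantCoeff p) * PowerSeries.coeff (n + 1) F
        + frobTail p q n fun m => PowerSeries.coeff m F := by
  have h1 : PowerSeries.coeff n (PowerSeries.X * PowerSeries.derivative ℂ
      (PowerSeries.derivative ℂ F)) = n * (n + 1) * PowerSeries.coeff (n + 1) F := by
    cases n with
    | zero => simp
    | succ n =>
      rw [PowerSeries.coeff_succ_X_mul, PowerSeries.coeff_derivative,
        PowerSeries.coeff_derivative]
      push_cast; ring
  have h2 (G H : PowerSeries ℂ) : PowerSeries.coeff n (G * H)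
      = ∑ j ∈ Finset.range (n + 1), PowerSeries.coeff (n - j) G * PowerSeries.coeff j H := by
    rw [mul_comm, PowerSeries.coeff_mul, Finset.Nat.sum_antidiagonal_eq_sum_range_succ_mk]
    exact Finset.sum_congr rfl fun j _ => mul_comm _ _
  rw [frobOp, map_add, map_add, h1, h2 p, h2 q, Finset.sum_range_succ, frobTail]
  simp only [PowerSeries.coeff_derivative, Nat.sub_self,
    PowerSeries.coeff_zero_eq_constantCoeff_apply]
  have : ∀ j : ℕ, PowerSeries.coeff (n - j) p * (PowerSeries.coeff (j + 1) F * (j + 1))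
      = PowerSeries.coeff (n - j) p * ((j + 1) * PowerSeries.coeff (j + 1) F) := fun j => by ring
  simp only [this]
  ring

/-- Course-of-values recursion: `f n` is a whole sequence, correct up to index $n$ and corrected at
$n+1$ in the next step; the answer is the diagonal. -/
theorem exists_seq (a₀ : ℂ) (Φ : ℕ → (ℕ → ℂ) → ℂ)
    (hΦ : ∀ n a a', (∀ m ≤ n, a m = a' m) → Φ n a = Φ n a') :
    ∃ a : ℕ → ℂ, a 0 = a₀ ∧ ∀ n, a (n + 1) = Φ n a := by
  let f : ℕ → ℕ → ℂ := fun n => Nat.rec (fun _ => a₀)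
    (fun n g => Function.update g (n + 1) (Φ n g)) n
  have hf : ∀ n, f (n + 1) = Function.update (f n) (n + 1) (Φ n (f n)) := fun n => rfl
  have hst : ∀ n m, m ≤ n → f n m = f m m := by
    intro n
    induction n with
    | zero => intro m hm; rw [Nat.le_zero.1 hm]
    | succ n ih =>
      intro m hm
      rcases hm.eq_or_lt with rfl | hm
      · rfl
      · rw [hf, Function.update_of_ne (by omega), ih m (by omega)]
  refine ⟨fun n => f n n, rfl, fun n => ?_⟩
  change f (n + 1) (n + 1) = _
  rw [hf, Function.update_self]
  exact hΦ n _ _ fun m hm => hst n m hm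

variable {r : ℕ} {p q : PowerSeries ℂ}

/-- The recursion can be solved except at the resonance $n=r$; there the equation is given up and
the coefficient of index $r+1$ becomes free. -/
theorem exists_frobenius (hp : PowerSeries.constantCoeff p = -r) (S : PowerSeries ℂ)
    (a₀ a₁ : ℂ) : ∃ F : PowerSeries ℂ, PowerSeries.coeff 0 F = a₀ ∧
      PowerSeries.coeff (r + 1) F = a₁ ∧
      ∀ n ≠ r, PowerSeries.coeff n (frobOp p q F) = PowerSeries.coeff n S := by
  obtain ⟨a, ha0, ha⟩ := exists_seq a₀ (fun n a => if n = r then a₁ else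
    (PowerSeries.coeff n S - frobTail p q n a) / ((n + 1) * (n - r))) (fun n a a' h => by
      rw [frobTail_congr p q h])
  refine ⟨PowerSeries.mk a, ?_, ?_, fun n hn => ?_⟩
  · rw [PowerSeries.coeff_mk, ha0]
  · rw [PowerSeries.coeff_mk, ha, if_pos rfl]
  · rw [coeff_frobOp, hp]
    simp only [PowerSeries.coeff_mk]
    rw [ha, if_neg hn]
    have h1 : (n : ℂ) + 1 ≠ 0 := by exact_mod_cast n.succ_ne_zero
    have h2 : (n : ℂ) - r ≠ 0 := sub_ne_zero.2 (by exact_mod_cast hn)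
    rw [← sub_eq_add_neg]
    field_simp
    ring

/-- A zero initial coefficient propagates up to index $r$ when the source vanishes below $r$. The
resonant coefficient of the operator involves only these zeros. -/
theorem coeff_frobenius_eq_zero (hp : PowerSeries.constantCoeff p = -r) {S F : PowerSeries ℂ}
    (hS : ∀ n < r, PowerSeries.coeff n S = 0) (h0 : PowerSeries.coeff 0 F = 0)
    (hF : ∀ n ≠ r, PowerSeries.coeff n (frobOp p q F) = PowerSeries.coeff n S) :
    (∀ m ≤ r, PowerSeries.coeff m F = 0) ∧ PowerSeries.coeff r (frobOp p q F) = 0 := by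
  have h1 : ∀ m ≤ r, PowerSeries.coeff m F = 0 := by
    intro m
    induction m using Nat.strong_induction_on with
    | _ m ih =>
      intro hm
      cases m with
      | zero => exact h0
      | succ m =>
        have h2 := hF m (by omega)
        have h3 : frobTail p q m (fun k => PowerSeries.coeff k F) = 0 := by
          rw [frobTail_congr p q (a' := fun _ => 0) fun k hk => ih k (by omega) (by omega)]
          simp [frobTail]
        rw [hS m (by omega), coeff_frobOp, hp, h3, add_zero] at h2
        refine (mul_eq_zero.1 h2).resolve_left (mul_ne_zero ?_ ?_)
        · exact_mod_cast m.succ_ne_zero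
        · rw [← sub_eq_add_neg]
          exact sub_ne_zero.2 (by exact_mod_cast (by omega : m ≠ r))
  refine ⟨h1, ?_⟩
  rw [coeff_frobOp, hp, add_neg_cancel, mul_zero, zero_mul, zero_add,
    frobTail_congr p q (a' := fun _ => 0) fun k hk => h1 k hk]
  simp [frobTail]

theorem sum_half_pow_le (n : ℕ) : ∑ j ∈ Finset.range n, (1 / 2 : ℝ) ^ (n - 1 - j) ≤ 2 := by
  rw [Finset.sum_range_reflect (fun j => (1 / 2 : ℝ) ^ j)]
  exact (Summable.sum_le_tsum _ (fun _ _ => by positivity) summable_geometric_two).trans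
    tsum_geometric_two.le

/-- Majorants $K\sigma^n$. The constant $K$ absorbs the coefficients through the resonant one;
beyond it $|m-r|\ge1$, and the factor $m+1$ on the left pays for the factors $j+1$ produced by $F'$.
-/
theorem geomBound_of_frobOp_eq (hp : PowerSeries.constantCoeff p = -r) {S F : PowerSeries ℂ}
    (bp : GeomBound p) (bq : GeomBound q) (bS : GeomBound S) (hF : frobOp p q F = S) :
    GeomBound F := by
  obtain ⟨B₁, hB₁, h1⟩ := bp
  obtain ⟨B₂, hB₂, h2⟩ := bq
  obtain ⟨B₃, hB₃, h3⟩ := bS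
  obtain ⟨B, hB, h1', h2', h3'⟩ : ∃ B : ℝ, 1 ≤ B ∧ B₁ ≤ B ∧ B₂ ≤ B ∧ B₃ ≤ B :=
    ⟨max B₁ (max B₂ B₃), hB₁.trans (le_max_left _ _), le_max_left _ _,
      (le_max_left _ _).trans (le_max_right _ _), (le_max_right _ _).trans (le_max_right _ _)⟩
  replace h1 : ∀ n, ‖PowerSeries.coeff n p‖ ≤ B * B ^ n := fun n =>
    (h1 n).trans (by rw [← pow_succ']; gcongr)
  replace h2 : ∀ n, ‖PowerSeries.coeff n q‖ ≤ B * B ^ n := fun n =>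
    (h2 n).trans (by rw [← pow_succ']; gcongr)
  replace h3 : ∀ n, ‖PowerSeries.coeff n S‖ ≤ B * B ^ n := fun n =>
    (h3 n).trans (by rw [← pow_succ']; gcongr)
  -- With $X=BK\sigma^m$, the terms from $p$, $q$ and $S$ are bounded by $2B(m+1)X$, $2X$ and $X$,
  -- in total at most $(m+1)(2B+3)X=(m+1)K\sigma^{m+1}$. Moreover $\sigma\ge2B$ bounds the
  -- convolutions by geometric sums of ratio $1/2$.
  set σ := B * (2 * B + 3) with hσ
  have hσ2 : 2 * B ≤ σ := by nlinarith
  have hσ1 : 1 ≤ σ := by linarith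
  have hσ0 : 0 < σ := by linarith
  set K := 1 + ∑ m ∈ Finset.range (r + 2), ‖PowerSeries.coeff m F‖ with hK
  have hK1 : 1 ≤ K := by
    rw [hK]; linarith [Finset.sum_nonneg fun m (_ : m ∈ Finset.range (r + 2)) =>
      norm_nonneg (PowerSeries.coeff m F)]
  have hpow : ∀ i j, B ^ i * σ ^ j ≤ (1 / 2) ^ i * σ ^ (i + j) := fun i j => by
    rw [pow_add, ← mul_assoc, ← mul_pow]
    have : B ≤ 1 / 2 * σ := by linarith
    gcongr
  have key : ∀ n, ‖PowerSeries.coeff n F‖ ≤ K * σ ^ n := by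
    intro n
    induction n using Nat.strong_induction_on with
    | _ n ih =>
      rcases lt_or_ge n (r + 2) with hn | hn
      · have : ‖PowerSeries.coeff n F‖ ≤ K := by
          rw [hK]
          have := Finset.single_le_sum (fun m (_ : m ∈ Finset.range (r + 2)) =>
            norm_nonneg (PowerSeries.coeff m F)) (Finset.mem_range.2 hn)
          linarith
        exact this.trans (le_mul_of_one_le_right (by linarith) (one_le_pow₀ hσ1))
      obtain ⟨m, rfl⟩ : ∃ m, n = m + 1 := ⟨n - 1, by omega⟩
      have hrec := congrArg (PowerSeries.coeff m) hF
      rw [coeff_frobOp, hp, ← sub_eq_add_neg] at hrec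
      have hsum1 : ‖∑ j ∈ Finset.range m, PowerSeries.coeff (m - j) p
          * ((j + 1) * PowerSeries.coeff (j + 1) F)‖ ≤ (m + 1) * (2 * B * (B * (K * σ ^ m))) := by
        refine (norm_sum_le _ _).trans ?_
        have : ∀ j ∈ Finset.range m, ‖PowerSeries.coeff (m - j) p
            * ((j + 1) * PowerSeries.coeff (j + 1) F)‖
            ≤ ((m + 1) * (B * (B * (K * σ ^ m)))) * (1 / 2) ^ (m - 1 - j) := fun j hj => by
          have hj := Finset.mem_range.1 hj
          obtain ⟨i, rfl⟩ : ∃ i, m = j + 1 + i := ⟨m - j - 1, by omega⟩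
          have hi := ih (j + 1) (by omega)
          have hh := hpow i (j + 1)
          have hj1 : ‖(j : ℂ) + 1‖ ≤ ((j + 1 + i : ℕ) : ℝ) + 1 := by
            rw [show (j : ℂ) + 1 = ((j + 1 : ℕ) : ℂ) by push_cast; ring, Complex.norm_natCast]
            push_cast; linarith [(Nat.cast_nonneg i : (0 : ℝ) ≤ i)]
          rw [norm_mul, norm_mul, show j + 1 + i - j = i + 1 by omega,
            show j + 1 + i - 1 - j = i by omega]
          calc _ ≤ (B * B ^ (i + 1)) * ((((j + 1 + i : ℕ) : ℝ) + 1) * (K * σ ^ (j + 1))) := by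
                gcongr
                exact h1 _
            _ = (((j + 1 + i : ℕ) : ℝ) + 1) * (B * (B * K)) * (B ^ i * σ ^ (j + 1)) := by
                rw [pow_succ]; ring
            _ ≤ (((j + 1 + i : ℕ) : ℝ) + 1) * (B * (B * K))
                  * ((1 / 2) ^ i * σ ^ (i + (j + 1))) := by gcongr
            _ = _ := by rw [show i + (j + 1) = j + 1 + i by ring]; ring
        refine (Finset.sum_le_sum this).trans ?_
        rw [← Finset.mul_sum]
        calc _ ≤ ((m + 1) * (B * (B * (K * σ ^ m)))) * 2 := by
              gcongr
              exact sum_half_pow_le m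
          _ = _ := by ring
      have hsum2 : ‖∑ j ∈ Finset.range (m + 1), PowerSeries.coeff (m - j) q
          * PowerSeries.coeff j F‖ ≤ 2 * (B * (K * σ ^ m)) := by
        refine (norm_sum_le _ _).trans ?_
        have : ∀ j ∈ Finset.range (m + 1), ‖PowerSeries.coeff (m - j) q * PowerSeries.coeff j F‖
            ≤ (B * (K * σ ^ m)) * (1 / 2) ^ (m + 1 - 1 - j) := fun j hj => by
          have hj := Finset.mem_range.1 hj
          obtain ⟨i, rfl⟩ : ∃ i, m = j + i := ⟨m - j, by omega⟩
          rw [norm_mul, show j + i - j = i by omega, show j + i + 1 - 1 - j = i by omega]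
          have hi := ih j (by omega)
          have hh := hpow i j
          calc _ ≤ (B * B ^ i) * (K * σ ^ j) := by gcongr; exact h2 _
            _ = (B * K) * (B ^ i * σ ^ j) := by ring
            _ ≤ (B * K) * ((1 / 2) ^ i * σ ^ (i + j)) := by gcongr
            _ = _ := by rw [add_comm i j]; ring
        refine (Finset.sum_le_sum this).trans ?_
        rw [← Finset.mul_sum]
        calc _ ≤ (B * (K * σ ^ m)) * 2 := by
              gcongr
              exact sum_half_pow_le (m + 1)
          _ = _ := by ring
      have hS : ‖PowerSeries.coeff m S‖ ≤ B * (K * σ ^ m) := by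
        refine (h3 m).trans ?_
        have : B ^ m ≤ σ ^ m := pow_le_pow_left₀ (by linarith) (by linarith) m
        have h4 : σ ^ m ≤ K * σ ^ m := le_mul_of_one_le_left (by positivity) hK1
        exact mul_le_mul_of_nonneg_left (this.trans h4) (by linarith)
      have heq : ((m : ℂ) + 1) * (m - r) * PowerSeries.coeff (m + 1) F
          = PowerSeries.coeff m S - (∑ j ∈ Finset.range m, PowerSeries.coeff (m - j) p
            * ((j + 1) * PowerSeries.coeff (j + 1) F)
            + ∑ j ∈ Finset.range (m + 1), PowerSeries.coeff (m - j) q * PowerSeries.coeff j F) := by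
        rw [← hrec, frobTail]; ring
      have hnorm : ‖((m : ℂ) + 1) * (m - r) * PowerSeries.coeff (m + 1) F‖
          ≤ B * (K * σ ^ m) + ((m + 1) * (2 * B * (B * (K * σ ^ m))) + 2 * (B * (K * σ ^ m))) := by
        rw [heq]
        exact (norm_sub_le _ _).trans (add_le_add hS ((norm_add_le _ _).trans
          (add_le_add hsum1 hsum2)))
      have hm1 : ‖(m : ℂ) + 1‖ = m + 1 := by
        rw [show (m : ℂ) + 1 = ((m + 1 : ℕ) : ℂ) by push_cast; ring, Complex.norm_natCast]
        push_cast; ring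
      have hm2 : 1 ≤ ‖(m : ℂ) - r‖ := by
        rw [← Nat.cast_sub (by omega), Complex.norm_natCast]
        exact_mod_cast (by omega : 1 ≤ m - r)
      rw [norm_mul, norm_mul, hm1] at hnorm
      have hX : 0 ≤ B * (K * σ ^ m) := by positivity
      have hm0 : (0 : ℝ) ≤ m := Nat.cast_nonneg m
      have hle : ((m : ℝ) + 1) * ‖PowerSeries.coeff (m + 1) F‖
          ≤ (m + 1) * (K * σ ^ (m + 1)) := by
        calc ((m : ℝ) + 1) * ‖PowerSeries.coeff (m + 1) F‖
            ≤ (m + 1) * ‖(m : ℂ) - r‖ * ‖PowerSeries.coeff (m + 1) F‖ := by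
              gcongr
              exact le_mul_of_one_le_right (by linarith) hm2
          _ ≤ _ := hnorm
          _ ≤ (m + 1) * ((2 * B + 3) * (B * (K * σ ^ m))) := by nlinarith
          _ = _ := by rw [pow_succ, hσ]; ring
      exact le_of_mul_le_mul_left hle (by linarith)
  refine ⟨K * σ, by nlinarith, fun n => (key n).trans ?_⟩
  rw [mul_pow K σ]
  have e1 : K ≤ K ^ (n + 1) := le_self_pow₀ hK1 (by omega)
  have e2 : σ ^ n ≤ σ ^ (n + 1) := pow_le_pow_right₀ hσ1 (by omega)
  exact mul_le_mul e1 e2 (by positivity) (by positivity)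

end TakemuraHeun

end

/-! ### Logarithmic solutions and the resonance obstruction -/

noncomputable section

namespace TakemuraHeun

theorem taylor_frob {b : ℂ} {p q g : ℂ → ℂ} (hp : AnalyticAt ℂ p b) (hq : AnalyticAt ℂ q b)
    (hg : AnalyticAt ℂ g b) :
    taylor b (fun z => (z - b) * deriv (deriv g) z + p z * deriv g z + q z * g z)
      = frobOp (taylor b p) (taylor b q) (taylor b g) := by
  have hid : AnalyticAt ℂ (fun z : ℂ => z - b) b := by fun_prop
  rw [taylor_add ((hid.fun_mul hg.deriv.deriv).fun_add (hp.fun_mul hg.deriv)) (hq.fun_mul hg),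
    taylor_add (hid.fun_mul hg.deriv.deriv) (hp.fun_mul hg.deriv), taylor_mul hid hg.deriv.deriv,
    taylor_mul hp hg.deriv, taylor_mul hq hg, taylor_sub_id, taylor_deriv, taylor_deriv, frobOp]

/-- A solution with a logarithm, from analytic `g` and `f = (z - b) k`. -/
theorem hasLogarithmicSolution_of {P Q p q g f k : ℂ → ℂ} {b c : ℂ} (hc : c ≠ 0)
    (hP : ∀ᶠ z in 𝓝[≠] b, P z = p z / (z - b)) (hQ : ∀ᶠ z in 𝓝[≠] b, Q z = q z / (z - b))
    (hg : AnalyticAt ℂ g b) (hf : AnalyticAt ℂ f b) (hk : AnalyticAt ℂ k b)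
    (hf0 : taylor b f ≠ 0) (hfk : ∀ᶠ z in 𝓝 b, f z = (z - b) * k z)
    (hfe : ∀ᶠ z in 𝓝 b, (z - b) * deriv (deriv f) z + p z * deriv f z + q z * f z = 0)
    (hge : ∀ᶠ z in 𝓝 b, (z - b) * deriv (deriv g) z + p z * deriv g z + q z * g z
      = -c * (2 * deriv f z + (p z - 1) * k z)) : HasLogarithmicSolution P Q b := by
  refine ⟨g, fun z => c * f z, hg.meromorphicAt, (analyticAt_const.fun_mul hf).meromorphicAt,
    fun h => ?_, ?_⟩
  · have h1 : ∀ᶠ z in 𝓝[≠] b, f z = 0 := h.mono fun z hz => (mul_eq_zero.1 hz).resolve_left hc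
    have h2 : f =ᶠ[𝓝 b] fun _ => 0 := hf.frequently_zero_iff_eventually_zero.1 h1.frequently
    rw [taylor_congr h2, taylor_const, map_zero] at hf0
    exact hf0 rfl
  · filter_upwards [hP, hQ, hge.filter_mono nhdsWithin_le_nhds,
      hfe.filter_mono nhdsWithin_le_nhds, hfk.eventually_nhds.filter_mono nhdsWithin_le_nhds,
      hg.eventually_analyticAt.filter_mono nhdsWithin_le_nhds,
      hf.eventually_analyticAt.filter_mono nhdsWithin_le_nhds,
      hk.eventually_analyticAt.filter_mono nhdsWithin_le_nhds, self_mem_nhdsWithin]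
      with z hPz hQz hgz hfz hfkz hga hfa hka hzb hz
    have hzb' : z - b ≠ 0 := sub_ne_zero.2 hzb
    -- Since $f/(w-b)=k$ is analytic, the first derivative shows no pole, and applying
    -- $t\,d^2+p\,d+q$ to $f\log t$ leaves $2f'+(p-1)k$ beyond the logarithmic term.
    have hd1 : ∀ᶠ w in 𝓝 z, deriv (fun w => g w + c * f w * Complex.log (w - b)) w
        = deriv g w + c * (deriv f w * Complex.log (w - b) + k w) := by
      have hsl : ∀ᶠ w in 𝓝 z, w - b ∈ Complex.slitPlane :=
        (Complex.isOpen_slitPlane.preimage (continuous_id.sub continuous_const)).mem_nhds hz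
      filter_upwards [hsl, hfkz, hga.eventually_analyticAt, hfa.eventually_analyticAt]
        with w hw hfkw hgw hfw
      have hwb : w - b ≠ 0 := Complex.slitPlane_ne_zero hw
      have h1 : HasDerivAt (fun w => Complex.log (w - b)) (1 / (w - b)) w := by
        simpa using ((hasDerivAt_id' w).sub_const b).clog hw
      have h2 := hgw.differentiableAt.hasDerivAt.fun_add
        ((hfw.differentiableAt.hasDerivAt.const_mul c).fun_mul h1)
      rw [h2.deriv, hfkw]
      field_simp
    have hl : HasDerivAt (fun w => Complex.log (w - b)) (1 / (z - b)) z := by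
      simpa using ((hasDerivAt_id' z).sub_const b).clog hz
    have h2 := hga.deriv.differentiableAt.hasDerivAt.fun_add
      (((hfa.deriv.differentiableAt.hasDerivAt.fun_mul hl).fun_add
        hka.differentiableAt.hasDerivAt).const_mul c)
    have h3 : deriv f z = k z + (z - b) * deriv k z := by
      rw [EventuallyEq.deriv_eq hfkz]
      have := ((hasDerivAt_id' z).sub_const b).fun_mul hka.differentiableAt.hasDerivAt
      rw [this.deriv]; ring
    have h4 := hfkz.self_of_nhds
    rw [SolvesAt, EventuallyEq.deriv_eq hd1, h2.deriv, hd1.self_of_nhds, hPz, hQz]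
    field_simp
    linear_combination hgz + c * Complex.log (z - b) * hfz - c * h3

/-- If there is no logarithmic solution, then both exponents `0` and `r + 1` belong to power
series solutions. -/
theorem exists_formal_solutions {r : ℕ} {P Q p q : ℂ → ℂ} {b : ℂ}
    (hP : ∀ᶠ z in 𝓝[≠] b, P z = p z / (z - b)) (hQ : ∀ᶠ z in 𝓝[≠] b, Q z = q z / (z - b))
    (hpa : AnalyticAt ℂ p b) (hqa : AnalyticAt ℂ q b) (hp : p b = -r)
    (hlog : ¬ HasLogarithmicSolution P Q b) :
    (∃ F, PowerSeries.constantCoeff F = 1 ∧ frobOp (taylor b p) (taylor b q) F = 0) ∧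
    ∃ F, (∀ m ≤ r, PowerSeries.coeff m F = 0) ∧ PowerSeries.coeff (r + 1) F = 1 ∧
      frobOp (taylor b p) (taylor b q) F = 0 := by
  have hp' : PowerSeries.constantCoeff (taylor b p) = -r := by rw [constantCoeff_taylor, hp]
  obtain ⟨F₁, h10, h11, h1⟩ := exists_frobenius (q := taylor b q) hp' 0 0 1
  obtain ⟨h1v, h1r⟩ := coeff_frobenius_eq_zero hp' (S := 0) (by simp) h10 h1
  have hF₁ : frobOp (taylor b p) (taylor b q) F₁ = 0 := by
    ext n
    by_cases hn : n = r
    · rw [hn, h1r, map_zero]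
    · exact h1 n hn
  refine ⟨?_, F₁, h1v, h11, hF₁⟩
  obtain ⟨F₀, h00, h01, h0⟩ := exists_frobenius (q := taylor b q) hp' 0 1 0
  rw [PowerSeries.coeff_zero_eq_constantCoeff_apply] at h00
  refine ⟨F₀, h00, ?_⟩
  -- The single obstruction to a series solution with exponent $0$: by construction the operator
  -- sends $F_0$ to $\kappa t^r$. If $\kappa\ne0$, a logarithmic solution is built.
  set κ := PowerSeries.coeff r (frobOp (taylor b p) (taylor b q) F₀) with hκ
  by_cases hκ0 : κ = 0
  · ext n
    by_cases hn : n = r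
    · rw [hn, ← hκ, hκ0, map_zero]
    · exact h0 n hn
  exfalso
  apply hlog
  have hr1 : (r : ℂ) + 1 ≠ 0 := by exact_mod_cast r.succ_ne_zero
  -- For $f=t^{r+1}+\cdots$ the source $-c(2f'+(p-1)k)$ has coefficient $-c(r+1)$ at $t^r$, and this
  -- choice makes it $\kappa$.
  set c := -κ / (r + 1) with hc
  have hc0 : c ≠ 0 := div_ne_zero (neg_ne_zero.2 hκ0) hr1
  have hG1 : GeomBound F₁ := geomBound_of_frobOp_eq hp' (geomBound_taylor hpa)
    (geomBound_taylor hqa) (S := 0) ⟨1, le_rfl, fun n => by simp⟩ hF₁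
  obtain ⟨f, hfa, hf⟩ := hG1.exists_taylor_eq b
  set K₁ : PowerSeries ℂ := PowerSeries.mk fun n => PowerSeries.coeff (n + 1) F₁ with hK₁
  have hXK : F₁ = PowerSeries.X * K₁ := by
    ext n
    cases n with
    | zero => simpa using h10
    | succ n => rw [PowerSeries.coeff_succ_X_mul, hK₁, PowerSeries.coeff_mk]
  obtain ⟨k, hka, hk⟩ : ∃ k, AnalyticAt ℂ k b ∧ taylor b k = K₁ := by
    apply GeomBound.exists_taylor_eq
    obtain ⟨B, hB, hb⟩ := hG1
    refine ⟨B ^ 2, one_le_pow₀ hB, fun n => ?_⟩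
    rw [hK₁, PowerSeries.coeff_mk, ← pow_mul]
    exact (hb (n + 1)).trans (pow_le_pow_right₀ hB (by omega))
  set s : ℂ → ℂ := fun z => -c * (2 * deriv f z + (p z - 1) * k z) with hs
  have hsa : AnalyticAt ℂ s b := by have := hfa.deriv; fun_prop
  have hst : taylor b s = PowerSeries.C (-c) * (2 * PowerSeries.derivative ℂ F₁
      + (taylor b p - 1) * K₁) := by
    have e1 : AnalyticAt ℂ (fun z => 2 * deriv f z) b := analyticAt_const.fun_mul hfa.deriv
    have e2 : AnalyticAt ℂ (fun z => p z + -1) b := hpa.fun_add analyticAt_const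
    simp only [hs, sub_eq_add_neg]
    rw [taylor_mul analyticAt_const (e1.fun_add (e2.fun_mul hka)), taylor_const,
      taylor_add e1 (e2.fun_mul hka), taylor_mul analyticAt_const hfa.deriv, taylor_const,
      taylor_mul e2 hka, taylor_add hpa analyticAt_const, taylor_const, taylor_deriv, hf, hk, map_ofNat]
    simp
  have hK₁v : ∀ m < r, PowerSeries.coeff m K₁ = 0 := fun m hm => by
    rw [hK₁, PowerSeries.coeff_mk, h1v _ (by omega)]
  have hmul : ∀ n, (∀ m < n, PowerSeries.coeff m K₁ = 0) → ∀ G : PowerSeries ℂ,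
      PowerSeries.coeff n (G * K₁) = PowerSeries.constantCoeff G * PowerSeries.coeff n K₁ := by
    intro n hn G
    rw [PowerSeries.coeff_mul, Finset.sum_eq_single (0, n)]
    · rw [PowerSeries.coeff_zero_eq_constantCoeff_apply]
    · rintro ⟨i, j⟩ hij hne
      have := Finset.HasAntidiagonal.mem_antidiagonal.1 hij
      simp only at this
      rw [hn j, mul_zero]
      by_contra h
      exact hne (Prod.ext (by simp only; omega) (by simp only; omega))
    · simp
  have hsn : ∀ n ≤ r, PowerSeries.coeff n (taylor b s)
      = -c * (2 * ((n + 1) * PowerSeries.coeff (n + 1) F₁)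
        + (-r - 1) * PowerSeries.coeff (n + 1) F₁) := fun n hn => by
    rw [hst, PowerSeries.coeff_C_mul, map_add, hmul n (fun m hm => hK₁v m (by omega)),
      map_sub, hp', map_one, ← map_ofNat (PowerSeries.C (R := ℂ)) 2,
      PowerSeries.coeff_C_mul, PowerSeries.coeff_derivative, hK₁, PowerSeries.coeff_mk]
    ring
  have hsv : ∀ n < r, PowerSeries.coeff n (taylor b s) = 0 := fun n hn => by
    rw [hsn n hn.le, h1v _ (by omega)]; ring
  have hsr : PowerSeries.coeff r (taylor b s) = κ := by
    rw [hsn r le_rfl, h11, hc]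
    field_simp
    ring
  -- $F_0$ already produces the term $\kappa t^r$ of the source. The remainder vanishes through
  -- degree $r$, so no resonance obstructs $H$, and $F_0+H$ is the non-logarithmic part.
  obtain ⟨H, hH0, -, hH⟩ := exists_frobenius (q := taylor b q) hp'
    (taylor b s - PowerSeries.monomial r κ) 0 0
  have hSv : ∀ n < r, PowerSeries.coeff n (taylor b s - PowerSeries.monomial r κ) = 0 :=
    fun n hn => by
      rw [map_sub, hsv n hn, PowerSeries.coeff_monomial, if_neg hn.ne, sub_zero]
  obtain ⟨-, hHr⟩ := coeff_frobenius_eq_zero hp' hSv hH0 hH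
  have hG : frobOp (taylor b p) (taylor b q) (F₀ + H) = taylor b s := by
    rw [frobOp_add]
    ext n
    rw [map_add]
    by_cases hn : n = r
    · rw [hn, hHr, ← hκ, hsr, add_zero]
    · rw [h0 n hn, hH n hn, map_sub, PowerSeries.coeff_monomial, if_neg hn]; simp
  obtain ⟨g, hga, hg⟩ := (geomBound_of_frobOp_eq hp' (geomBound_taylor hpa)
    (geomBound_taylor hqa) (geomBound_taylor hsa) hG).exists_taylor_eq b
  have hid : AnalyticAt ℂ (fun z : ℂ => z - b) b := by fun_prop
  refine hasLogarithmicSolution_of hc0 hP hQ hga hfa hka ?_ ?_ ?_ ?_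
  · rw [hf]
    intro h
    rw [h, map_zero] at h11
    exact zero_ne_one h11
  · have e := eventually_eq_zero_of_taylor (hfa.fun_add
      (analyticAt_const (v := (-1 : ℂ)) |>.fun_mul (hid.fun_mul hka))) (by
      rw [taylor_add hfa (analyticAt_const.fun_mul (hid.fun_mul hka)),
        taylor_mul analyticAt_const (hid.fun_mul hka), taylor_mul hid hka, taylor_const,
        taylor_sub_id, hf, hk, ← hXK]
      simp)
    exact e.mono fun z hz => by linear_combination hz
  · refine eventually_eq_zero_of_taylor ?_ (by rw [taylor_frob hpa hqa hfa, hf, hF₁])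
    have := hfa.deriv; have := hfa.deriv.deriv
    fun_prop
  · have h2 := hga.deriv; have h3 := hga.deriv.deriv
    have e1 : AnalyticAt ℂ
        (fun z => (z - b) * deriv (deriv g) z + p z * deriv g z + q z * g z) b := by fun_prop
    have e := eventually_eq_zero_of_taylor (e1.fun_add
      (analyticAt_const (v := (-1 : ℂ)) |>.fun_mul hsa)) (by
      rw [taylor_add e1 (analyticAt_const.fun_mul hsa), taylor_mul analyticAt_const hsa,
        taylor_frob hpa hqa hga, hg, hG, taylor_const]
      simp)
    exact e.mono fun z hz => by linear_combination hz

end TakemuraHeun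

end

noncomputable section

namespace TakemuraHeun

/-! ### The algebraic identity between the two forms of the equation -/

theorem sum_sum_erase_comm {ι A : Type*} [Fintype ι] [DecidableEq ι] [AddCommMonoid A]
    (f : ι → ι → A) : ∑ k, ∑ m ∈ Finset.univ.erase k, f k m
      = ∑ k, ∑ m ∈ Finset.univ.erase k, f m k :=
  Finset.sum_comm' fun k m => by simp [eq_comm]

section Identity

variable {A : Type*} [Field A] [CharZero A]

/-- Expanding the square of the logarithmic derivative splits `fuchs_identity` into terms involving
no $b_k$, one $b_k$, or two distinct ones; this is the first kind. -/
theorem identity_no_poles {e₁ e₂ e₃ x : A} (he : e₁ + e₂ + e₃ = 0) (h₁ : x - e₁ ≠ 0)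
    (h₂ : x - e₂ ≠ 0) (h₃ : x - e₃ ≠ 0) (l₀ l₁ l₂ l₃ E : A) :
    2 * (4 * (x - e₁) * (x - e₂) * (x - e₃))
        * (l₁ / (x - e₁) ^ 2 + l₂ / (x - e₂) ^ 2 + l₃ / (x - e₃) ^ 2)
      + (4 * (x - e₁) * (x - e₂) * (x - e₃))
        * (l₁ / (x - e₁) + l₂ / (x - e₂) + l₃ / (x - e₃)) ^ 2
      - (l₁ / (x - e₁) + l₂ / (x - e₂) + l₃ / (x - e₃))
        * (4 * ((x - e₁) * (x - e₂) + (x - e₁) * (x - e₃) + (x - e₂) * (x - e₃)))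
      + 4 * (E - (l₀ * (l₀ + 1) * x
        + l₁ * (l₁ + 1) * (e₁ + (e₁ - e₂) * (e₁ - e₃) / (x - e₁))
        + l₂ * (l₂ + 1) * (e₂ + (e₂ - e₁) * (e₂ - e₃) / (x - e₂))
        + l₃ * (l₃ + 1) * (e₃ + (e₃ - e₁) * (e₃ - e₂) / (x - e₃))))
    = 4 * ((l₀ + l₁ + l₂ + l₃) * (l₀ + l₁ + l₂ + l₃ - 2 * l₀ - 1) * x
      + (E + (e₁ * l₁ ^ 2 + e₂ * l₂ ^ 2 + e₃ * l₃ ^ 2)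
        - 2 * (l₁ * l₂ * e₃ + l₂ * l₃ * e₁ + l₃ * l₁ * e₂))) := by
  obtain rfl : e₃ = -e₁ - e₂ := by linear_combination he
  field_simp
  ring

theorem identity_one_pole {e₁ e₂ e₃ x b : A} (he : e₁ + e₂ + e₃ = 0) (h₁ : x - e₁ ≠ 0)
    (h₂ : x - e₂ ≠ 0) (h₃ : x - e₃ ≠ 0) (hb : x - b ≠ 0) (l₁ l₂ l₃ r s : A) :
    2 * (4 * (x - e₁) * (x - e₂) * (x - e₃)) * (r / (x - b) ^ 2)
      + 2 * (4 * (x - e₁) * (x - e₂) * (x - e₃))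
        * (l₁ / (x - e₁) + l₂ / (x - e₂) + l₃ / (x - e₃)) * (r / (x - b))
      + (4 * (x - e₁) * (x - e₂) * (x - e₃)) * (r / (x - b)) ^ 2
      - r / (x - b) * (4 * ((x - e₁) * (x - e₂) + (x - e₁) * (x - e₃) + (x - e₂) * (x - e₃)))
      - 4 * (r / 2 * (r / 2 + 1) * (2 * b + (12 * b ^ 2 + 4 * (e₁ * e₂ + e₂ * e₃ + e₃ * e₁)) / 2
          / (x - b) + 4 * (b - e₁) * (b - e₂) * (b - e₃) / (x - b) ^ 2) + s / (x - b))
    = 4 * ((-s + r * (1 / 8 * r * (12 * b ^ 2 - -4 * (e₁ * e₂ + e₂ * e₃ + e₃ * e₁))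
        + 2 * (l₁ * (b - e₂) * (b - e₃) + l₂ * (b - e₁) * (b - e₃) + l₃ * (b - e₁) * (b - e₂))))
          / (x - b))
      + (r ^ 2 * (6 * b + 4 * x) - 4 * r * x
        + 8 * r * (l₁ * (x + b + e₁) + l₂ * (x + b + e₂) + l₃ * (x + b + e₃))) := by
  obtain rfl : e₃ = -e₁ - e₂ := by linear_combination he
  field_simp
  ring

/-- The partial fraction decomposition of a cross term. Its residues give the sum over $i''\ne i'$
in the accessory parameters, its polynomial part contributes to $N(N-2l_0-1)z+p$. -/
theorem identity_two_poles {e₁ e₂ e₃ x b b' : A} (he : e₁ + e₂ + e₃ = 0) (hb : x - b ≠ 0)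
    (hb' : x - b' ≠ 0) (hbb : b - b' ≠ 0) (r r' : A) :
    (4 * (x - e₁) * (x - e₂) * (x - e₃)) * (r / (x - b) * (r' / (x - b')))
      = r * r' * (4 * x + 4 * b + 4 * b')
        + r * (4 * (b - e₁) * (b - e₂) * (b - e₃)) * (r' / (b - b')) / (x - b)
        + r' * (4 * (b' - e₁) * (b' - e₂) * (b' - e₃)) * (r / (b' - b)) / (x - b') := by
  obtain rfl : e₃ = -e₁ - e₂ := by linear_combination he
  rw [← neg_sub b b']
  field_simp
  ring

/-- The normal form of the Fuchsian equation. -/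
theorem fuchs_identity {M : ℕ} {e₁ e₂ e₃ x : A} {b : Fin M → A} (he : e₁ + e₂ + e₃ = 0)
    (h₁ : x - e₁ ≠ 0) (h₂ : x - e₂ ≠ 0) (h₃ : x - e₃ ≠ 0) (hb : ∀ k, x - b k ≠ 0)
    (hinj : Function.Injective b) (l₀ l₁ l₂ l₃ E : A) (r s : Fin M → A) :
    4 * ((l₀ + l₁ + l₂ + l₃ + ∑ k, r k) * (l₀ + l₁ + l₂ + l₃ + ∑ k, r k - 2 * l₀ - 1) * x
      + (E + (e₁ * l₁ ^ 2 + e₂ * l₂ ^ 2 + e₃ * l₃ ^ 2)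
        - 2 * (l₁ * l₂ * e₃ + l₂ * l₃ * e₁ + l₃ * l₁ * e₂)
        - 1 / 2 * ∑ k, b k * r k ^ 2
        + 2 * ∑ k, (l₁ * r k * (e₁ + b k) + l₂ * r k * (e₂ + b k) + l₃ * r k * (e₃ + b k))
        + 2 * (∑ k, b k * r k) * (∑ k, r k))
      + ∑ k, (-s k + r k * (1 / 8 * r k * (12 * b k ^ 2 - -4 * (e₁ * e₂ + e₂ * e₃ + e₃ * e₁))
        + 1 / 2 * (4 * (b k - e₁) * (b k - e₂) * (b k - e₃)) *
            (∑ m ∈ Finset.univ.erase k, r m / (b k - b m))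
        + 2 * (l₁ * (b k - e₂) * (b k - e₃) + l₂ * (b k - e₁) * (b k - e₃)
            + l₃ * (b k - e₁) * (b k - e₂)))) / (x - b k))
    = 2 * (4 * (x - e₁) * (x - e₂) * (x - e₃))
        * (l₁ / (x - e₁) ^ 2 + l₂ / (x - e₂) ^ 2 + l₃ / (x - e₃) ^ 2
          + ∑ k, r k / (x - b k) ^ 2)
      + (4 * (x - e₁) * (x - e₂) * (x - e₃))
        * (l₁ / (x - e₁) + l₂ / (x - e₂) + l₃ / (x - e₃) + ∑ k, r k / (x - b k)) ^ 2
      - (l₁ / (x - e₁) + l₂ / (x - e₂) + l₃ / (x - e₃) + ∑ k, r k / (x - b k))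
        * (4 * ((x - e₁) * (x - e₂) + (x - e₁) * (x - e₃) + (x - e₂) * (x - e₃)))
      + 4 * (E - (l₀ * (l₀ + 1) * x
        + l₁ * (l₁ + 1) * (e₁ + (e₁ - e₂) * (e₁ - e₃) / (x - e₁))
        + l₂ * (l₂ + 1) * (e₂ + (e₂ - e₁) * (e₂ - e₃) / (x - e₂))
        + l₃ * (l₃ + 1) * (e₃ + (e₃ - e₁) * (e₃ - e₂) / (x - e₃))
        + ∑ k, (r k / 2 * (r k / 2 + 1) * (2 * b k
          + (12 * b k ^ 2 + 4 * (e₁ * e₂ + e₂ * e₃ + e₃ * e₁)) / 2 / (x - b k)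
          + 4 * (b k - e₁) * (b k - e₂) * (b k - e₃) / (x - b k) ^ 2) + s k / (x - b k)))) := by
  classical
  have h0 := identity_no_poles he h₁ h₂ h₃ l₀ l₁ l₂ l₃ E
  have hk := Finset.sum_congr rfl fun k (_ : k ∈ Finset.univ) =>
    identity_one_pole he h₁ h₂ h₃ (hb k) l₁ l₂ l₃ (r k) (s k)
  have hkm : ∑ k, ∑ m ∈ Finset.univ.erase k, (4 * (x - e₁) * (x - e₂) * (x - e₃))
        * (r k / (x - b k) * (r m / (x - b m)))
      = ∑ k, ∑ m ∈ Finset.univ.erase k, (r k * r m * (4 * x + 4 * b k + 4 * b m)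
        + r k * (4 * (b k - e₁) * (b k - e₂) * (b k - e₃)) * (r m / (b k - b m)) / (x - b k)
        + r m * (4 * (b m - e₁) * (b m - e₂) * (b m - e₃)) * (r k / (b m - b k))
          / (x - b m)) :=
    Finset.sum_congr rfl fun k _ => Finset.sum_congr rfl fun m hm =>
      identity_two_poles he (hb k) (hb m)
        (sub_ne_zero.2 fun h => (Finset.ne_of_mem_erase hm) (hinj h).symm) (r k) (r m)
  simp only [Finset.sum_add_distrib] at hkm
  -- Swapping the indices identifies the residue sums at $b_k$ and at $b_m$, so together they are
  -- twice one of them.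
  rw [← sum_sum_erase_comm (fun k m => r k * (4 * (b k - e₁) * (b k - e₂) * (b k - e₃))
    * (r m / (b k - b m)) / (x - b k))] at hkm
  have hsplit (f : Fin M → Fin M → A) :
      ∑ k, ∑ m ∈ Finset.univ.erase k, f k m = ∑ k, ∑ m, f k m - ∑ k, f k k := by
    rw [eq_sub_iff_add_eq, ← Finset.sum_add_distrib]
    exact Finset.sum_congr rfl fun k _ => Finset.sum_erase_add _ _ (Finset.mem_univ k)
  have hsq : ∑ k, ∑ m ∈ Finset.univ.erase k, (4 * (x - e₁) * (x - e₂) * (x - e₃))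
        * (r k / (x - b k) * (r m / (x - b m)))
      = (4 * (x - e₁) * (x - e₂) * (x - e₃)) * (∑ k, r k / (x - b k)) ^ 2
        - ∑ k, (4 * (x - e₁) * (x - e₂) * (x - e₃)) * (r k / (x - b k)) ^ 2 := by
    rw [hsplit]
    congr 1
    · rw [sq, Finset.sum_mul_sum, Finset.mul_sum]
      exact Finset.sum_congr rfl fun k _ => by rw [Finset.mul_sum]
    · exact Finset.sum_congr rfl fun k _ => by rw [sq]
  have hpoly : ∑ k, ∑ m ∈ Finset.univ.erase k, r k * r m * (4 * x + 4 * b k + 4 * b m)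
      = 4 * x * (∑ k, r k) ^ 2 + 8 * (∑ k, b k * r k) * (∑ k, r k)
        - ∑ k, r k ^ 2 * (4 * x + 8 * b k) := by
    rw [hsplit]
    congr 1
    · have e1 : ∀ k m, r k * r m * (4 * x + 4 * b k + 4 * b m)
        = 4 * x * (r k * r m) + 4 * (b k * r k * r m) + 4 * (r k * (b m * r m)) :=
        fun k m => by ring
      simp only [e1, Finset.sum_add_distrib, ← Finset.mul_sum, ← Finset.sum_mul]
      ring
    · exact Finset.sum_congr rfl fun k _ => by ring
  have hZ : ∑ k, ∑ m ∈ Finset.univ.erase k, r k * (4 * (b k - e₁) * (b k - e₂) * (b k - e₃))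
        * (r m / (b k - b m)) / (x - b k)
      = ∑ k, r k * (4 * (b k - e₁) * (b k - e₂) * (b k - e₃))
        * (∑ m ∈ Finset.univ.erase k, r m / (b k - b m)) / (x - b k) :=
    Finset.sum_congr rfl fun k _ => by rw [Finset.mul_sum, Finset.sum_div]
  rw [hsq, hpoly, hZ] at hkm
  have hR : ∑ k, (r k ^ 2 * (6 * b k + 4 * x) - 4 * r k * x
        + 8 * r k * (l₁ * (x + b k + e₁) + l₂ * (x + b k + e₂) + l₃ * (x + b k + e₃)))
      - ∑ k, r k ^ 2 * (4 * x + 8 * b k)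
      = -2 * ∑ k, b k * r k ^ 2 + (8 * (l₁ + l₂ + l₃) - 4) * x * ∑ k, r k
        + 8 * ∑ k, (l₁ * r k * (e₁ + b k) + l₂ * r k * (e₂ + b k)
          + l₃ * r k * (e₃ + b k)) := by
    simp only [Finset.mul_sum]
    rw [← Finset.sum_sub_distrib, ← Finset.sum_add_distrib, ← Finset.sum_add_distrib]
    exact Finset.sum_congr rfl fun k _ => by ring
  have hO : ∑ k, (-s k + r k * (1 / 8 * r k
        * (12 * b k ^ 2 - -4 * (e₁ * e₂ + e₂ * e₃ + e₃ * e₁))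
        + 1 / 2 * (4 * (b k - e₁) * (b k - e₂) * (b k - e₃)) *
            (∑ m ∈ Finset.univ.erase k, r m / (b k - b m))
        + 2 * (l₁ * (b k - e₂) * (b k - e₃) + l₂ * (b k - e₁) * (b k - e₃)
            + l₃ * (b k - e₁) * (b k - e₂)))) / (x - b k)
      = ∑ k, (-s k + r k * (1 / 8 * r k
        * (12 * b k ^ 2 - -4 * (e₁ * e₂ + e₂ * e₃ + e₃ * e₁))
        + 2 * (l₁ * (b k - e₂) * (b k - e₃) + l₂ * (b k - e₁) * (b k - e₃)
            + l₃ * (b k - e₁) * (b k - e₂)))) / (x - b k)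
        + 1 / 2 * ∑ k, r k * (4 * (b k - e₁) * (b k - e₂) * (b k - e₃))
        * (∑ m ∈ Finset.univ.erase k, r m / (b k - b m)) / (x - b k) := by
    rw [Finset.mul_sum, ← Finset.sum_add_distrib]
    exact Finset.sum_congr rfl fun k _ => by ring
  rw [Finset.sum_add_distrib, ← Finset.mul_sum] at hk
  have hL : ∑ k, (2 * (4 * (x - e₁) * (x - e₂) * (x - e₃)) * (r k / (x - b k) ^ 2)
      + 2 * (4 * (x - e₁) * (x - e₂) * (x - e₃))
        * (l₁ / (x - e₁) + l₂ / (x - e₂) + l₃ / (x - e₃)) * (r k / (x - b k))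
      + (4 * (x - e₁) * (x - e₂) * (x - e₃)) * (r k / (x - b k)) ^ 2
      - r k / (x - b k)
        * (4 * ((x - e₁) * (x - e₂) + (x - e₁) * (x - e₃) + (x - e₂) * (x - e₃)))
      - 4 * (r k / 2 * (r k / 2 + 1) * (2 * b k
          + (12 * b k ^ 2 + 4 * (e₁ * e₂ + e₂ * e₃ + e₃ * e₁)) / 2 / (x - b k)
          + 4 * (b k - e₁) * (b k - e₂) * (b k - e₃) / (x - b k) ^ 2) + s k / (x - b k)))
    = 2 * (4 * (x - e₁) * (x - e₂) * (x - e₃)) * (∑ k, r k / (x - b k) ^ 2)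
      + 2 * (4 * (x - e₁) * (x - e₂) * (x - e₃))
        * (l₁ / (x - e₁) + l₂ / (x - e₂) + l₃ / (x - e₃)) * (∑ k, r k / (x - b k))
      + (∑ k, (4 * (x - e₁) * (x - e₂) * (x - e₃)) * (r k / (x - b k)) ^ 2)
      - (∑ k, r k / (x - b k))
        * (4 * ((x - e₁) * (x - e₂) + (x - e₁) * (x - e₃) + (x - e₂) * (x - e₃)))
      - 4 * ∑ k, (r k / 2 * (r k / 2 + 1) * (2 * b k
          + (12 * b k ^ 2 + 4 * (e₁ * e₂ + e₂ * e₃ + e₃ * e₁)) / 2 / (x - b k)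
          + 4 * (b k - e₁) * (b k - e₂) * (b k - e₃) / (x - b k) ^ 2) + s k / (x - b k)) := by
    simp only [Finset.mul_sum, Finset.sum_mul]
    rw [← Finset.sum_add_distrib, ← Finset.sum_add_distrib, ← Finset.sum_sub_distrib,
      ← Finset.sum_sub_distrib]
  rw [hL] at hk
  rw [hO]
  linear_combination -h0 - hk - hkm - hR

end Identity

end TakemuraHeun

end

noncomputable section

namespace TakemuraHeun

/-! ### Elements that are regular at a point -/

section OffPole

variable {κ : Type} {c : κ → ℂ}

/-- The functions whose partial fraction decomposition does not involve the generator with a pole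
at `o`. -/
def offPole (o : Option κ) : Subalgebra ℂ (PoleRing κ) :=
  Algebra.adjoin ℂ (MvPolynomial.X '' {o' | o' ≠ o})

theorem X_mem_offPole {o o' : Option κ} (h : o' ≠ o) :
    (MvPolynomial.X o' : PoleRing κ) ∈ offPole o :=
  Algebra.subset_adjoin ⟨o', h, rfl⟩

theorem C_mem_offPole (o : Option κ) (a : ℂ) : (MvPolynomial.C a : PoleRing κ) ∈ offPole o :=
  (offPole o).algebraMap_mem a

theorem exists_hasLead_of_mem_offPole (hc : Function.Injective c) {o : Option κ}
    {h : PoleRing κ} (hh : h ∈ offPole o) : ∃ d, HasLead 0 d (evalAt c (coord c o) h) := by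
  induction hh using Algebra.adjoin_induction with
  | mem x hx =>
    obtain ⟨o', ho', rfl⟩ := hx
    exact hasLead_evalAt_coord hc (Ne.symm ho')
  | algebraMap a => exact ⟨a, by rw [AlgHom.commutes]; exact hasLead_algebraMap a⟩
  | add x y _ _ hx hy =>
    obtain ⟨a, ha⟩ := hx
    obtain ⟨b, hb⟩ := hy
    rw [map_add]
    exact ⟨_, ha.add hb⟩
  | mul x y _ _ hx hy =>
    obtain ⟨a, ha⟩ := hx
    obtain ⟨b, hb⟩ := hy
    rw [map_mul]
    exact ⟨_, ha.mul hb⟩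

theorem coe_taylor_const (b a : ℂ) :
    ((taylor b fun _ => a : PowerSeries ℂ) : LaurentSeries ℂ) = algebraMap ℂ _ a := by
  rw [taylor_const, algebraMap_eq_single]
  simp

/-- Both expansions are multiplicative and additive, so the generators suffice. This links the
analytic hypothesis at $b_k$ to formal computation in Laurent series. -/
theorem taylor_of_mem_offPole (hc : Function.Injective c) {k : κ} {h : PoleRing κ}
    (hh : h ∈ offPole (some k)) : AnalyticAt ℂ (fun z => evalAt c z h) (c k) ∧
      evalAt c (coord c (some k)) h
        = ((taylor (c k) fun z => evalAt c z h : PowerSeries ℂ) : LaurentSeries ℂ) := by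
  have hcoord : coord c (some k)
      = ((taylor (c k) fun z => z : PowerSeries ℂ) : LaurentSeries ℂ) := by
    have : (fun z : ℂ => z) = fun z => (z - c k) + c k := by funext z; ring
    rw [this, taylor_add (by fun_prop) (by fun_prop), taylor_sub_id, PowerSeries.coe_add,
      coe_taylor_const, PowerSeries.coe_X]
    rfl
  induction hh using Algebra.adjoin_induction with
  | mem x hx =>
    obtain ⟨o', ho', rfl⟩ := hx
    cases o' with
    | none =>
      simp only [evalAt_X_none]
      exact ⟨analyticAt_id, hcoord⟩
    | some j =>
      have hkj : c k - c j ≠ 0 := sub_ne_zero.2 fun e => ho' (by rw [hc e])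
      have h1 : AnalyticAt ℂ (fun z : ℂ => z - c j) (c k) := by fun_prop
      have h2 : AnalyticAt ℂ (fun z : ℂ => (z - c j)⁻¹) (c k) := h1.fun_inv hkj
      simp only [evalAt_X_some, Algebra.algebraMap_self, RingHom.id_apply]
      refine ⟨h2, inv_eq_of_mul_eq_one_right ?_⟩
      have h3 : (coord c (some k) - algebraMap ℂ _ (c j))
          = ((taylor (c k) fun z => z + -c j : PowerSeries ℂ) : LaurentSeries ℂ) := by
        rw [taylor_add (by fun_prop) (by fun_prop), PowerSeries.coe_add, coe_taylor_const,
          hcoord, map_neg, sub_eq_add_neg]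
      simp only [← sub_eq_add_neg] at h3
      rw [h3, ← PowerSeries.coe_mul, ← taylor_mul h1 h2]
      have h4 : (fun z => (z - c j) * (z - c j)⁻¹) =ᶠ[𝓝 (c k)] fun _ => 1 := by
        filter_upwards [h1.continuousAt.eventually_ne hkj] with z hz
        exact mul_inv_cancel₀ hz
      rw [taylor_congr h4, taylor_const]
      simp
  | algebraMap a =>
    simp only [AlgHom.commutes, Algebra.algebraMap_self, RingHom.id_apply]
    exact ⟨analyticAt_const, (coe_taylor_const _ _).symm⟩
  | add x y _ _ hx hy =>
    simp only [map_add]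
    refine ⟨hx.1.fun_add hy.1, ?_⟩
    rw [taylor_add hx.1 hy.1, PowerSeries.coe_add, hx.2, hy.2]
  | mul x y _ _ hx hy =>
    simp only [map_mul]
    refine ⟨hx.1.fun_mul hy.1, ?_⟩
    rw [taylor_mul hx.1 hy.1, PowerSeries.coe_mul, hx.2, hy.2]

end OffPole

/-- `f` is a nonzero multiple of `t ^ n` plus higher order terms. -/
def HasOrder (n : ℤ) (f : LaurentSeries ℂ) : Prop := ∃ c ≠ 0, HasLead n c f

theorem HasOrder.mul {n m : ℤ} {f g : LaurentSeries ℂ} (hf : HasOrder n f) (hg : HasOrder m g) :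
    HasOrder (n + m) (f * g) :=
  let ⟨_, hc, hf⟩ := hf
  let ⟨_, hd, hg⟩ := hg
  ⟨_, mul_ne_zero hc hd, hf.mul hg⟩

theorem HasOrder.pow {n : ℤ} {f : LaurentSeries ℂ} (hf : HasOrder n f) (k : ℕ) :
    HasOrder (k * n) (f ^ k) :=
  let ⟨_, hc, hf⟩ := hf
  ⟨_, pow_ne_zero k hc, hf.pow k⟩

theorem HasOrder.prod {ι : Type*} (s : Finset ι) {f : ι → LaurentSeries ℂ}
    (hf : ∀ i ∈ s, HasOrder 0 (f i)) : HasOrder 0 (∏ i ∈ s, f i) := by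
  classical
  induction s using Finset.induction_on with
  | empty => exact ⟨1, one_ne_zero, by simpa using hasLead_algebraMap 1⟩
  | insert a s ha ih =>
    rw [Finset.prod_insert ha]
    simpa using (hf a (by simp)).mul (ih fun i hi => hf i (by simp [hi]))

/-! ### The local data of the Fuchsian equation -/

section Data

open MvPolynomial (X C)

variable (e : Fin 4 → ℂ) (l : Fin 4 → ℕ) {M : ℕ} (r : Fin M → ℕ) (b s : Fin M → ℂ) (E : ℂ)

/-- The finite singular points `e 1, e 2, e 3, b k`. -/
def poles : Fin 3 ⊕ Fin M → ℂ := Sum.elim ![e 1, e 2, e 3] b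

/-- The function `1 / (z - e (i + 1))`. -/
def invE (M : ℕ) (i : Fin 3) : PoleRing (Fin 3 ⊕ Fin M) := X (some (Sum.inl i))

/-- The function `1 / (z - b k)`. -/
def invB (k : Fin M) : PoleRing (Fin 3 ⊕ Fin M) := X (some (Sum.inr k))

/-- The cubic polynomial `4 (z - e 1) (z - e 2) (z - e 3)`. -/
def cubic (M : ℕ) : PoleRing (Fin 3 ⊕ Fin M) :=
  C 4 * (X none - C (e 1)) * (X none - C (e 2)) * (X none - C (e 3))

/-- The potential as a rational function of `z`. -/
def ratPotential : PoleRing (Fin 3 ⊕ Fin M) :=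
  C ((l 0 : ℂ) * (l 0 + 1)) * X none
    + C ((l 1 : ℂ) * (l 1 + 1)) * (C (e 1) + C ((e 1 - e 2) * (e 1 - e 3)) * invE M 0)
    + C ((l 2 : ℂ) * (l 2 + 1)) * (C (e 2) + C ((e 2 - e 1) * (e 2 - e 3)) * invE M 1)
    + C ((l 3 : ℂ) * (l 3 + 1)) * (C (e 3) + C ((e 3 - e 1) * (e 3 - e 2)) * invE M 2)
    + ∑ k, (C ((r k : ℂ) / 2 * ((r k : ℂ) / 2 + 1)) * (C (2 * b k)
        + C ((12 * b k ^ 2 + 4 * (e 1 * e 2 + e 2 * e 3 + e 3 * e 1)) / 2) * invB k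
        + C (4 * (b k - e 1) * (b k - e 2) * (b k - e 3)) * invB k ^ 2) + C (s k) * invB k)

/-- The square of the factor by which the solutions of the two equations differ, up to sign. -/
def gauge : PoleRing (Fin 3 ⊕ Fin M) :=
  invE M 0 ^ l 1 * invE M 1 ^ l 2 * invE M 2 ^ l 3 * ∏ k, invB k ^ r k

/-- The logarithmic derivative of `gauge`. -/
def gaugeLog : PoleRing (Fin 3 ⊕ Fin M) :=
  -(C (l 1 : ℂ) * invE M 0 + C (l 2 : ℂ) * invE M 1 + C (l 3 : ℂ) * invE M 2
    + ∑ k, C (r k : ℂ) * invB k)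

theorem poleDeriv_invE (i : Fin 3) : poleDeriv (invE M i) = -invE M i ^ 2 :=
  poleDeriv_X_some _

theorem poleDeriv_invB (k : Fin M) : poleDeriv (invB k) = -invB k ^ 2 :=
  poleDeriv_X_some _

theorem derivation_pow_eq {A : Type*} [CommRing A] [Algebra ℂ A] (d : Derivation ℂ A A) {y : A}
    (h : d y = -y ^ 2) (n : ℕ) : d (y ^ n) = -(n * y) * y ^ n := by
  rw [Derivation.leibniz_pow, h]
  cases n with
  | zero => simp
  | succ n =>
    simp only [Nat.add_sub_cancel, nsmul_eq_mul, smul_eq_mul]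
    ring

theorem derivation_mul_eq {A : Type*} [CommRing A] [Algebra ℂ A] (d : Derivation ℂ A A)
    {x y α β : A} (hx : d x = α * x) (hy : d y = β * y) : d (x * y) = (α + β) * (x * y) := by
  rw [Derivation.leibniz, hx, hy]
  simp only [smul_eq_mul]
  ring

theorem derivation_prod_eq {A ι : Type*} [CommRing A] [Algebra ℂ A] (d : Derivation ℂ A A)
    (t : Finset ι) {x α : ι → A} (hx : ∀ i, d (x i) = α i * x i) :
    d (∏ i ∈ t, x i) = (∑ i ∈ t, α i) * ∏ i ∈ t, x i := by
  classical
  induction t using Finset.induction_on with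
  | empty => simp
  | insert a t ha ih =>
    rw [Finset.prod_insert ha, Finset.sum_insert ha]
    exact derivation_mul_eq d (hx a) ih

theorem poleDeriv_gauge : poleDeriv (gauge l r) = gaugeLog l r * gauge l r := by
  have h := derivation_mul_eq poleDeriv (derivation_mul_eq poleDeriv (derivation_mul_eq poleDeriv
    (derivation_pow_eq poleDeriv (poleDeriv_invE (M := M) 0) (l 1))
    (derivation_pow_eq poleDeriv (poleDeriv_invE (M := M) 1) (l 2)))
    (derivation_pow_eq poleDeriv (poleDeriv_invE (M := M) 2) (l 3)))
    (derivation_prod_eq poleDeriv Finset.univ fun k =>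
      derivation_pow_eq poleDeriv (poleDeriv_invB k) (r k))
  rw [gauge, h, gaugeLog]
  congr 1
  rw [Finset.sum_neg_distrib]
  simp only [map_natCast]
  ring

theorem poleDeriv_C {κ : Type} (a : ℂ) : poleDeriv (C a : PoleRing κ) = 0 :=
  MvPolynomial.derivation_C _ a

theorem poleDeriv_cubic : poleDeriv (cubic e M)
    = C 4 * ((X none - C (e 1)) * (X none - C (e 2)) + (X none - C (e 1)) * (X none - C (e 3))
      + (X none - C (e 2)) * (X none - C (e 3))) := by
  simp only [cubic, Derivation.leibniz, map_sub, poleDeriv_X_none, poleDeriv_C, smul_eq_mul]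
  ring

theorem poleDeriv_gaugeLog : poleDeriv (gaugeLog l r)
    = C (l 1 : ℂ) * invE M 0 ^ 2 + C (l 2 : ℂ) * invE M 1 ^ 2 + C (l 3 : ℂ) * invE M 2 ^ 2
      + ∑ k, C (r k : ℂ) * invB k ^ 2 := by
  simp only [gaugeLog, map_neg, map_add, Derivation.leibniz, poleDeriv_invE, poleDeriv_C,
    smul_eq_mul, map_sum, poleDeriv_invB, mul_zero, add_zero, mul_neg, Finset.sum_neg_distrib]
  ring

section Eval

variable {A : Type} [Field A] [Algebra ℂ A] (ζ : A)

theorem evalAt_invE_zero : evalAt (poles e b) ζ (invE M 0) = (ζ - algebraMap ℂ A (e 1))⁻¹ := by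
  rw [invE, evalAt_X_some]; rfl

theorem evalAt_invE_one : evalAt (poles e b) ζ (invE M 1) = (ζ - algebraMap ℂ A (e 2))⁻¹ := by
  rw [invE, evalAt_X_some]; rfl

theorem evalAt_invE_two : evalAt (poles e b) ζ (invE M 2) = (ζ - algebraMap ℂ A (e 3))⁻¹ := by
  rw [invE, evalAt_X_some]; rfl

theorem evalAt_invB (k : Fin M) :
    evalAt (poles e b) ζ (invB k) = (ζ - algebraMap ℂ A (b k))⁻¹ := by
  rw [invB, evalAt_X_some]; rfl

theorem evalAt_cubic : evalAt (poles e b) ζ (cubic e M) = 4 * (ζ - algebraMap ℂ A (e 1))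
    * (ζ - algebraMap ℂ A (e 2)) * (ζ - algebraMap ℂ A (e 3)) := by
  simp only [cubic, map_mul, map_sub, evalAt_X_none, evalAt_C, map_ofNat]

end Eval

end Data

end TakemuraHeun

end

/-! ### Exponents of the third-order operator at the singular points -/

noncomputable section

namespace TakemuraHeun

section LeadingTerms

variable {κ : Type} {c : κ → ℂ}

theorem hasLead_of_mem_offPole (hc : Function.Injective c) {o : Option κ} {g : PoleRing κ}
    (hg : g ∈ offPole o) {n : ℤ} (hn : n < 0) : HasLead n 0 (evalAt c (coord c o) g) := by
  obtain ⟨d, hd⟩ := exists_hasLead_of_mem_offPole hc hg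
  exact hd.mono hn

theorem hasLead_C_mul (o : Option κ) (a : ℂ) {n : ℤ} {d : ℂ} {g : PoleRing κ}
    (hg : HasLead n d (evalAt c (coord c o) g)) :
    HasLead n (a * d) (evalAt c (coord c o) (MvPolynomial.C a * g)) := by
  rw [map_mul, evalAt_C]
  simpa using (hasLead_algebraMap a).mul hg

theorem hasLead_evalAt_add {o : Option κ} {n : ℤ} {a d : ℂ} {f g : PoleRing κ}
    (hf : HasLead n a (evalAt c (coord c o) f)) (hg : HasLead n d (evalAt c (coord c o) g)) :
    HasLead n (a + d) (evalAt c (coord c o) (f + g)) := by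
  rw [map_add]
  exact hf.add hg

theorem hasLead_X_self (c : κ → ℂ) (o : Option κ) :
    HasLead (-1) 1 (evalAt c (coord c o) (MvPolynomial.X o)) := by
  rw [evalAt_coord_self]
  exact hasLead_single _ _

theorem hasLead_coord_sub_self (k : κ) :
    HasLead 1 1 (coord c (some k) - algebraMap ℂ _ (c k)) := by
  have : coord c (some k) = HahnSeries.single 1 1 + algebraMap ℂ (LaurentSeries ℂ) (c k) := rfl
  rw [this, add_sub_cancel_right]
  exact hasLead_single 1 1

end LeadingTerms

section Data

open MvPolynomial (X C)

variable {e : Fin 4 → ℂ} {M : ℕ} {b : Fin M → ℂ} (l : Fin 4 → ℕ) (r : Fin M → ℕ)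
  (s : Fin M → ℂ) (E : ℂ)

theorem evalAt_cubic_eq (ζ : LaurentSeries ℂ) :
    evalAt (poles e b) ζ (cubic e M) = algebraMap ℂ _ 4 * (ζ - algebraMap ℂ _ (e 1))
      * (ζ - algebraMap ℂ _ (e 2)) * (ζ - algebraMap ℂ _ (e 3)) := by
  rw [evalAt_cubic, map_ofNat]

theorem invE_mem_offPole {o : Option (Fin 3 ⊕ Fin M)} {i : Fin 3} (h : some (Sum.inl i) ≠ o) :
    invE M i ∈ offPole o :=
  X_mem_offPole h

theorem invB_mem_offPole {o : Option (Fin 3 ⊕ Fin M)} {k : Fin M} (h : some (Sum.inr k) ≠ o) :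
    invB k ∈ offPole o :=
  X_mem_offPole h

theorem pair_mem_offPole {κ : Type} {o : Option κ} {g : PoleRing κ} (hg : g ∈ offPole o)
    (a a₀ a₁ a₂ a' : ℂ) :
    C a * (C a₀ + C a₁ * g + C a₂ * g ^ 2) + C a' * g ∈ offPole o :=
  add_mem (mul_mem (C_mem_offPole _ _) (add_mem (add_mem (C_mem_offPole _ _)
    (mul_mem (C_mem_offPole _ _) hg)) (mul_mem (C_mem_offPole _ _) (pow_mem hg 2))))
    (mul_mem (C_mem_offPole _ _) hg)

theorem hasLead_ratPotential (hc : Function.Injective (poles e b)) {o : Option (Fin 3 ⊕ Fin M)}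
    {n : ℤ} (hn : n < 0) {a₀ a₁ a₂ a₃ : ℂ} {a : Fin M → ℂ}
    (h₀ : HasLead n a₀ (evalAt (poles e b) (coord (poles e b) o) (X none)))
    (h₁ : HasLead n a₁ (evalAt (poles e b) (coord (poles e b) o) (invE M 0)))
    (h₂ : HasLead n a₂ (evalAt (poles e b) (coord (poles e b) o) (invE M 1)))
    (h₃ : HasLead n a₃ (evalAt (poles e b) (coord (poles e b) o) (invE M 2)))
    (hk : ∀ k, HasLead n (a k) (evalAt (poles e b) (coord (poles e b) o)
      (C ((r k : ℂ) / 2 * ((r k : ℂ) / 2 + 1)) * (C (2 * b k)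
        + C ((12 * b k ^ 2 + 4 * (e 1 * e 2 + e 2 * e 3 + e 3 * e 1)) / 2) * invB k
        + C (4 * (b k - e 1) * (b k - e 2) * (b k - e 3)) * invB k ^ 2) + C (s k) * invB k))) :
    HasLead n (-(l 0 * (l 0 + 1) * a₀ + l 1 * (l 1 + 1) * ((e 1 - e 2) * (e 1 - e 3) * a₁)
        + l 2 * (l 2 + 1) * ((e 2 - e 1) * (e 2 - e 3) * a₂)
        + l 3 * (l 3 + 1) * ((e 3 - e 1) * (e 3 - e 2) * a₃) + ∑ k, a k))
      (evalAt (poles e b) (coord (poles e b) o) (C E - ratPotential e l r b s)) := by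
  have hoff {g : PoleRing (Fin 3 ⊕ Fin M)} (hg : g ∈ offPole o) :=
    hasLead_of_mem_offPole hc hg hn
  have hhalf {g : PoleRing (Fin 3 ⊕ Fin M)} {d : ℂ} (x y z : ℂ)
      (hg : HasLead n d (evalAt (poles e b) (coord (poles e b) o) g)) :=
    hasLead_C_mul o x (hasLead_evalAt_add (hoff (C_mem_offPole _ y)) (hasLead_C_mul o z hg))
  have hsum := HasLead.sum Finset.univ fun k _ => hk k
  rw [← map_sum] at hsum
  have h := (hoff (C_mem_offPole _ E)).sub (hasLead_evalAt_add (hasLead_evalAt_add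
    (hasLead_evalAt_add (hasLead_evalAt_add (hasLead_C_mul o ((l 0 : ℂ) * (l 0 + 1)) h₀)
    (hhalf (l 1 * (l 1 + 1)) (e 1) ((e 1 - e 2) * (e 1 - e 3)) h₁))
    (hhalf (l 2 * (l 2 + 1)) (e 2) ((e 2 - e 1) * (e 2 - e 3)) h₂))
    (hhalf (l 3 * (l 3 + 1)) (e 3) ((e 3 - e 1) * (e 3 - e 2)) h₃)) hsum)
  simp only [zero_add, zero_sub] at h
  rw [map_sub]
  exact h

/-- With $z=1/t$ the leading terms are $4t$ for $w/(dz/dt)^2$ and $-l_0(l_0+1)t^{-1}$ for $u$, so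
$l_0+1$ is an exponent and the window has odd length $2l_0+1$. -/
theorem exists_localData_infinity (hc : Function.Injective (poles e b)) :
    ∃ S : LocalData, S.n = l 0 ∧ S.size ≤ 2 * S.n + Module.finrank ℂ S.radical ∧
      S.w = evalAt (poles e b) (coord (poles e b) none) (cubic e M)
        / lsDeriv (coord (poles e b) none) ^ 2 ∧
      S.u = evalAt (poles e b) (coord (poles e b) none) (C E - ratPotential e l r b s) := by
  have hu := hasLead_ratPotential l r s E hc (show (1 - 2 : ℤ) < 0 by norm_num)
    (hasLead_X_self _ none)
    (hasLead_of_mem_offPole hc (invE_mem_offPole (by simp)) (by norm_num))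
    (hasLead_of_mem_offPole hc (invE_mem_offPole (by simp)) (by norm_num))
    (hasLead_of_mem_offPole hc (invE_mem_offPole (by simp)) (by norm_num))
    (fun k => hasLead_of_mem_offPole hc
      (pair_mem_offPole (invB_mem_offPole (k := k) (by simp)) _ _ _ _ _) (by norm_num))
  have hw : HasLead 1 4 (evalAt (poles e b) (coord (poles e b) none) (cubic e M)
        / lsDeriv (coord (poles e b) none) ^ 2) := by
    have hx (a : ℂ) : HasLead (-1) 1 (coord (poles e b) none - algebraMap ℂ _ a) := by
      simpa [coord] using (hasLead_single (-1) 1).sub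
        ((hasLead_algebraMap a).mono (show (-1 : ℤ) < 0 by norm_num))
    have h := ((((hasLead_algebraMap 4).mul (hx (e 1))).mul (hx (e 2))).mul (hx (e 3))).mul
      (((hasLead_single (-2) (-1)).pow 2).inv (by norm_num))
    rw [evalAt_cubic_eq, lsDeriv_coord_none, div_eq_mul_inv]
    norm_num at h
    simpa using h
  let S : LocalData :=
    { w := _, u := _, α := 1, w₀ := 4, u₀ := _, n := l 0, size := 2 * l 0 + 1
      lead_w := hw, lead_u := hu
      size_eq := by push_cast; ring
      indicial_eq := by
        simp only [indicial, mul_zero, Finset.sum_const_zero]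
        push_cast
        ring }
  refine ⟨S, rfl, ?_, rfl, rfl⟩
  have : 1 ≤ Module.finrank ℂ S.radical := S.one_le_finrank_radical ⟨l 0, rfl⟩
  show 2 * l 0 + 1 ≤ 2 * l 0 + _
  omega

/-- For $\alpha=1$ the characteristic polynomial at $n+1$ equals $(2n+1)(n(n+1)w_0+4u_0)$, which
explains the hypothesis on $u_0$; the odd window gives the radical. -/
theorem exists_localData_of_hasLead {w u : LaurentSeries ℂ} {n : ℕ} {w₀ u₀ : ℂ}
    (hw : HasLead 1 w₀ w) (hu : HasLead (1 - 2) u₀ u) (h : u₀ = -(n * (n + 1) * w₀ / 4)) :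
    ∃ S : LocalData, S.n = n ∧ S.size ≤ 2 * S.n + Module.finrank ℂ S.radical ∧
      S.w = w ∧ S.u = u := by
  let S : LocalData :=
    { w := _, u := _, α := 1, w₀ := w₀, u₀ := _, n := n, size := 2 * n + 1
      lead_w := hw, lead_u := hu
      size_eq := by push_cast; ring
      indicial_eq := by
        simp only [indicial, h]
        push_cast
        ring }
  refine ⟨S, rfl, ?_, rfl, rfl⟩
  have : 1 ≤ Module.finrank ℂ S.radical := S.one_le_finrank_radical ⟨n, rfl⟩
  show 2 * n + 1 ≤ 2 * n + _
  omega

theorem exists_localData_inl (hc : Function.Injective (poles e b)) (i : Fin 3) :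
    ∃ S : LocalData, S.n = l i.succ ∧ S.size ≤ 2 * S.n + Module.finrank ℂ S.radical ∧
      S.w = evalAt (poles e b) (coord (poles e b) (some (Sum.inl i))) (cubic e M)
        / lsDeriv (coord (poles e b) (some (Sum.inl i))) ^ 2 ∧
      S.u = evalAt (poles e b) (coord (poles e b) (some (Sum.inl i)))
        (C E - ratPotential e l r b s) := by
  rw [lsDeriv_coord_some, one_pow, div_one, evalAt_cubic_eq]
  have hX : HasLead (1 - 2) 0 (evalAt (poles e b) (coord (poles e b) (some (Sum.inl i)))
      (X none)) := hasLead_of_mem_offPole hc (X_mem_offPole (by simp)) (by norm_num)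
  have hk (k : Fin M) := hasLead_of_mem_offPole hc (pair_mem_offPole (invB_mem_offPole
    (show some (Sum.inr k) ≠ some (Sum.inl i) by simp)) ((r k : ℂ) / 2 * ((r k : ℂ) / 2 + 1))
    (2 * b k) ((12 * b k ^ 2 + 4 * (e 1 * e 2 + e 2 * e 3 + e 3 * e 1)) / 2)
    (4 * (b k - e 1) * (b k - e 2) * (b k - e 3)) (s k)) (show (1 - 2 : ℤ) < 0 by norm_num)
  have hself : HasLead (1 - 2) 1 (evalAt (poles e b) (coord (poles e b) (some (Sum.inl i)))
      (invE M i)) := hasLead_X_self _ _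
  have hne (j : Fin 3) (h : j ≠ i) : HasLead (1 - 2) 0 (evalAt (poles e b)
      (coord (poles e b) (some (Sum.inl i))) (invE M j)) :=
    hasLead_of_mem_offPole hc (invE_mem_offPole (by simpa using h)) (by norm_num)
  have hs : HasLead 1 1 (coord (poles e b) (some (Sum.inl i)) - algebraMap ℂ _ (e i.succ)) := by
    convert hasLead_coord_sub_self (c := poles e b) (Sum.inl i) using 3
    fin_cases i <;> rfl
  have hd (j : Fin 3) : HasLead 0 (e i.succ - e j.succ)
      (coord (poles e b) (some (Sum.inl i)) - algebraMap ℂ _ (e j.succ)) := by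
    convert hasLead_coord_sub (c := poles e b) (Sum.inl i) (Sum.inl j) using 3
    · fin_cases i <;> rfl
    · fin_cases j <;> rfl
    · fin_cases j <;> rfl
  fin_cases i
  · refine exists_localData_of_hasLead
      ((((hasLead_algebraMap 4).mul hs).mul (hd 1)).mul (hd 2))
      (hasLead_ratPotential l r s E hc (by norm_num) hX hself (hne 1 (by simp))
        (hne 2 (by simp)) hk) ?_
    simp
    ring
  · refine exists_localData_of_hasLead
      ((((hasLead_algebraMap 4).mul (hd 0)).mul hs).mul (hd 2))
      (hasLead_ratPotential l r s E hc (by norm_num) hX (hne 0 (by simp)) hself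
        (hne 2 (by simp)) hk) ?_
    simp
    ring
  · refine exists_localData_of_hasLead
      ((((hasLead_algebraMap 4).mul (hd 0)).mul (hd 1)).mul hs)
      (hasLead_ratPotential l r s E hc (by norm_num) hX (hne 0 (by simp)) (hne 1 (by simp))
        hself hk) ?_
    simp
    ring

theorem hasLead_cubic_inr (k : Fin M) :
    HasLead 0 (4 * (b k - e 1) * (b k - e 2) * (b k - e 3))
      (evalAt (poles e b) (coord (poles e b) (some (Sum.inr k))) (cubic e M)) := by
  rw [evalAt_cubic_eq]
  exact (((hasLead_algebraMap 4).mul (hasLead_coord_sub (c := poles e b) (Sum.inr k)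
    (Sum.inl 0))).mul (hasLead_coord_sub (c := poles e b) (Sum.inr k) (Sum.inl 1))).mul
    (hasLead_coord_sub (c := poles e b) (Sum.inr k) (Sum.inl 2))

theorem hasLead_ratPotential_inr (hc : Function.Injective (poles e b)) (k : Fin M) :
    HasLead (-2) (-((r k : ℂ) / 2 * ((r k : ℂ) / 2 + 1)
        * (4 * (b k - e 1) * (b k - e 2) * (b k - e 3))))
      (evalAt (poles e b) (coord (poles e b) (some (Sum.inr k)))
        (C E - ratPotential e l r b s)) := by
  classical
  have hX : HasLead (-2) 0 (evalAt (poles e b) (coord (poles e b) (some (Sum.inr k)))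
      (X none)) := hasLead_of_mem_offPole hc (X_mem_offPole (by simp)) (by norm_num)
  have hE (i : Fin 3) : HasLead (-2) 0 (evalAt (poles e b)
      (coord (poles e b) (some (Sum.inr k))) (invE M i)) :=
    hasLead_of_mem_offPole hc (invE_mem_offPole (by simp)) (by norm_num)
  have h := hasLead_ratPotential l r s E hc (show (-2 : ℤ) < 0 by norm_num) hX (hE 0) (hE 1)
    -- Only the summand belonging to $b_k$ itself has a double pole there.
    (hE 2) (a := fun m => if m = k then (r k : ℂ) / 2 * ((r k : ℂ) / 2 + 1)
        * (4 * (b k - e 1) * (b k - e 2) * (b k - e 3)) else 0) fun m => by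
      split_ifs with hm
      · subst hm
        have h1 : HasLead (-1) 1 (evalAt (poles e b) (coord (poles e b) (some (Sum.inr m)))
            (invB m)) := hasLead_X_self _ _
        have h2 := h1.pow 2
        rw [← map_pow] at h2
        have h1' := h1.mono (show -2 < (-1 : ℤ) by norm_num)
        convert hasLead_evalAt_add (hasLead_C_mul _ _ (hasLead_evalAt_add (hasLead_evalAt_add
          (hasLead_of_mem_offPole hc (C_mem_offPole _ _) (by norm_num)) (hasLead_C_mul _ _ h1'))
          (hasLead_C_mul _ _ h2))) (hasLead_C_mul _ _ h1') using 1
        simp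
      · exact hasLead_of_mem_offPole hc (pair_mem_offPole (invB_mem_offPole (by simpa using hm))
          _ _ _ _ _) (by norm_num)
  simpa using h

end Data

end TakemuraHeun

end

/-! ### The Fuchsian equation and its normal form -/

noncomputable section

namespace TakemuraHeun

section Data

open MvPolynomial (X C)

variable {e : Fin 4 → ℂ} {M : ℕ} {b : Fin M → ℂ} (l : Fin 4 → ℕ) (r : Fin M → ℕ)
  (s : Fin M → ℂ) (E : ℂ)

theorem accessoryO_eq (he : e 1 + e 2 + e 3 = 0) (k : Fin M) :
    accessoryO e l r b s k = -s k + r k * (1 / 8 * r k * (12 * b k ^ 2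
        - -4 * (e 1 * e 2 + e 2 * e 3 + e 3 * e 1))
      + 1 / 2 * (4 * (b k - e 1) * (b k - e 2) * (b k - e 3)) *
          (∑ m ∈ Finset.univ.erase k, (r m : ℂ) / (b k - b m))
      + 2 * (l 1 * (b k - e 2) * (b k - e 3) + l 2 * (b k - e 1) * (b k - e 3)
          + l 3 * (b k - e 1) * (b k - e 2))) := by
  have h : 4 * b k ^ 3 - -4 * (e 1 * e 2 + e 2 * e 3 + e 3 * e 1) * b k - 4 * e 1 * e 2 * e 3
      = 4 * (b k - e 1) * (b k - e 2) * (b k - e 3) := by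
    linear_combination 4 * b k ^ 2 * he
  simp only [accessoryO, h]

variable (b) in
/-- The coefficient of the first derivative, multiplied by `z - b k`. -/
def regP (k : Fin M) : PoleRing (Fin 3 ⊕ Fin M) :=
  C (-(r k : ℂ)) + (X none - C (b k)) *
    (C (1 / 2 - l 1 : ℂ) * invE M 0 + C (1 / 2 - l 2 : ℂ) * invE M 1
      + C (1 / 2 - l 3 : ℂ) * invE M 2 + ∑ m ∈ Finset.univ.erase k, C (-(r m : ℂ)) * invB m)

variable (b) in
/-- The coefficient of the zeroth derivative, multiplied by `z - b k`. -/
def regQ (c p : ℂ) (o : Fin M → ℂ) (k : Fin M) : PoleRing (Fin 3 ⊕ Fin M) :=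
  (C (o k) + (X none - C (b k)) * (C c * X none + C p
      + ∑ m ∈ Finset.univ.erase k, C (o m) * invB m))
    * (C (1 / 4) * invE M 0 * invE M 1 * invE M 2)

theorem regP_mem_offPole (k : Fin M) : regP b l r k ∈ offPole (some (Sum.inr k)) := by
  refine add_mem (C_mem_offPole _ _) (mul_mem (sub_mem (X_mem_offPole (by simp))
    (C_mem_offPole _ _)) (add_mem (add_mem (add_mem ?_ ?_) ?_) (sum_mem fun m hm => ?_)))
  · exact mul_mem (C_mem_offPole _ _) (invE_mem_offPole (by simp))
  · exact mul_mem (C_mem_offPole _ _) (invE_mem_offPole (by simp))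
  · exact mul_mem (C_mem_offPole _ _) (invE_mem_offPole (by simp))
  · exact mul_mem (C_mem_offPole _ _)
      (invB_mem_offPole (by simpa using Finset.ne_of_mem_erase hm))

theorem regQ_mem_offPole (c p : ℂ) (o : Fin M → ℂ) (k : Fin M) :
    regQ b c p o k ∈ offPole (some (Sum.inr k)) := by
  refine mul_mem (add_mem (C_mem_offPole _ _) (mul_mem (sub_mem (X_mem_offPole (by simp))
    (C_mem_offPole _ _)) (add_mem (add_mem (mul_mem (C_mem_offPole _ _)
    (X_mem_offPole (by simp))) (C_mem_offPole _ _)) (sum_mem fun m hm => ?_))))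
    (mul_mem (mul_mem (mul_mem (C_mem_offPole _ _) (invE_mem_offPole (by simp)))
      (invE_mem_offPole (by simp))) (invE_mem_offPole (by simp)))
  exact mul_mem (C_mem_offPole _ _)
    (invB_mem_offPole (by simpa using Finset.ne_of_mem_erase hm))

section Field

variable {A : Type} [Field A] [Algebra ℂ A] {ζ : A}

variable (e) in
theorem evalAt_regP {k : Fin M} (hk : ζ - algebraMap ℂ A (b k) ≠ 0) :
    evalAt (poles e b) ζ (regP b l r k) / (ζ - algebraMap ℂ A (b k))
      = algebraMap ℂ A (1 / 2 - l 1) / (ζ - algebraMap ℂ A (e 1))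
        + algebraMap ℂ A (1 / 2 - l 2) / (ζ - algebraMap ℂ A (e 2))
        + algebraMap ℂ A (1 / 2 - l 3) / (ζ - algebraMap ℂ A (e 3))
        + ∑ m, algebraMap ℂ A (-(r m : ℂ)) / (ζ - algebraMap ℂ A (b m)) := by
  rw [← Finset.add_sum_erase _ _ (Finset.mem_univ k)]
  simp only [regP, map_add, map_mul, map_sub, map_sum, evalAt_C, evalAt_X_none, evalAt_invE_zero,
    evalAt_invE_one, evalAt_invE_two, evalAt_invB, div_eq_mul_inv]
  rw [add_mul, mul_right_comm, mul_inv_cancel₀ hk]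
  ring

variable (e) in
theorem evalAt_regQ (c p : ℂ) (o : Fin M → ℂ) {k : Fin M}
    (hk : ζ - algebraMap ℂ A (b k) ≠ 0) :
    evalAt (poles e b) ζ (regQ b c p o k) / (ζ - algebraMap ℂ A (b k))
      = (algebraMap ℂ A c * ζ + algebraMap ℂ A p
          + ∑ m, algebraMap ℂ A (o m) / (ζ - algebraMap ℂ A (b m)))
        / (4 * (ζ - algebraMap ℂ A (e 1)) * (ζ - algebraMap ℂ A (e 2))
          * (ζ - algebraMap ℂ A (e 3))) := by
  have h4 : algebraMap ℂ A (1 / 4) = 4⁻¹ := by rw [one_div, map_inv₀, map_ofNat]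
  rw [← Finset.add_sum_erase _ _ (Finset.mem_univ k)]
  simp only [regQ, map_add, map_mul, map_sub, map_sum, evalAt_C, evalAt_X_none, evalAt_invE_zero,
    evalAt_invE_one, evalAt_invE_two, evalAt_invB, div_eq_mul_inv, mul_inv] at h4 ⊢
  rw [h4]
  generalize (∑ x ∈ Finset.univ.erase k, algebraMap ℂ A (o x) * (ζ - algebraMap ℂ A (b x))⁻¹) = S
  generalize (ζ - algebraMap ℂ A (b k)) = t at *
  generalize algebraMap ℂ A c * ζ + algebraMap ℂ A p = u
  have h (y : A) : (algebraMap ℂ A (o k) + t * (u + S)) * y * t⁻¹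
      = (u + (algebraMap ℂ A (o k) * t⁻¹ + S)) * y := by
    field_simp
    ring
  exact h _

/-- This and `normal_form_zeroth` are the conditions `hP` and `hQ` of `symOp_mul_mul_eq_zero`, with
`gaugeLog` as $\theta$. -/
theorem normal_form_first {k : Fin M} (hx₁ : ζ - algebraMap ℂ A (e 1) ≠ 0)
    (hx₂ : ζ - algebraMap ℂ A (e 2) ≠ 0) (hx₃ : ζ - algebraMap ℂ A (e 3) ≠ 0)
    (hk : ζ - algebraMap ℂ A (b k) ≠ 0) (d : Derivation ℂ A A) (hx : d ζ = 1) :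
    2 * evalAt (poles e b) ζ (cubic e M)
        * (evalAt (poles e b) ζ (regP b l r k) / (ζ - algebraMap ℂ A (b k)))
      = 2 * evalAt (poles e b) ζ (cubic e M) * evalAt (poles e b) ζ (gaugeLog l r)
        + d (evalAt (poles e b) ζ (cubic e M)) := by
  have : CharZero A := charZero_of_injective_algebraMap (algebraMap ℂ A).injective
  rw [evalAt_regP e l r hk, derivation_evalAt (poles e b) ζ d, hx, one_mul, poleDeriv_cubic,
    evalAt_cubic]
  simp only [gaugeLog, map_neg, map_add, map_mul, map_sub, map_sum, evalAt_C, evalAt_X_none,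
    evalAt_invE_zero, evalAt_invE_one, evalAt_invE_two, evalAt_invB, map_natCast, map_ofNat, map_inv₀,
    map_one, neg_mul, Finset.sum_neg_distrib, div_eq_mul_inv]
  generalize (∑ m, (r m : A) * (ζ - algebraMap ℂ A (b m))⁻¹) = S
  field_simp
  ring

theorem normal_form_zeroth {k : Fin M} (he : e 1 + e 2 + e 3 = 0) (hinj : Function.Injective b)
    (hx₁ : ζ - algebraMap ℂ A (e 1) ≠ 0)
    (hx₂ : ζ - algebraMap ℂ A (e 2) ≠ 0) (hx₃ : ζ - algebraMap ℂ A (e 3) ≠ 0)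
    (hb : ∀ k, ζ - algebraMap ℂ A (b k) ≠ 0) (d : Derivation ℂ A A) (hx : d ζ = 1) :
    4 * evalAt (poles e b) ζ (cubic e M)
        * (evalAt (poles e b) ζ (regQ b ((∑ i, (l i : ℂ) + ∑ k, (r k : ℂ))
      * ((∑ i, (l i : ℂ) + ∑ k, (r k : ℂ)) - 2 * l 0 - 1)) (accessoryP e l r b E)
        (accessoryO e l r b s) k) / (ζ - algebraMap ℂ A (b k)))
      = 2 * evalAt (poles e b) ζ (cubic e M) * d (evalAt (poles e b) ζ (gaugeLog l r))
        + evalAt (poles e b) ζ (cubic e M) * evalAt (poles e b) ζ (gaugeLog l r) ^ 2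
        + evalAt (poles e b) ζ (gaugeLog l r) * d (evalAt (poles e b) ζ (cubic e M))
        + 4 * evalAt (poles e b) ζ (C E - ratPotential e l r b s) := by
  have : CharZero A := charZero_of_injective_algebraMap (algebraMap ℂ A).injective
  have h4 : (4 : A) ≠ 0 := by norm_num
  have he' : algebraMap ℂ A (e 1) + algebraMap ℂ A (e 2) + algebraMap ℂ A (e 3)
      = 0 := by rw [← map_add, ← map_add, he, map_zero]
  have h := fuchs_identity he' hx₁ hx₂ hx₃ hb ((algebraMap ℂ A).injective.comp
    hinj) (l 0 : A) (l 1) (l 2) (l 3) (algebraMap ℂ A E) (fun k => r k)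
    (fun k => algebraMap ℂ A (s k))
  rw [evalAt_regQ e _ _ _ (hb k), derivation_evalAt (poles e b) ζ d,
    derivation_evalAt (poles e b) ζ d, hx, one_mul, one_mul,
    poleDeriv_cubic, poleDeriv_gaugeLog, evalAt_cubic]
  rw [mul_assoc 4, mul_div_cancel₀ _ (mul_ne_zero (mul_ne_zero (mul_ne_zero h4 hx₁) hx₂)
    hx₃)]
  simp only [accessoryO_eq l r s he, accessoryP, gaugeLog, ratPotential, map_neg, map_add,
    map_mul, map_sub, map_sum, map_pow, map_div₀, map_one, evalAt_C, evalAt_X_none,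
    evalAt_invE_zero, evalAt_invE_one, evalAt_invE_two, evalAt_invB, map_natCast, map_ofNat,
    Fin.sum_univ_four, inv_pow, ← div_eq_mul_inv] at h ⊢
  linear_combination h

end Field

theorem fuchsP_eq {k : Fin M} {z : ℂ} (hz : z ≠ b k) :
    fuchsP e l r b z = evalAt (poles e b) z (regP b l r k) / (z - b k) :=
  (evalAt_regP e l r (A := ℂ) (sub_ne_zero.2 hz)).symm

theorem fuchsQ_eq (p : ℂ) (o : Fin M → ℂ) {k : Fin M} {z : ℂ} (hz : z ≠ b k) :
    fuchsQ e l r b p o z = evalAt (poles e b) z (regQ b ((∑ i, (l i : ℂ) + ∑ k, (r k : ℂ))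
      * ((∑ i, (l i : ℂ) + ∑ k, (r k : ℂ)) - 2 * l 0 - 1)) p o k) / (z - b k) :=
  (evalAt_regQ e (A := ℂ) _ p o (sub_ne_zero.2 hz)).symm

theorem evalAt_regP_self (k : Fin M) : evalAt (poles e b) (b k) (regP b l r k) = -r k := by
  rw [regP, map_add, map_mul, map_sub, evalAt_X_none, evalAt_C, evalAt_C]
  simp

section Laurent

variable {k : Fin M}

theorem coe_frobOp {p q F : PowerSeries ℂ} (h : frobOp p q F = 0) {t : LaurentSeries ℂ}
    (ht : t = HahnSeries.single 1 1) :
    lsDeriv (lsDeriv F) + (p : LaurentSeries ℂ) / t * lsDeriv F + (q : LaurentSeries ℂ) / t * F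
      = 0 := by
  have ht0 : t ≠ 0 := by rw [ht]; exact HahnSeries.single_ne_zero one_ne_zero
  have h' : ((frobOp p q F : PowerSeries ℂ) : LaurentSeries ℂ) = 0 := by
    rw [h, PowerSeries.coe_zero]
  rw [frobOp, PowerSeries.coe_add, PowerSeries.coe_add, PowerSeries.coe_mul, PowerSeries.coe_mul,
    PowerSeries.coe_mul, PowerSeries.coe_X, ← ht] at h'
  rw [lsDeriv_coe, lsDeriv_coe]
  field_simp
  rw [mul_comm _ t, mul_zero]
  exact h'


end Laurent

end Data

end TakemuraHeun

end

/-! ### The apparent singularities and the rational solution -/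

noncomputable section

namespace TakemuraHeun

section Data

open MvPolynomial (X C)

variable {e : Fin 4 → ℂ} {M : ℕ} {b : Fin M → ℂ} (l : Fin 4 → ℕ) (r : Fin M → ℕ)
  (s : Fin M → ℂ) (E : ℂ)

theorem coord_sub_ne_zero {κ : Type} (c : κ → ℂ) (o : Option κ) (j : κ) :
    coord c o - algebraMap ℂ _ (c j) ≠ 0 :=
  sub_ne_zero.2 (coord_ne o j)

theorem hasOrder_evalAt_X {κ : Type} {c : κ → ℂ} (hc : Function.Injective c) {k j : κ}
    (h : j ≠ k) : HasOrder 0 (evalAt c (coord c (some k)) (X (some j))) := by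
  refine ⟨(c k - c j)⁻¹, inv_ne_zero (sub_ne_zero.2 fun h' => h (hc h').symm), ?_⟩
  rw [evalAt_X_some]
  simpa using (hasLead_coord_sub (c := c) k j).inv (sub_ne_zero.2 fun h' => h (hc h').symm)

theorem hasOrder_gauge (hc : Function.Injective (poles e b)) (k : Fin M) :
    HasOrder (-r k)
      (evalAt (poles e b) (coord (poles e b) (some (Sum.inr k))) (gauge l r)) := by
  have hE (i : Fin 3) : HasOrder 0
      (evalAt (poles e b) (coord (poles e b) (some (Sum.inr k))) (invE M i)) :=
    hasOrder_evalAt_X hc (by simp)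
  have hB : HasOrder (-1)
      (evalAt (poles e b) (coord (poles e b) (some (Sum.inr k))) (invB k)) :=
    ⟨1, one_ne_zero, hasLead_X_self _ _⟩
  have hne (m : Fin M) (hm : m ∈ Finset.univ.erase k) : HasOrder 0 ((evalAt (poles e b)
      (coord (poles e b) (some (Sum.inr k))) (invB m)) ^ r m) := by
    have h : HasOrder 0 (evalAt (poles e b) (coord (poles e b) (some (Sum.inr k))) (invB m)) :=
      hasOrder_evalAt_X hc (by simpa using Finset.ne_of_mem_erase hm)
    simpa using h.pow (r m)
  have h := ((((hE 0).pow (l 1)).mul ((hE 1).pow (l 2))).mul ((hE 2).pow (l 3))).mul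
    ((hB.pow (r k)).mul (HasOrder.prod _ hne))
  rw [gauge, map_mul, map_mul, map_mul, map_pow, map_pow, map_pow, map_prod]
  simp only [map_pow]
  rw [← Finset.mul_prod_erase _ _ (Finset.mem_univ k)]
  simpa using h

theorem hasLead_coe_of_coeff {n : ℕ} {F : PowerSeries ℂ}
    (h : ∀ m < n, PowerSeries.coeff m F = 0) :
    HasLead n (PowerSeries.coeff n F) (F : LaurentSeries ℂ) := by
  refine ⟨fun m hm => ?_, LaurentSeries.coeff_coe_powerSeries F n⟩
  rcases lt_or_ge m 0 with h0 | h0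
  · exact coeff_coe_of_neg F h0
  · lift m to ℕ using h0
    rw [LaurentSeries.coeff_coe_powerSeries]
    exact h m (by exact_mod_cast hm)

/-- Here $w$ does not vanish, so the window has even length $2r_k+2$ and parity alone does not give
enough. As $\Phi$ has order $-r_k$, the solutions $\Phi F^2$ and $\Phi FG$ have orders $-r_k$ and
$1$, both below the highest exponent $r_k+2$, and span two dimensions of the radical. -/
theorem exists_localData_inr (he : e 1 + e 2 + e 3 = 0) (hc : Function.Injective (poles e b))
    (k : Fin M) (hlog : ¬ HasLogarithmicSolution (fuchsP e l r b)
      (fuchsQ e l r b (accessoryP e l r b E) (accessoryO e l r b s)) (b k)) :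
    ∃ S : LocalData, S.n = r k ∧ S.size ≤ 2 * S.n + Module.finrank ℂ S.radical ∧
      S.w = evalAt (poles e b) (coord (poles e b) (some (Sum.inr k))) (cubic e M)
        / lsDeriv (coord (poles e b) (some (Sum.inr k))) ^ 2 ∧
      S.u = evalAt (poles e b) (coord (poles e b) (some (Sum.inr k)))
        (C E - ratPotential e l r b s) := by
  rw [lsDeriv_coord_some, one_pow, div_one]
  have hinj : Function.Injective b := hc.comp Sum.inr_injective
  let S : LocalData :=
    { w := _, u := _, α := 0, w₀ := _, u₀ := _, n := r k, size := 2 * r k + 2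
      lead_w := hasLead_cubic_inr k, lead_u := hasLead_ratPotential_inr l r s E hc k
      size_eq := by push_cast; ring
      indicial_eq := by
        simp only [indicial]
        push_cast
        ring }
  refine ⟨S, rfl, ?_, rfl, rfl⟩
  suffices h : 2 ≤ Module.finrank ℂ S.radical from Nat.add_le_add_left h _
  set p := accessoryP e l r b E with hp
  set o := accessoryO e l r b s with ho
  set n : ℂ := (∑ i, (l i : ℂ) + ∑ k, (r k : ℂ)) * ((∑ i, (l i : ℂ) + ∑ k, (r k : ℂ))
    - 2 * l 0 - 1) with hn
  set x := coord (poles e b) (some (Sum.inr k)) with hx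
  obtain ⟨hpa, hpt⟩ := taylor_of_mem_offPole hc (regP_mem_offPole (b := b) l r k)
  obtain ⟨hqa, hqt⟩ := taylor_of_mem_offPole hc (regQ_mem_offPole (b := b) n p o k)
  have hbk : poles e b (Sum.inr k) = b k := rfl
  rw [hbk] at hpa hpt hqa hqt
  obtain ⟨⟨F, hF, hF'⟩, ⟨G, hG0, hG1, hG'⟩⟩ := exists_formal_solutions (r := r k)
    (eventually_nhdsWithin_of_forall fun z hz => fuchsP_eq (e := e) l r hz)
    (eventually_nhdsWithin_of_forall fun z hz => fuchsQ_eq (e := e) l r p o hz)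
    hpa hqa (evalAt_regP_self l r k) hlog
  have ht : x - algebraMap ℂ _ (b k) = HahnSeries.single 1 1 := add_sub_cancel_right _ _
  have hF'' := coe_frobOp hF' ht
  have hG'' := coe_frobOp hG' ht
  rw [← hpt, ← hqt] at hF'' hG''
  have hsub (j) := coord_sub_ne_zero (poles e b) (some (Sum.inr k)) j
  have hx1 : lsDeriv x = 1 := lsDeriv_coord_some _
  have hP := normal_form_first (e := e) (ζ := x) l r (hsub (Sum.inl 0)) (hsub (Sum.inl 1))
    (hsub (Sum.inl 2)) (hsub (Sum.inr k)) lsDeriv hx1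
  have hQ := normal_form_zeroth (e := e) (ζ := x) (k := k) l r s E he hinj (hsub (Sum.inl 0))
    (hsub (Sum.inl 1)) (hsub (Sum.inl 2)) (fun j => hsub (Sum.inr j)) lsDeriv hx1
  have hΦ : lsDeriv (evalAt (poles e b) x (gauge l r))
      = evalAt (poles e b) x (gaugeLog l r) * evalAt (poles e b) x (gauge l r) := by
    rw [derivation_evalAt, hx1, one_mul, poleDeriv_gauge, map_mul]
  obtain ⟨a, ha, hΦ0⟩ := hasOrder_gauge l r hc k
  have hF0 := hasLead_coe F
  rw [hF] at hF0
  have hG0' : HasLead ((r k + 1 : ℕ) : ℤ) 1 (G : LaurentSeries ℂ) := by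
    rw [← hG1]
    exact hasLead_coe_of_coeff fun m hm => hG0 m (by omega)
  have h1 := (hΦ0.mul hF0).mul hF0
  have h2 := (hΦ0.mul hF0).mul hG0'
  refine S.two_le_finrank_radical (x := a * 1 * 1) (y := a * 1 * 1) (by simpa) (by simpa)
    (by simpa using h1) h2 ?_ ?_ (symOp_mul_mul_eq_zero lsDeriv hF'' hF'' hΦ hP hQ)
    (symOp_mul_mul_eq_zero lsDeriv hF'' hG'' hΦ hP hQ)
  · show -(r k : ℤ) < _
    push_cast
    omega
  · show _ < ((2 * r k + 2 : ℕ) : ℤ) - (r k : ℤ)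
    push_cast
    omega

/-- The exponent that bounds the order of the pole of the solution. -/
def poleBound (l : Fin 4 → ℕ) (r : Fin M → ℕ) : Option (Fin 3 ⊕ Fin M) → ℕ
  | none => l 0
  | some (Sum.inl i) => l i.succ
  | some (Sum.inr k) => r k

theorem exists_rational_solution (he : e 1 + e 2 + e 3 = 0)
    (hc : Function.Injective (poles e b))
    (hlog : ∀ k, ¬ HasLogarithmicSolution (fuchsP e l r b)
      (fuchsQ e l r b (accessoryP e l r b E) (accessoryO e l r b s)) (b k)) :
    ∃ q : ℂ × (Option (Fin 3 ⊕ Fin M) → Polynomial ℂ),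
      (∀ o m, poleBound l r o ≤ m → (q.2 o).coeff m = 0) ∧
      (∃ z : ℂ, (∀ j, z ≠ poles e b j) ∧ evalAt (poles e b) z (ofParts _ q) ≠ 0) ∧
      ∀ z : ℂ, (∀ j, z ≠ poles e b j) → evalAt (poles e b) z
        (symOp poleDeriv (cubic e M) (C E - ratPotential e l r b s) (ofParts _ q)) = 0 := by
  have h (o : Option (Fin 3 ⊕ Fin M)) : ∃ S : LocalData, S.n = poleBound l r o ∧
      S.size ≤ 2 * S.n + Module.finrank ℂ S.radical ∧
      S.w = evalAt (poles e b) (coord (poles e b) o) (cubic e M)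
        / lsDeriv (coord (poles e b) o) ^ 2 ∧
      S.u = evalAt (poles e b) (coord (poles e b) o) (C E - ratPotential e l r b s) :=
    match o with
    | none => exists_localData_infinity l r s E hc
    | some (Sum.inl i) => exists_localData_inl l r s E hc i
    | some (Sum.inr k) => exists_localData_inr l r s E he hc k (hlog k)
  choose S hn hrad hw hu using h
  simp only [← hn]
  exact exists_symOp_eq_zero hc _ _ S hw hu hrad

end Data

end TakemuraHeun

end

noncomputable section

namespace TakemuraHeun

/-! ### Elliptic functions -/

variable (L : PeriodPair)

theorem eventually_nhdsNE_notMem_lattice (x : ℂ) : ∀ᶠ y in 𝓝[≠] x, y ∉ L.lattice := by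
  filter_upwards [self_mem_nhdsWithin, mem_nhdsWithin_of_mem_nhds
    (L.compl_lattice_sdiff_singleton_mem_nhds x)] with y hy hy' hmem
  exact hy' ⟨hmem, hy⟩

/-- An elliptic function without poles is constant. -/
theorem exists_eq_const_of_order_nonneg {f : ℂ → ℂ} (hf : Meromorphic f)
    (hper : ∀ x, ∀ l ∈ L.lattice, f (x + l) = f x) (h0 : ∀ x, 0 ≤ meromorphicOrderAt f x) :
    ∃ c, ∀ x, ContinuousAt f x → f x = c := by
  set g := toMeromorphicNFOn f Set.univ with hg
  have hfm : MeromorphicOn f Set.univ := fun x _ => hf x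
  have hfg (x : ℂ) : g =ᶠ[𝓝[≠] x] f := hfm.toMeromorphicNFOn_eq_self_on_nhdsNE (Set.mem_univ x)
  have hga (x : ℂ) : AnalyticAt ℂ g x := by
    refine ((meromorphicNFOn_toMeromorphicNFOn f Set.univ)
      (Set.mem_univ x)).meromorphicOrderAt_nonneg_iff_analyticAt.1 ?_
    rw [meromorphicOrderAt_congr (hfg x)]
    exact h0 x
  have hlim (x : ℂ) : Tendsto f (𝓝[≠] x) (𝓝 (g x)) :=
    ((hga x).continuousAt.tendsto.mono_left nhdsWithin_le_nhds).congr' (hfg x)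
  have hgper (x l : ℂ) (hl : l ∈ L.lattice) : g (x + l) = g x := by
    refine tendsto_nhds_unique ?_ (hlim x)
    have h : Tendsto (fun y => y + l) (𝓝[≠] x) (𝓝[≠] (x + l)) :=
      tendsto_nhdsWithin_iff.2 ⟨((continuous_add_const l).tendsto x).mono_left
        nhdsWithin_le_nhds, by
          filter_upwards [self_mem_nhdsWithin] with y hy
          simpa using hy⟩
    exact ((hlim (x + l)).comp h).congr fun y => hper y l hl
  have hd : Differentiable ℂ g := fun x => (hga x).differentiableAt
  refine ⟨g 0, fun x hx => ?_⟩
  rw [← hd.apply_eq_apply_of_bounded (IsZLattice.isCompact_range_of_periodic L.lattice _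
    hd.continuous hgper).isBounded x 0]
  exact tendsto_nhds_unique (hx.tendsto.mono_left nhdsWithin_le_nhds) (hlim x)

theorem continuousAt_weierstrassP {x : ℂ} (hx : x ∉ L.lattice) : ContinuousAt L.weierstrassP x :=
  (L.analyticOnNhd_weierstrassP x hx).continuousAt

theorem hasDerivAt_weierstrassP {x : ℂ} (hx : x ∉ L.lattice) :
    HasDerivAt L.weierstrassP (L.derivWeierstrassP x) x := by
  rw [← L.deriv_weierstrassP]
  exact (L.analyticOnNhd_weierstrassP x hx).differentiableAt.hasDerivAt

theorem meromorphic_weierstrassP_sub (a : ℂ) : Meromorphic fun x => L.weierstrassP x - a :=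
  L.meromorphic_weierstrassP.fun_sub (Meromorphic.const a)

theorem order_weierstrassP_sub {x : ℂ} (hx : x ∈ L.lattice) (a : ℂ) :
    meromorphicOrderAt (fun x => L.weierstrassP x - a) x = -2 := by
  classical
  have h : meromorphicOrderAt (fun _ : ℂ => -a) x ≥ 0 := analyticAt_const.meromorphicOrderAt_nonneg
  have h2 := L.order_weierstrassP x hx
  rw [show (fun x => L.weierstrassP x - a) = L.weierstrassP + fun _ => -a by
    funext y; simp [sub_eq_add_neg]]
  rw [meromorphicOrderAt_add_eq_left_of_lt analyticAt_const.meromorphicAt, h2]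
  rw [h2]
  exact lt_of_lt_of_le (by decide) h

theorem order_weierstrassP_sub_nonneg {x : ℂ} (hx : x ∉ L.lattice) (a : ℂ) :
    0 ≤ meromorphicOrderAt (fun x => L.weierstrassP x - a) x :=
  ((L.analyticOnNhd_weierstrassP x hx).fun_sub analyticAt_const).meromorphicOrderAt_nonneg

/-- The order is finite at the pole $0$, and finiteness spreads over the connected plane. -/
theorem order_weierstrassP_sub_ne_top (a x : ℂ) :
    meromorphicOrderAt (fun x => L.weierstrassP x - a) x ≠ ⊤ := by
  refine MeromorphicOn.meromorphicOrderAt_ne_top_of_isPreconnected (U := Set.univ) (x := 0)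
    (fun y _ => meromorphic_weierstrassP_sub L a y) isPreconnected_univ (Set.mem_univ _)
    (Set.mem_univ _) ?_
  rw [order_weierstrassP_sub L (zero_mem _)]
  decide

theorem order_weierstrassP_sub_self {x : ℂ} (hx : x ∉ L.lattice) :
    1 ≤ meromorphicOrderAt (fun y => L.weierstrassP y - L.weierstrassP x) x := by
  have ha := (L.analyticOnNhd_weierstrassP x hx).fun_sub
    (analyticAt_const (v := L.weierstrassP x))
  rw [ha.meromorphicOrderAt_eq]
  refine ENat.monotone_map_iff.mpr Nat.mono_cast
    ((natCast_le_analyticOrderAt_iff_iteratedDeriv_eq_zero (n := 1) ha).mpr fun i hi => ?_)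
  obtain rfl : i = 0 := by omega
  simp

theorem derivWeierstrassP_half {x : ℂ} (h : 2 * x ∈ L.lattice) : L.derivWeierstrassP x = 0 := by
  have h1 := L.derivWeierstrassP_sub_coe x ⟨2 * x, h⟩
  rw [show x - ((⟨2 * x, h⟩ : L.lattice) : ℂ) = -x by simp; ring,
    L.derivWeierstrassP_neg] at h1
  exact CharZero.eq_neg_self_iff.1 h1.symm

theorem order_weierstrassP_sub_half {x : ℂ} (hx : x ∉ L.lattice) (h : 2 * x ∈ L.lattice) :
    2 ≤ meromorphicOrderAt (fun y => L.weierstrassP y - L.weierstrassP x) x := by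
  have ha := (L.analyticOnNhd_weierstrassP x hx).fun_sub
    (analyticAt_const (v := L.weierstrassP x))
  rw [ha.meromorphicOrderAt_eq]
  refine ENat.monotone_map_iff.mpr Nat.mono_cast
    ((natCast_le_analyticOrderAt_iff_iteratedDeriv_eq_zero (n := 2) ha).mpr fun i hi => ?_)
  interval_cases i
  · simp
  · rw [iteratedDeriv_one, deriv_sub_const, L.deriv_weierstrassP, derivWeierstrassP_half L h]

theorem meromorphicOrderAt_comp_add (f : ℂ → ℂ) (a x : ℂ) :
    meromorphicOrderAt (fun y => f (y + a)) x = meromorphicOrderAt f (x + a) :=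
  meromorphicOrderAt_comp_add_const_eq_meromorphicOrderAt

/-- Each double pole of one factor meets a zero of order at least two of the other, because $\wp'$
vanishes at half periods. So the product is elliptic without poles. -/
theorem exists_half_translate {ω : ℂ} (hω : ω ∉ L.lattice) (h2 : 2 * ω ∈ L.lattice) :
    ∃ c ≠ 0, ∀ x, x ∉ L.lattice → x + ω ∉ L.lattice →
      (L.weierstrassP (x + ω) - L.weierstrassP ω) * (L.weierstrassP x - L.weierstrassP ω)
        = c := by
  set e := L.weierstrassP ω with he
  have hm := meromorphic_weierstrassP_sub L e
  have hm' : Meromorphic fun y => L.weierstrassP (y + ω) - e := fun x =>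
    (hm (x + ω)).comp_analyticAt (g := fun y => y + ω) (by fun_prop)
  have hord (x : ℂ) : meromorphicOrderAt (fun y => (L.weierstrassP (y + ω) - e)
      * (L.weierstrassP y - e)) x = meromorphicOrderAt (fun y => L.weierstrassP y - e) (x + ω)
        + meromorphicOrderAt (fun y => L.weierstrassP y - e) x := by
    rw [← meromorphicOrderAt_comp_add]
    exact meromorphicOrderAt_mul (hm' x) (hm x)
  have hhalf {x y : ℂ} (hx : x ∈ L.lattice) (hy : y - ω - x ∈ L.lattice) :
      2 ≤ meromorphicOrderAt (fun y => L.weierstrassP y - e) y := by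
    have hyω : y - ω ∈ L.lattice := by simpa using add_mem hy hx
    have hval : L.weierstrassP y = e := by
      rw [he, ← L.weierstrassP_add_coe ω ⟨_, hyω⟩]
      simp
    rw [← hval]
    refine order_weierstrassP_sub_half L (fun h => hω ?_) ?_
    · simpa using sub_mem h hyω
    · have := add_mem h2 (add_mem hyω hyω)
      convert! this using 1
      ring
  have hcancel {a : WithTop ℤ} (ha : 2 ≤ a) : 0 ≤ a + -2 := by
    have := add_le_add_left ha (-2)
    exact this
  obtain ⟨c, hc⟩ := exists_eq_const_of_order_nonneg L (hm'.fun_mul hm)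
    (fun x l hl => by
      rw [add_right_comm, L.weierstrassP_add_coe _ ⟨l, hl⟩, L.weierstrassP_add_coe _ ⟨l, hl⟩])
    (fun x => by
      rw [hord]
      by_cases hx : x ∈ L.lattice
      · rw [order_weierstrassP_sub L hx]
        exact hcancel (hhalf (x := x) hx (by simp))
      · by_cases hx' : x + ω ∈ L.lattice
        · rw [order_weierstrassP_sub L hx', add_comm]
          refine hcancel (hhalf (x := x + ω) hx' ?_)
          rw [show x - ω - (x + ω) = -(2 * ω) by ring]
          exact neg_mem h2
        · exact add_nonneg (order_weierstrassP_sub_nonneg L hx' _)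
            (order_weierstrassP_sub_nonneg L hx _))
  have hval {x : ℂ} (hx : x ∉ L.lattice) (hx' : x + ω ∉ L.lattice) :
      (L.weierstrassP (x + ω) - e) * (L.weierstrassP x - e) = c := by
    refine hc x (ContinuousAt.mul (.sub ?_ continuousAt_const)
      ((continuousAt_weierstrassP L hx).sub continuousAt_const))
    exact ContinuousAt.comp (f := fun y => y + ω) (continuousAt_weierstrassP L hx')
      (by fun_prop)
  refine ⟨c, fun h0 => ?_, fun x hx hx' => hval hx hx'⟩
  -- If the constant were zero, one of the two factors would vanish identically near some point.
  have htop : meromorphicOrderAt (fun y => (L.weierstrassP (y + ω) - e)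
      * (L.weierstrassP y - e)) 0 = ⊤ := by
    rw [meromorphicOrderAt_eq_top_iff]
    have hne : ∀ᶠ y in 𝓝 (0 : ℂ), y + ω ∉ L.lattice := by
      refine ContinuousAt.eventually_mem (f := fun y : ℂ => y + ω) (by fun_prop)
        (L.isClosed_lattice.isOpen_compl.mem_nhds ?_)
      simpa using hω
    filter_upwards [eventually_nhdsNE_notMem_lattice L 0, hne.filter_mono nhdsWithin_le_nhds]
      with y hy hy'
    rw [hval hy hy', h0]
  rw [hord] at htop
  rcases WithTop.add_eq_top.1 htop with h | h
  · exact order_weierstrassP_sub_ne_top L _ _ h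
  · exact order_weierstrassP_sub_ne_top L _ _ h

end TakemuraHeun

end

/-! ### Half periods and the values $e_i$ -/

noncomputable section

namespace TakemuraHeun

variable (L : PeriodPair)

theorem halfPeriod_notMem (i : Fin 3) : halfPeriod L i.succ ∉ L.lattice := by
  fin_cases i
  · exact L.ω₁_div_two_notMem_lattice
  · have h := (L.mul_ω₁_add_mul_ω₂_mem_lattice (α := -1 / 2) (β := -1 / 2)).not.mpr (by norm_num)
    convert! h using 2
    simp [halfPeriod]
    ring
  · exact L.ω₂_div_two_notMem_lattice

theorem two_mul_halfPeriod_mem (i : Fin 4) : 2 * halfPeriod L i ∈ L.lattice := by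
  have h (m n : ℤ) : m * L.ω₁ + n * L.ω₂ ∈ L.lattice := PeriodPair.mem_lattice.2 ⟨m, n, rfl⟩
  fin_cases i
  · simp [halfPeriod]
  · convert! h 1 0 using 1; simp [halfPeriod]; ring
  · convert! h (-1) (-1) using 1; simp [halfPeriod]; ring
  · convert! h 0 1 using 1; simp [halfPeriod]; ring

theorem halfPeriod_sum : halfPeriod L 1 + halfPeriod L 2 + halfPeriod L 3 = 0 := by
  simp [halfPeriod]
  ring

/-- The constants `c i` with `(℘(x + ω i) - e i) (℘(x) - e i) = c i`. -/
theorem exists_half_constants : ∃ c : Fin 3 → ℂ, ∀ i, c i ≠ 0 ∧ ∀ x, x ∉ L.lattice →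
    x + halfPeriod L i.succ ∉ L.lattice →
    (L.weierstrassP (x + halfPeriod L i.succ) - halfValue L i.succ)
      * (L.weierstrassP x - halfValue L i.succ) = c i := by
  choose c hc h using fun i : Fin 3 =>
    exists_half_translate L (halfPeriod_notMem L i) (two_mul_halfPeriod_mem L i.succ)
  exact ⟨c, fun i => ⟨hc i, h i⟩⟩

/-- Evaluation at $x=\omega_j$, where $\omega_j+\omega_i=-\omega_k$. Since the constants are
nonzero, this also yields that the $e_i$ are distinct. -/
theorem half_constant_eq {c : Fin 3 → ℂ} (hc : ∀ i, c i ≠ 0 ∧ ∀ x, x ∉ L.lattice →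
    x + halfPeriod L i.succ ∉ L.lattice →
    (L.weierstrassP (x + halfPeriod L i.succ) - halfValue L i.succ)
      * (L.weierstrassP x - halfValue L i.succ) = c i) {i j k : Fin 3}
    (h : halfPeriod L i.succ + halfPeriod L j.succ + halfPeriod L k.succ = 0) :
    (halfValue L i.succ - halfValue L j.succ) * (halfValue L i.succ - halfValue L k.succ)
      = c i := by
  have h1 : halfPeriod L j.succ + halfPeriod L i.succ = -halfPeriod L k.succ := by
    linear_combination h
  have h2 := (hc i).2 (halfPeriod L j.succ) (halfPeriod_notMem L j) (by
    rw [h1]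
    exact fun hm => halfPeriod_notMem L k (by simpa using hm))
  rw [h1, L.weierstrassP_neg] at h2
  rw [← h2]
  simp only [halfValue]
  ring

theorem half_identities : ∃ c : Fin 3 → ℂ, (∀ i, c i ≠ 0 ∧ ∀ x, x ∉ L.lattice →
    x + halfPeriod L i.succ ∉ L.lattice →
    (L.weierstrassP (x + halfPeriod L i.succ) - halfValue L i.succ)
      * (L.weierstrassP x - halfValue L i.succ) = c i) ∧
    (halfValue L 1 - halfValue L 2) * (halfValue L 1 - halfValue L 3) = c 0 ∧
    (halfValue L 2 - halfValue L 1) * (halfValue L 2 - halfValue L 3) = c 1 ∧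
    (halfValue L 3 - halfValue L 1) * (halfValue L 3 - halfValue L 2) = c 2 := by
  obtain ⟨c, hc⟩ := exists_half_constants L
  refine ⟨c, hc, half_constant_eq L hc (i := 0) (j := 1) (k := 2) (halfPeriod_sum L),
    half_constant_eq L hc (i := 1) (j := 0) (k := 2) ?_,
    half_constant_eq L hc (i := 2) (j := 0) (k := 1) ?_⟩
  · rw [add_comm (halfPeriod L _)]; exact halfPeriod_sum L
  · rw [add_assoc, add_comm]; exact halfPeriod_sum L

/-- The numbers `(e i - e j) (e i - e k)`. -/
def halfConst : Fin 3 → ℂ :=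
  ![(halfValue L 1 - halfValue L 2) * (halfValue L 1 - halfValue L 3),
    (halfValue L 2 - halfValue L 1) * (halfValue L 2 - halfValue L 3),
    (halfValue L 3 - halfValue L 1) * (halfValue L 3 - halfValue L 2)]

theorem halfConst_spec (i : Fin 3) : halfConst L i ≠ 0 ∧ ∀ x, x ∉ L.lattice →
    x + halfPeriod L i.succ ∉ L.lattice →
    (L.weierstrassP (x + halfPeriod L i.succ) - halfValue L i.succ)
      * (L.weierstrassP x - halfValue L i.succ) = halfConst L i := by
  obtain ⟨c, hc, h0, h1, h2⟩ := half_identities L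
  have : halfConst L = c := by
    funext j
    fin_cases j
    · exact h0
    · exact h1
    · exact h2
  rw [this]
  exact hc i

theorem halfConst_ne_zero (i : Fin 3) : halfConst L i ≠ 0 := (halfConst_spec L i).1

theorem weierstrassP_ne_halfValue {x : ℂ} (hx : x ∉ L.lattice) {i : Fin 3}
    (hx' : x + halfPeriod L i.succ ∉ L.lattice) :
    L.weierstrassP x - halfValue L i.succ ≠ 0 := fun h =>
  halfConst_ne_zero L i (by rw [← (halfConst_spec L i).2 x hx hx', h, mul_zero])

theorem weierstrassP_add_half {x : ℂ} (hx : x ∉ L.lattice) {i : Fin 3}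
    (hx' : x + halfPeriod L i.succ ∉ L.lattice) :
    L.weierstrassP (x + halfPeriod L i.succ)
      = halfValue L i.succ + halfConst L i * (L.weierstrassP x - halfValue L i.succ)⁻¹ := by
  have h := (halfConst_spec L i).2 x hx hx'
  have h0 := weierstrassP_ne_halfValue L hx hx'
  rw [← div_eq_mul_inv, ← h, mul_div_cancel_right₀ _ h0]
  ring

theorem halfValue_sub_ne_zero :
    halfValue L 1 - halfValue L 2 ≠ 0 ∧ halfValue L 1 - halfValue L 3 ≠ 0 ∧
      halfValue L 2 - halfValue L 3 ≠ 0 :=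
  ⟨left_ne_zero_of_mul (halfConst_ne_zero L 0), right_ne_zero_of_mul (halfConst_ne_zero L 0),
    right_ne_zero_of_mul (halfConst_ne_zero L 1)⟩

theorem halfValue_root (i : Fin 3) :
    4 * halfValue L i.succ ^ 3 - L.g₂ * halfValue L i.succ - L.g₃ = 0 := by
  rw [halfValue, ← L.derivWeierstrassP_sq _ (halfPeriod_notMem L i),
    derivWeierstrassP_half L (two_mul_halfPeriod_mem L i.succ)]
  simp

/-- The $e_i$ are three distinct roots of a cubic without quadratic term; the combination below is a
Vandermonde elimination of $g_2$ and $g_3$. -/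
theorem halfValue_sum : halfValue L 1 + halfValue L 2 + halfValue L 3 = 0 := by
  obtain ⟨h12, h13, h23⟩ := halfValue_sub_ne_zero L
  have h1 : _ = _ := halfValue_root L 0
  have h2 : _ = _ := halfValue_root L 1
  have h3 : _ = _ := halfValue_root L 2
  simp only [Fin.succ_zero_eq_one, Fin.succ_one_eq_two] at h1 h2
  rw [show (2 : Fin 3).succ = 3 from rfl] at h3
  have : (halfValue L 1 - halfValue L 2) * ((halfValue L 1 - halfValue L 3)
      * ((halfValue L 2 - halfValue L 3) * (halfValue L 1 + halfValue L 2 + halfValue L 3)))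
      = 0 := by
    linear_combination (halfValue L 2 - halfValue L 3) / 4 * h1
      - (halfValue L 1 - halfValue L 3) / 4 * h2 + (halfValue L 1 - halfValue L 2) / 4 * h3
  simpa [h12, h13, h23] using this

theorem derivWeierstrassP_sq_eq {x : ℂ} (hx : x ∉ L.lattice) :
    L.derivWeierstrassP x ^ 2 = 4 * (L.weierstrassP x - halfValue L 1)
      * (L.weierstrassP x - halfValue L 2) * (L.weierstrassP x - halfValue L 3) := by
  obtain ⟨h12, h13, h23⟩ := halfValue_sub_ne_zero L
  have h1 : _ = _ := halfValue_root L 0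
  have h2 : _ = _ := halfValue_root L 1
  simp only [Fin.succ_zero_eq_one, Fin.succ_one_eq_two] at h1 h2
  rw [L.derivWeierstrassP_sq _ hx, ← sub_eq_zero]
  refine (mul_eq_zero.1 (?_ : (halfValue L 1 - halfValue L 2) * _ = 0)).resolve_left h12
  have h3 : halfValue L 3 = -halfValue L 1 - halfValue L 2 := by
    linear_combination halfValue_sum L
  rw [h3]
  linear_combination (L.weierstrassP x - halfValue L 2) * h1
    - (L.weierstrassP x - halfValue L 1) * h2

end TakemuraHeun

end

/-! ### The sum $\wp(x-\delta)+\wp(x+\delta)$ as a rational function of $\wp(x)$ -/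

noncomputable section

namespace TakemuraHeun

variable (L : PeriodPair)

/-- The limit leaves a simple pole as the only possible pole, and an even function cannot have one.
-/
theorem order_nonneg_of_even {f : ℂ → ℂ} (hf : MeromorphicAt f 0) (heven : ∀ x, f (-x) = f x)
    (h : Tendsto (fun x => x ^ 2 * f x) (𝓝[≠] 0) (𝓝 0)) : 0 ≤ meromorphicOrderAt f 0 := by
  have hx2 : MeromorphicAt (fun x : ℂ => x ^ 2) 0 := by fun_prop
  have hid : meromorphicOrderAt (fun x : ℂ => x ^ 2) 0 = 2 := by
    have := meromorphicOrderAt_pow (f := (id : ℂ → ℂ)) (x := 0) (n := 2) (by fun_prop)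
    rw [meromorphicOrderAt_id] at this
    exact this
  have hpos := (tendsto_zero_iff_meromorphicOrderAt_pos (hx2.fun_mul hf)).1 h
  have hmul : meromorphicOrderAt (fun x => x ^ 2 * f x) 0 = 2 + meromorphicOrderAt f 0 := by
    rw [← hid]
    exact meromorphicOrderAt_mul hx2 hf
  rw [hmul] at hpos
  by_contra hneg
  rw [not_le] at hneg
  obtain ⟨n, hn⟩ := WithTop.ne_top_iff_exists.1 (hneg.trans_le le_top).ne
  rw [← hn] at hpos hneg
  have hn1 : n < 0 := by exact_mod_cast hneg
  have hn2 : 0 < 2 + n := WithTop.coe_lt_coe.1 (by simpa using hpos)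
  obtain rfl : n = -1 := by omega
  obtain ⟨g, hg, hg0, hfg⟩ := (meromorphicOrderAt_eq_int_iff hf).1 hn.symm
  have hneg' : Tendsto (fun x : ℂ => -x) (𝓝[≠] 0) (𝓝[≠] 0) :=
    tendsto_nhdsWithin_iff.2 ⟨by
      have : Tendsto (fun x : ℂ => -x) (𝓝 0) (𝓝 (-0)) := continuous_neg.tendsto 0
      rw [neg_zero] at this
      exact this.mono_left nhdsWithin_le_nhds, by
        filter_upwards [self_mem_nhdsWithin] with y hy
        simpa using hy⟩
  have hgl : Tendsto g (𝓝[≠] 0) (𝓝 (g 0)) := hg.continuousAt.tendsto.mono_left nhdsWithin_le_nhds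
  have hgn : Tendsto g (𝓝[≠] 0) (𝓝 (-g 0)) := by
    refine ((hgl.comp hneg').neg).congr' ?_
    filter_upwards [hfg, hneg'.eventually hfg, self_mem_nhdsWithin] with x h1 h2 hx
    have hx0 : x ≠ 0 := hx
    rw [heven, h1] at h2
    simp only [sub_zero, zpow_neg_one, smul_eq_mul, inv_neg, neg_mul] at h2
    simp only [Function.comp_apply]
    exact (mul_left_cancel₀ (inv_ne_zero hx0) (by rw [h2]; ring)).symm
  exact hg0 (CharZero.eq_neg_self_iff.1 (tendsto_nhds_unique hgl hgn))

theorem tendsto_sq_mul_weierstrassP (a : ℂ) :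
    Tendsto (fun x => x ^ 2 * (L.weierstrassP x - a)) (𝓝[≠] 0) (𝓝 1) := by
  have h : ContinuousAt (fun x : ℂ => x ^ 2 * (L.weierstrassPExcept 0 x - a) + 1) 0 := by
    have := (L.analyticAt_weierstrassPExcept 0).continuousAt
    fun_prop
  have h' := h.tendsto.mono_left (nhdsWithin_le_nhds (s := {0}ᶜ))
  simp only [ne_eq, OfNat.ofNat_ne_zero, not_false_eq_true, zero_pow, zero_mul, zero_add] at h'
  refine h'.congr' ?_
  filter_upwards [self_mem_nhdsWithin] with x hx
  have hx0 : x ≠ 0 := hx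
  rw [← L.weierstrassPExcept_add 0 x]
  simp
  field_simp
  ring

variable {L} {δ : ℂ}

theorem notMem_of_two_mul_notMem (hδ : 2 * δ ∉ L.lattice) : δ ∉ L.lattice := fun h =>
  hδ (by rw [two_mul]; exact add_mem h h)

/-- The sum of two translates, as an even function. -/
def translateSum (L : PeriodPair) (δ x : ℂ) : ℂ :=
  L.weierstrassP (x + δ) + L.weierstrassP (x - δ) - 2 * L.weierstrassP δ

theorem translateSum_neg (x : ℂ) : translateSum L δ (-x) = translateSum L δ x := by
  rw [translateSum, translateSum, ← L.weierstrassP_neg (-x + δ), ← L.weierstrassP_neg (-x - δ),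
    add_comm (L.weierstrassP (- (-x + δ)))]
  congr 3 <;> ring_nf

theorem analyticAt_translate {a x : ℂ} (h : x + a ∉ L.lattice) :
    AnalyticAt ℂ (fun y => L.weierstrassP (y + a)) x :=
  AnalyticAt.fun_comp (g := L.weierstrassP) (L.analyticOnNhd_weierstrassP _ h) (by fun_prop)

theorem analyticAt_translateSum {x : ℂ} (h : x + δ ∉ L.lattice) (h' : x - δ ∉ L.lattice) :
    AnalyticAt ℂ (translateSum L δ) x := by
  have h1 := analyticAt_translate h
  have h2 := analyticAt_translate (a := -δ) (by rwa [← sub_eq_add_neg])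
  simp only [← sub_eq_add_neg] at h2
  exact (h1.fun_add h2).fun_sub analyticAt_const

/-- The value at $0$ is zero by the normalization, and the derivative is zero because $\wp'$ is odd.
-/
theorem exists_translateSum_eq_sq_mul (hδ : 2 * δ ∉ L.lattice) :
    ∃ h : ℂ → ℂ, AnalyticAt ℂ h 0 ∧ ∀ᶠ x in 𝓝 0, translateSum L δ x = x ^ 2 * h x := by
  have hδ' := notMem_of_two_mul_notMem hδ
  have ha : AnalyticAt ℂ (translateSum L δ) 0 :=
    analyticAt_translateSum (by simpa using hδ') (by simpa using hδ')
  have hd : HasDerivAt (translateSum L δ)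
      (L.derivWeierstrassP δ + L.derivWeierstrassP (-δ)) 0 := by
    have h1 : HasDerivAt (fun y => L.weierstrassP (y + δ)) (L.derivWeierstrassP δ) 0 := by
      have := hasDerivAt_weierstrassP L hδ'
      exact HasDerivAt.comp_add_const 0 δ (by rwa [zero_add])
    have h2 : HasDerivAt (fun y => L.weierstrassP (y - δ)) (L.derivWeierstrassP (-δ)) 0 := by
      have := hasDerivAt_weierstrassP L (x := -δ) (by simpa using hδ')
      exact HasDerivAt.comp_sub_const 0 δ (by rwa [zero_sub])
    exact (h1.fun_add h2).sub_const _
  have ho : ((2 : ℕ) : ℕ∞) ≤ analyticOrderAt (translateSum L δ) 0 := by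
    refine (natCast_le_analyticOrderAt_iff_iteratedDeriv_eq_zero ha).mpr fun i hi => ?_
    interval_cases i
    · simp [translateSum]
      ring
    · rw [iteratedDeriv_one, hd.deriv, L.derivWeierstrassP_neg, add_neg_cancel]
  obtain ⟨h, hh, hh'⟩ := (natCast_le_analyticOrderAt ha).1 ho
  exact ⟨h, hh, by simpa using hh'⟩

theorem meromorphic_translate (a : ℂ) : Meromorphic fun x => L.weierstrassP (x + a) := fun x =>
  (L.meromorphic_weierstrassP (x + a)).comp_analyticAt (g := fun y => y + a) (by fun_prop)

theorem translateSum_eq : translateSum L δ = (fun x => L.weierstrassP (x + δ))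
    + ((fun x => L.weierstrassP (x + -δ)) + fun _ => -(2 * L.weierstrassP δ)) := by
  funext x
  simp only [translateSum, Pi.add_apply, sub_eq_add_neg, add_assoc]

theorem meromorphic_translateSum : Meromorphic (translateSum L δ) := by
  rw [translateSum_eq]
  exact (meromorphic_translate _).add ((meromorphic_translate _).add (Meromorphic.const _))

theorem neg_two_le_order_weierstrassP (x : ℂ) : -2 ≤ meromorphicOrderAt L.weierstrassP x := by
  by_cases hx : x ∈ L.lattice
  · rw [L.order_weierstrassP x hx]
  · exact le_trans (by decide) (L.analyticOnNhd_weierstrassP x hx).meromorphicOrderAt_nonneg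

theorem neg_two_le_order_translateSum (x : ℂ) : -2 ≤ meromorphicOrderAt (translateSum L δ) x := by
  have h (a : ℂ) : -2 ≤ meromorphicOrderAt (fun x => L.weierstrassP (x + a)) x := by
    rw [meromorphicOrderAt_comp_add]
    exact neg_two_le_order_weierstrassP _
  have hc : (-2 : WithTop ℤ) ≤ meromorphicOrderAt (fun _ : ℂ => -(2 * L.weierstrassP δ)) x :=
    le_trans (by decide) analyticAt_const.meromorphicOrderAt_nonneg
  rw [translateSum_eq]
  refine le_trans (le_min (h δ) (le_trans (le_min (h (-δ)) hc) ?_)) (meromorphicOrderAt_add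
    (meromorphic_translate _ x) ((meromorphic_translate _ x).add analyticAt_const.meromorphicAt))
  exact meromorphicOrderAt_add (meromorphic_translate _ x) analyticAt_const.meromorphicAt

/-- The combination of `translateSum` and `℘` whose only possible poles are the lattice points. -/
def pairCombination (L : PeriodPair) (δ α x : ℂ) : ℂ :=
  translateSum L δ x * (L.weierstrassP x - L.weierstrassP δ) ^ 2
    + -α * (L.weierstrassP x - L.weierstrassP δ)

theorem meromorphic_pairCombination (α : ℂ) : Meromorphic (pairCombination L δ α) :=
  (meromorphic_translateSum.fun_mul fun x => (meromorphic_weierstrassP_sub L _ x).fun_pow 2).fun_add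
    ((Meromorphic.const _).fun_mul (meromorphic_weierstrassP_sub L _))

theorem pairCombination_add (α x : ℂ) {l : ℂ} (hl : l ∈ L.lattice) :
    pairCombination L δ α (x + l) = pairCombination L δ α x := by
  have h (y : ℂ) : L.weierstrassP (y + l) = L.weierstrassP y := L.weierstrassP_add_coe y ⟨l, hl⟩
  simp only [pairCombination, translateSum, h, add_right_comm x l δ, add_sub_right_comm x l δ]

/-- Off the lattice the only possible poles are the double ones at $\pm\delta$, which the square of
$\wp(x)-\wp(\delta)$ cancels. -/
theorem order_pairCombination_nonneg (α : ℂ) {x : ℂ} (hx : x ∉ L.lattice) :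
    0 ≤ meromorphicOrderAt (pairCombination L δ α) x := by
  set b := L.weierstrassP δ with hb
  have hsub := (meromorphic_weierstrassP_sub L b x)
  have h2 : 0 ≤ meromorphicOrderAt (fun y => -α * (L.weierstrassP y - b)) x :=
    AnalyticAt.meromorphicOrderAt_nonneg
      (analyticAt_const.fun_mul ((L.analyticOnNhd_weierstrassP x hx).fun_sub analyticAt_const))
  have h1 : 0 ≤ meromorphicOrderAt
      (fun y => translateSum L δ y * (L.weierstrassP y - b) ^ 2) x := by
    by_cases hp : x + δ ∉ L.lattice ∧ x - δ ∉ L.lattice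
    · exact ((analyticAt_translateSum hp.1 hp.2).fun_mul (((L.analyticOnNhd_weierstrassP x
        hx).fun_sub analyticAt_const).fun_pow 2)).meromorphicOrderAt_nonneg
    · have hval : L.weierstrassP x = b := by
        rcases not_and_or.1 hp with h | h
        · rw [not_not] at h
          rw [hb, ← L.weierstrassP_neg δ, ← L.weierstrassP_add_coe (-δ) ⟨_, h⟩]
          congr 1
          simp
        · rw [not_not] at h
          rw [hb, ← L.weierstrassP_add_coe δ ⟨_, h⟩]
          congr 1
          simp
      have hmul : meromorphicOrderAt (fun y => translateSum L δ y * (L.weierstrassP y - b) ^ 2) x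
          = meromorphicOrderAt (translateSum L δ) x
            + (meromorphicOrderAt (fun y => L.weierstrassP y - b) x
              + meromorphicOrderAt (fun y => L.weierstrassP y - b) x) := by
        simp only [pow_two]
        rw [← meromorphicOrderAt_mul hsub hsub]
        exact meromorphicOrderAt_mul (meromorphic_translateSum x) (hsub.mul hsub)
      have hone := order_weierstrassP_sub_self L hx
      rw [hval] at hone
      rw [hmul]
      calc (0 : WithTop ℤ) = -2 + (1 + 1) := by decide
        _ ≤ _ := add_le_add (neg_two_le_order_translateSum x) (add_le_add hone hone)
  refine le_trans (le_min h1 h2) (meromorphicOrderAt_add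
    ((meromorphic_translateSum x).mul (hsub.pow 2)) (analyticAt_const.meromorphicAt.mul hsub))

/-- If `translateSum` is $x^2h(x)$, the choice $\alpha=h(0)$ cancels the $x^{-2}$ term at the
origin; evenness removes $x^{-1}$, and an elliptic function without poles remains. -/
theorem exists_pairCombination_eq_const (hδ : 2 * δ ∉ L.lattice) : ∃ α c, ∀ x, x ∉ L.lattice →
    x + δ ∉ L.lattice → x - δ ∉ L.lattice → pairCombination L δ α x = c := by
  obtain ⟨h, hh, hT⟩ := exists_translateSum_eq_sq_mul hδ
  set b := L.weierstrassP δ with hb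
  have h0 : 0 ≤ meromorphicOrderAt (pairCombination L δ (h 0)) 0 := by
    refine order_nonneg_of_even (meromorphic_pairCombination _ 0) (fun x => ?_) ?_
    · rw [pairCombination, translateSum_neg, L.weierstrassP_neg]
      rfl
    · have hl := tendsto_sq_mul_weierstrassP L b
      have hhl : Tendsto h (𝓝[≠] 0) (𝓝 (h 0)) :=
        hh.continuousAt.tendsto.mono_left nhdsWithin_le_nhds
      have := hl.mul ((hhl.mul hl).sub_const (h 0))
      rw [mul_one, sub_self, mul_zero] at this
      refine this.congr' ?_
      filter_upwards [hT.filter_mono nhdsWithin_le_nhds] with x hx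
      rw [pairCombination, hx]
      ring
  obtain ⟨c, hc⟩ := exists_eq_const_of_order_nonneg L (meromorphic_pairCombination (L := L)
    (δ := δ) (h 0)) (fun x l hl => pairCombination_add _ x hl) (fun x => by
      by_cases hx : x ∈ L.lattice
      · have := meromorphicOrderAt_comp_add (pairCombination L δ (h 0)) x 0
        rw [zero_add] at this
        rw [← this]
        simpa only [pairCombination_add _ _ hx] using h0
      · exact order_pairCombination_nonneg _ hx)
  refine ⟨h 0, c, fun x hx hp hm => hc x ?_⟩
  have ha := L.analyticOnNhd_weierstrassP x hx
  exact (((analyticAt_translateSum hp hm).fun_mul ((ha.fun_sub analyticAt_const).fun_pow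
    2)).fun_add (analyticAt_const.fun_mul (ha.fun_sub analyticAt_const))).continuousAt

theorem halfPeriod_add_notMem (hδ : 2 * δ ∉ L.lattice) (i : Fin 4) :
    halfPeriod L i + δ ∉ L.lattice ∧ halfPeriod L i - δ ∉ L.lattice := by
  have h2 := two_mul_halfPeriod_mem L i
  constructor <;> intro h <;> apply hδ
  · convert! sub_mem (add_mem h h) h2 using 1
    ring
  · convert! sub_mem h2 (add_mem h h) using 1
    ring

/-- The value of the cubic at `℘(δ)`. -/
def cubicValue (L : PeriodPair) (b : ℂ) : ℂ :=
  4 * (b - halfValue L 1) * (b - halfValue L 2) * (b - halfValue L 3)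

theorem weierstrassP_sub_halfValue_ne_zero (hδ : 2 * δ ∉ L.lattice) (i : Fin 3) :
    L.weierstrassP δ - halfValue L i.succ ≠ 0 :=
  weierstrassP_ne_halfValue L (notMem_of_two_mul_notMem hδ)
    (by rw [add_comm]; exact (halfPeriod_add_notMem hδ i.succ).1)

theorem cubicValue_ne_zero (hδ : 2 * δ ∉ L.lattice) : cubicValue L (L.weierstrassP δ) ≠ 0 :=
  mul_ne_zero (mul_ne_zero (mul_ne_zero (by norm_num : (4 : ℂ) ≠ 0)
    (weierstrassP_sub_halfValue_ne_zero hδ 0))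
    (weierstrassP_sub_halfValue_ne_zero hδ 1)) (weierstrassP_sub_halfValue_ne_zero hδ 2)

theorem translateSum_halfPeriod (hδ : 2 * δ ∉ L.lattice) (i : Fin 3) :
    translateSum L δ (halfPeriod L i.succ) = 2 * (halfValue L i.succ - L.weierstrassP δ)
      + 2 * halfConst L i / (L.weierstrassP δ - halfValue L i.succ) := by
  have hδ' := notMem_of_two_mul_notMem hδ
  have h1 := weierstrassP_add_half L hδ' (i := i)
    (by rw [add_comm]; exact (halfPeriod_add_notMem hδ i.succ).1)
  have h2 : L.weierstrassP (halfPeriod L i.succ - δ) = L.weierstrassP (δ + halfPeriod L i.succ) := by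
    rw [← L.weierstrassP_neg, neg_sub,
      ← L.weierstrassP_add_coe _ ⟨_, two_mul_halfPeriod_mem L i.succ⟩]
    congr 1
    simp only
    ring
  rw [translateSum, h2, add_comm (halfPeriod L i.succ), h1]
  ring

theorem pairCombination_eq (hδ : 2 * δ ∉ L.lattice) {x : ℂ} (hx : x ∉ L.lattice)
    (hp : x + δ ∉ L.lattice) (hm : x - δ ∉ L.lattice) :
    pairCombination L δ ((12 * L.weierstrassP δ ^ 2 + 4 * (halfValue L 1 * halfValue L 2
      + halfValue L 2 * halfValue L 3 + halfValue L 3 * halfValue L 1)) / 2) x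
      = cubicValue L (L.weierstrassP δ) := by
  obtain ⟨α, c, h⟩ := exists_pairCombination_eq_const hδ
  set b := L.weierstrassP δ with hb
  -- Evaluation at the half periods, where $\omega_i-\delta\equiv-(\delta+\omega_i)$; the cases
  -- $i=1,2$ determine $\alpha$ and $c$.
  have hi (i : Fin 3) : 2 * (halfValue L i.succ - b) ^ 3
      - (2 * halfConst L i + α) * (halfValue L i.succ - b) = c := by
    have h1 := h _ (halfPeriod_notMem L i) (halfPeriod_add_notMem hδ i.succ).1
      (halfPeriod_add_notMem hδ i.succ).2
    have hne := weierstrassP_sub_halfValue_ne_zero hδ i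
    rw [pairCombination, translateSum_halfPeriod hδ, ← hb,
      show L.weierstrassP (halfPeriod L i.succ) = halfValue L i.succ from rfl] at h1
    rw [← hb] at hne
    rw [← h1]
    field_simp
    ring
  have h1 := hi 0
  have h2 := hi 1
  have h3 : halfValue L 3 = -halfValue L 1 - halfValue L 2 := by
    linear_combination halfValue_sum L
  simp only [halfConst, Fin.succ_zero_eq_one, Fin.succ_one_eq_two, Matrix.cons_val_zero,
    Matrix.cons_val_one, h3] at h1 h2
  have hα : α = (12 * b ^ 2 + 4 * (halfValue L 1 * halfValue L 2
      + halfValue L 2 * halfValue L 3 + halfValue L 3 * halfValue L 1)) / 2 := by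
    refine mul_left_cancel₀ (halfValue_sub_ne_zero L).1 ?_
    rw [h3]
    linear_combination h2 - h1
  have hc : c = cubicValue L b := by
    rw [← h1, cubicValue, hα, h3]
    ring
  rw [← hα, ← hc]
  exact h x hx hp hm

/-- At a zero of $\wp(x)-\wp(\delta)$ the left side of `pairCombination_eq` would vanish, while its
right side is nonzero. -/
theorem weierstrassP_ne_of_notMem (hδ : 2 * δ ∉ L.lattice) {x : ℂ} (hx : x ∉ L.lattice)
    (hp : x + δ ∉ L.lattice) (hm : x - δ ∉ L.lattice) :
    L.weierstrassP x - L.weierstrassP δ ≠ 0 := fun h => by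
  have h1 := pairCombination_eq hδ hx hp hm
  rw [pairCombination, h, zero_pow two_ne_zero, mul_zero, mul_zero, add_zero] at h1
  exact cubicValue_ne_zero hδ h1.symm

theorem weierstrassP_sub_add_weierstrassP_add (hδ : 2 * δ ∉ L.lattice) {x : ℂ}
    (hx : x ∉ L.lattice) (hp : x + δ ∉ L.lattice) (hm : x - δ ∉ L.lattice) :
    L.weierstrassP (x - δ) + L.weierstrassP (x + δ) = 2 * L.weierstrassP δ
      + (12 * L.weierstrassP δ ^ 2 + 4 * (halfValue L 1 * halfValue L 2
      + halfValue L 2 * halfValue L 3 + halfValue L 3 * halfValue L 1)) / 2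
        * (L.weierstrassP x - L.weierstrassP δ)⁻¹
      + cubicValue L (L.weierstrassP δ) * ((L.weierstrassP x - L.weierstrassP δ)⁻¹) ^ 2 := by
  have h0 := weierstrassP_ne_of_notMem hδ hx hp hm
  rw [← pairCombination_eq hδ hx hp hm, pairCombination, translateSum]
  field_simp
  ring

end TakemuraHeun

end

noncomputable section

namespace TakemuraHeun

/-! ### Rational functions of `℘` -/

section Elliptic

variable {L : PeriodPair} {M : ℕ} {δ b : Fin M → ℂ}

theorem eventually_nhdsNE_add_notMem (a x : ℂ) : ∀ᶠ y in 𝓝[≠] x, y + a ∉ L.lattice := by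
  have h : Tendsto (fun y => y + a) (𝓝[≠] x) (𝓝[≠] (x + a)) :=
    tendsto_nhdsWithin_iff.2 ⟨((continuous_add_const a).tendsto x).mono_left
      nhdsWithin_le_nhds, by
        filter_upwards [self_mem_nhdsWithin] with y hy
        simpa using hy⟩
  exact h.eventually (eventually_nhdsNE_notMem_lattice L (x + a))

theorem notMem_singularSet_iff {x : ℂ} : x ∉ singularSet L δ ↔
    (∀ i, x + -halfPeriod L i ∉ L.lattice) ∧
      ∀ k, x + -δ k ∉ L.lattice ∧ x + δ k ∉ L.lattice := by
  simp [singularSet, sub_eq_add_neg]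

theorem eventually_nhdsNE_notMem_singularSet (δ : Fin M → ℂ) (x : ℂ) :
    ∀ᶠ y in 𝓝[≠] x, y ∉ singularSet L δ := by
  simp only [notMem_singularSet_iff]
  exact (eventually_all.2 fun i => eventually_nhdsNE_add_notMem _ x).and
    (eventually_all.2 fun k => (eventually_nhdsNE_add_notMem _ x).and
      (eventually_nhdsNE_add_notMem _ x))

theorem eventually_notMem_singularSet {x : ℂ} (hx : x ∉ singularSet L δ) :
    ∀ᶠ y in 𝓝 x, y ∉ singularSet L δ := by
  rw [← nhdsNE_sup_pure, eventually_sup]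
  exact ⟨eventually_nhdsNE_notMem_singularSet δ x, hx⟩

theorem notMem_lattice_of_notMem {x : ℂ} (hx : x ∉ singularSet L δ) : x ∉ L.lattice := by
  have := (notMem_singularSet_iff.1 hx).1 0
  simpa [halfPeriod] using this

theorem add_halfPeriod_notMem {x : ℂ} (hx : x ∉ singularSet L δ) (i : Fin 4) :
    x + halfPeriod L i ∉ L.lattice := fun h => by
  refine (notMem_singularSet_iff.1 hx).1 i ?_
  convert! sub_mem h (two_mul_halfPeriod_mem L i) using 1
  ring

theorem add_notMem_of_notMem {x : ℂ} (hx : x ∉ singularSet L δ) (k : Fin M) :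
    x + δ k ∉ L.lattice := ((notMem_singularSet_iff.1 hx).2 k).2

theorem sub_notMem_of_notMem {x : ℂ} (hx : x ∉ singularSet L δ) (k : Fin M) :
    x - δ k ∉ L.lattice := by
  rw [sub_eq_add_neg]
  exact ((notMem_singularSet_iff.1 hx).2 k).1

theorem poles_inl (e : Fin 4 → ℂ) (b : Fin M → ℂ) (i : Fin 3) :
    poles e b (Sum.inl i) = e i.succ := by
  fin_cases i <;> rfl

theorem weierstrassP_ne_poles (hδ : ∀ k, 2 * δ k ∉ L.lattice)
    (hb : ∀ k, L.weierstrassP (δ k) = b k) {x : ℂ} (hx : x ∉ singularSet L δ) (j) :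
    L.weierstrassP x ≠ poles (halfValue L) b j := by
  rw [← sub_ne_zero]
  cases j with
  | inl i =>
    rw [poles_inl]
    exact weierstrassP_ne_halfValue L (notMem_lattice_of_notMem hx) (add_halfPeriod_notMem hx _)
  | inr k =>
    show L.weierstrassP x - b k ≠ 0
    rw [← hb]
    exact weierstrassP_ne_of_notMem (hδ k) (notMem_lattice_of_notMem hx)
      (add_notMem_of_notMem hx k) (sub_notMem_of_notMem hx k)

theorem injective_poles (hδ : ∀ k, 2 * δ k ∉ L.lattice)
    (hb : ∀ k, L.weierstrassP (δ k) = b k) (hinj : Function.Injective b) :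
    Function.Injective (poles (halfValue L) b) := by
  obtain ⟨h12, h13, h23⟩ := halfValue_sub_ne_zero L
  rw [sub_ne_zero] at h12 h13 h23
  refine Function.Injective.sumElim ?_ hinj fun i k h => ?_
  · intro i j h
    fin_cases i <;> fin_cases j <;> simp_all [eq_comm]
  · have h1 : poles (halfValue L) b (Sum.inl i) = b k := h
    rw [poles_inl, ← hb] at h1
    exact weierstrassP_sub_halfValue_ne_zero (hδ k) i (sub_eq_zero.2 h1.symm)

theorem potential_eq (l : Fin 4 → ℕ) (r : Fin M → ℕ) (s : Fin M → ℂ)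
    (hδ : ∀ k, 2 * δ k ∉ L.lattice) (hb : ∀ k, L.weierstrassP (δ k) = b k) {x : ℂ}
    (hx : x ∉ singularSet L δ) :
    potential L l r δ s x = evalAt (poles (halfValue L) b) (L.weierstrassP x)
      (ratPotential (halfValue L) l r b s) := by
  have hx0 := notMem_lattice_of_notMem hx
  have hh (i : Fin 3) := weierstrassP_add_half L hx0 (i := i) (add_halfPeriod_notMem hx i.succ)
  have h1 : _ = _ := hh 0
  have h2 : _ = _ := hh 1
  have h3 : _ = _ := hh 2
  simp only [Fin.succ_zero_eq_one, Fin.succ_one_eq_two] at h1 h2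
  rw [show (2 : Fin 3).succ = 3 from rfl] at h3
  have h0 : halfPeriod L 0 = 0 := rfl
  have hk (k : Fin M) := weierstrassP_sub_add_weierstrassP_add (hδ k) hx0
    (add_notMem_of_notMem hx k) (sub_notMem_of_notMem hx k)
  simp only [potential, Fin.sum_univ_four, h0, add_zero, h1, h2, h3, hk, hb]
  simp only [ratPotential, map_add, map_mul, map_sum, map_pow, evalAt_C, evalAt_X_none,
    evalAt_invE_zero, evalAt_invE_one, evalAt_invE_two, evalAt_invB, cubicValue, halfConst,
    Algebra.algebraMap_self, RingHom.id_apply, Matrix.cons_val, div_eq_mul_inv]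

theorem meromorphic_evalAt {κ : Type} (c : κ → ℂ) (h : PoleRing κ) :
    Meromorphic fun x => evalAt c (L.weierstrassP x) h := by
  induction h using MvPolynomial.induction_on with
  | C a => simpa only [evalAt_C] using Meromorphic.const _
  | add p q hp hq => simpa only [map_add] using hp.fun_add hq
  | mul_X p o hp =>
    simp only [map_mul]
    refine hp.fun_mul ?_
    cases o with
    | none => simpa only [evalAt_X_none] using L.meromorphic_weierstrassP
    | some j =>
      simp only [evalAt_X_some, Algebra.algebraMap_self, RingHom.id_apply]
      exact (meromorphic_weierstrassP_sub L (c j)).fun_inv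


end Elliptic

end TakemuraHeun

end

/-! ### Return to the variable $x$ -/

noncomputable section

namespace TakemuraHeun

section Elliptic

variable {L : PeriodPair} {M : ℕ} {δ b : Fin M → ℂ}

theorem hasDerivAt_evalAt_weierstrassP (hδ : ∀ k, 2 * δ k ∉ L.lattice)
    (hb : ∀ k, L.weierstrassP (δ k) = b k) {x : ℂ} (hx : x ∉ singularSet L δ)
    (h : PoleRing (Fin 3 ⊕ Fin M)) :
    HasDerivAt (fun y => evalAt (poles (halfValue L) b) (L.weierstrassP y) h)
      (L.derivWeierstrassP x
        * evalAt (poles (halfValue L) b) (L.weierstrassP x) (poleDeriv h)) x := by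
  rw [mul_comm]
  exact (hasDerivAt_evalAt _ (weierstrassP_ne_poles hδ hb hx) h).comp x
    (hasDerivAt_weierstrassP L (notMem_lattice_of_notMem hx))

theorem derivWeierstrassP_sq_eq_cubic {x : ℂ} (hx : x ∉ L.lattice) :
    L.derivWeierstrassP x ^ 2
      = evalAt (poles (halfValue L) b) (L.weierstrassP x) (cubic (halfValue L) M) := by
  rw [evalAt_cubic, derivWeierstrassP_sq_eq L hx]
  rfl

theorem derivWeierstrassP_ne_zero (hδ : ∀ k, 2 * δ k ∉ L.lattice)
    (hb : ∀ k, L.weierstrassP (δ k) = b k) {x : ℂ} (hx : x ∉ singularSet L δ) :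
    L.derivWeierstrassP x ≠ 0 := fun h => by
  have h1 := derivWeierstrassP_sq_eq L (notMem_lattice_of_notMem hx)
  have h2 (i : Fin 3) : L.weierstrassP x - halfValue L i.succ ≠ 0 := by
    have := weierstrassP_ne_poles hδ hb hx (Sum.inl i)
    rwa [poles_inl, ← sub_ne_zero] at this
  rw [h, zero_pow two_ne_zero] at h1
  exact mul_ne_zero (mul_ne_zero (mul_ne_zero (by norm_num : (4 : ℂ) ≠ 0) (h2 0)) (h2 1)) (h2 2)
    h1.symm

/-- Differentiating $\wp'^2=w(\wp)$ and cancelling $\wp'$, which is nonzero off the singular set. -/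
theorem hasDerivAt_derivWeierstrassP (hδ : ∀ k, 2 * δ k ∉ L.lattice)
    (hb : ∀ k, L.weierstrassP (δ k) = b k) {x : ℂ} (hx : x ∉ singularSet L δ) :
    HasDerivAt L.derivWeierstrassP (evalAt (poles (halfValue L) b) (L.weierstrassP x)
      (poleDeriv (cubic (halfValue L) M)) / 2) x := by
  have hx0 := notMem_lattice_of_notMem hx
  have hd := (L.analyticOnNhd_derivWeierstrassP x hx0).differentiableAt.hasDerivAt
  have h1 := hasDerivAt_evalAt_weierstrassP hδ hb hx (cubic (halfValue L) M)
  have h2 : (fun y => evalAt (poles (halfValue L) b) (L.weierstrassP y) (cubic (halfValue L) M))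
      =ᶠ[𝓝 x] fun y => L.derivWeierstrassP y ^ 2 := by
    filter_upwards [eventually_notMem_singularSet hx] with y hy
    exact (derivWeierstrassP_sq_eq_cubic (notMem_lattice_of_notMem hy)).symm
  have h3 := (h1.congr_of_eventuallyEq h2.symm).unique (hd.fun_pow 2)
  have h4 : L.derivWeierstrassP x * evalAt (poles (halfValue L) b) (L.weierstrassP x)
      (poleDeriv (cubic (halfValue L) M))
      = L.derivWeierstrassP x * (2 * deriv L.derivWeierstrassP x) := by
    rw [h3]
    simp
    ring
  rw [mul_left_cancel₀ (derivWeierstrassP_ne_zero hδ hb hx) h4]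
  simpa using hd

/-- By the chain rule with $\wp'^2=w$ and $\wp''=w'/2$, the left side is $\wp'/2$ times $Df$
evaluated at $z=\wp(x)$. -/
theorem third_order_equation (l : Fin 4 → ℕ) (r : Fin M → ℕ) (s : Fin M → ℂ) (E : ℂ)
    (hδ : ∀ k, 2 * δ k ∉ L.lattice) (hb : ∀ k, L.weierstrassP (δ k) = b k)
    {f : PoleRing (Fin 3 ⊕ Fin M)} {x : ℂ} (hx : x ∉ singularSet L δ)
    (hf : evalAt (poles (halfValue L) b) (L.weierstrassP x) (symOp poleDeriv
      (cubic (halfValue L) M) (MvPolynomial.C E - ratPotential (halfValue L) l r b s) f) = 0) :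
    iteratedDeriv 3 (fun y => evalAt (poles (halfValue L) b) (L.weierstrassP y) f) x
      - 4 * (potential L l r δ s x - E)
        * deriv (fun y => evalAt (poles (halfValue L) b) (L.weierstrassP y) f) x
      - 2 * deriv (potential L l r δ s) x
        * evalAt (poles (halfValue L) b) (L.weierstrassP x) f = 0 := by
  set c := poles (halfValue L) b with hc
  set w := cubic (halfValue L) M with hw
  set V := ratPotential (halfValue L) l r b s with hV
  have hd {y : ℂ} (hy : y ∉ singularSet L δ) (h) := hasDerivAt_evalAt_weierstrassP hδ hb hy h
  rw [← hc] at hd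
  have h1 {y : ℂ} (hy : y ∉ singularSet L δ) :
      deriv (fun y => evalAt c (L.weierstrassP y) f) y
        = L.derivWeierstrassP y * evalAt c (L.weierstrassP y) (poleDeriv f) := (hd hy f).deriv
  set g : PoleRing (Fin 3 ⊕ Fin M) := MvPolynomial.C (1 / 2) * (poleDeriv w * poleDeriv f)
    + w * poleDeriv (poleDeriv f) with hg
  have h2 {y : ℂ} (hy : y ∉ singularSet L δ) :
      deriv (deriv fun y => evalAt c (L.weierstrassP y) f) y = evalAt c (L.weierstrassP y) g := by
    have he : deriv (fun y => evalAt c (L.weierstrassP y) f) =ᶠ[𝓝 y]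
        fun y => L.derivWeierstrassP y * evalAt c (L.weierstrassP y) (poleDeriv f) := by
      filter_upwards [eventually_notMem_singularSet hy] with t ht using h1 ht
    rw [he.deriv_eq, ((hasDerivAt_derivWeierstrassP hδ hb hy).fun_mul (hd hy (poleDeriv f))).deriv,
      hg, map_add, map_mul, map_mul, map_mul, evalAt_C,
      ← derivWeierstrassP_sq_eq_cubic (b := b) (notMem_lattice_of_notMem hy)]
    simp only [Algebra.algebraMap_self, RingHom.id_apply]
    ring
  have h3 : iteratedDeriv 3 (fun y => evalAt c (L.weierstrassP y) f) x
      = L.derivWeierstrassP x * evalAt c (L.weierstrassP x) (poleDeriv g) := by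
    have he : deriv (deriv fun y => evalAt c (L.weierstrassP y) f) =ᶠ[𝓝 x]
        fun y => evalAt c (L.weierstrassP y) g := by
      filter_upwards [eventually_notMem_singularSet hx] with t ht using h2 ht
    rw [iteratedDeriv_succ, iteratedDeriv_succ, iteratedDeriv_one, he.deriv_eq, (hd hx g).deriv]
  have h4 : deriv (potential L l r δ s) x
      = L.derivWeierstrassP x * evalAt c (L.weierstrassP x) (poleDeriv V) := by
    have he : potential L l r δ s =ᶠ[𝓝 x] fun y => evalAt c (L.weierstrassP y) V := by
      filter_upwards [eventually_notMem_singularSet hx] with t ht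
        using potential_eq l r s hδ hb ht
    rw [he.deriv_eq, (hd hx V).deriv]
  have hg' : poleDeriv g = MvPolynomial.C (1 / 2) * (poleDeriv (poleDeriv w) * poleDeriv f
      + poleDeriv w * poleDeriv (poleDeriv f))
      + (poleDeriv w * poleDeriv (poleDeriv f) + w * poleDeriv (poleDeriv (poleDeriv f))) := by
    simp only [hg, map_add, Derivation.leibniz, poleDeriv_C, smul_eq_mul]
    ring
  rw [h3, h1 hx, h4, potential_eq l r s hδ hb hx, hg']
  simp only [symOp, map_add, map_sub, map_mul, evalAt_C, poleDeriv_C, zero_sub, map_neg,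
    map_ofNat, Algebra.algebraMap_self, RingHom.id_apply] at hf ⊢
  linear_combination L.derivWeierstrassP x / 2 * hf

/-- Otherwise $f$ would vanish on a neighbourhood of some $\wp(x)$, as $\wp$ is locally open where
$\wp'\ne0$, and hence on the connected complement of the finitely many poles. -/
theorem exists_evalAt_weierstrassP_ne_zero (hδ : ∀ k, 2 * δ k ∉ L.lattice)
    (hb : ∀ k, L.weierstrassP (δ k) = b k) {f : PoleRing (Fin 3 ⊕ Fin M)}
    (hf : ∃ z : ℂ, (∀ j, z ≠ poles (halfValue L) b j)
      ∧ evalAt (poles (halfValue L) b) z f ≠ 0) :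
    ∃ x, x ∉ singularSet L δ ∧ evalAt (poles (halfValue L) b) (L.weierstrassP x) f ≠ 0 := by
  set c := poles (halfValue L) b with hc
  obtain ⟨z, hz, hfz⟩ := hf
  by_contra! h
  obtain ⟨x, hx⟩ := (eventually_nhdsNE_notMem_singularSet (L := L) δ 0).exists
  have hs : HasStrictDerivAt L.weierstrassP (L.derivWeierstrassP x) x := by
    rw [← L.deriv_weierstrassP]
    exact (L.analyticOnNhd_weierstrassP x (notMem_lattice_of_notMem hx)).hasStrictDerivAt
  have hmap := hs.map_nhds_eq (derivWeierstrassP_ne_zero hδ hb hx)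
  have hzero : ∀ᶠ t in 𝓝 (L.weierstrassP x), evalAt c t f = 0 := by
    rw [← hmap, eventually_map]
    filter_upwards [eventually_notMem_singularSet hx] with y hy using h y hy
  have hU : IsOpen (Set.range c)ᶜ := (Set.finite_range c).isClosed.isOpen_compl
  have hmem {t : ℂ} : t ∈ (Set.range c)ᶜ ↔ ∀ j, t ≠ c j := by
    simp [eq_comm]
  have han : AnalyticOnNhd ℂ (fun t => evalAt c t f) (Set.range c)ᶜ := by
    refine DifferentiableOn.analyticOnNhd (fun t ht => ?_) hU
    exact (hasDerivAt_evalAt c (hmem.1 ht) f).differentiableAt.differentiableWithinAt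
  have hpre : IsPreconnected (Set.range c)ᶜ :=
    ((Set.finite_range c).countable.isPathConnected_compl_of_one_lt_rank
      (by rw [Complex.rank_real_complex]; norm_num)).isConnected.isPreconnected
  exact hfz (han.eqOn_zero_of_preconnected_of_eventuallyEq_zero hpre
    (hmem.2 (weierstrassP_ne_poles hδ hb hx)) hzero (hmem.2 hz))

end Elliptic

/-! ### Partial fractions in $\wp$ and the required expansion -/

section Expansion

theorem eval_eq_coeff_zero_add {n : ℕ} {R : Polynomial ℂ} (hR : R.natDegree ≤ n) (y : ℂ) :
    R.eval y = R.coeff 0 + ∑ j ∈ Finset.range n, R.coeff (n - j) * y ^ (n - j) := by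
  rw [Polynomial.eval_eq_sum_range' (Nat.lt_succ_of_le hR), Finset.sum_range_succ', add_comm,
    pow_zero, mul_one, ← Finset.sum_range_reflect]
  congr 1
  refine Finset.sum_congr rfl fun j hj => ?_
  rw [show n - 1 - j + 1 = n - j by have := Finset.mem_range.1 hj; omega]

theorem natDegree_X_mul_le {n : ℕ} {p : Polynomial ℂ} (hp : ∀ m, n ≤ m → p.coeff m = 0) :
    (Polynomial.X * p).natDegree ≤ n := by
  rw [Polynomial.natDegree_le_iff_coeff_eq_zero]
  intro m hm
  obtain ⟨m, rfl⟩ : ∃ k, m = k + 1 := ⟨m - 1, by omega⟩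
  rw [Polynomial.coeff_X_mul]
  exact hp m (by omega)

variable {L : PeriodPair} {M : ℕ} {δ b : Fin M → ℂ}

theorem evalAt_ofParts_eq_expansion (l : Fin 4 → ℕ) (r : Fin M → ℕ)
    (hb : ∀ k, L.weierstrassP (δ k) = b k)
    {q : ℂ × (Option (Fin 3 ⊕ Fin M) → Polynomial ℂ)}
    (hq : ∀ o m, poleBound l r o ≤ m → (q.2 o).coeff m = 0) :
    ∃ (c₀ : ℂ) (β : Fin 4 → ℕ → ℂ) (d : Fin M → ℕ → ℂ), ∀ x, x ∉ singularSet L δ →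
      evalAt (poles (halfValue L) b) (L.weierstrassP x) (ofParts _ q)
        = expansion L l r δ c₀ β d x := by
  -- Since $(\wp(x)-e_i)^{-1}=c_i^{-1}(\wp(x+\omega_i)-e_i)$, the polar part at $e_i$ is a
  -- polynomial in $\wp(x+\omega_i)$ of the same degree bound. The constant terms created by this
  -- affine substitution are collected in $c_0$.
  let R : Fin 4 → Polynomial ℂ := Fin.cons (Polynomial.X * q.2 none) fun i : Fin 3 =>
    (Polynomial.X * q.2 (some (Sum.inl i))).comp
      (Polynomial.C (halfConst L i)⁻¹ * (Polynomial.X - Polynomial.C (halfValue L i.succ)))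
  have hR (i : Fin 4) : (R i).natDegree ≤ l i := by
    refine Fin.cases ?_ (fun i => ?_) i
    · exact natDegree_X_mul_le (hq none)
    · refine Polynomial.natDegree_comp_le.trans ?_
      refine (Nat.mul_le_mul (natDegree_X_mul_le (hq (some (Sum.inl i))))
        ((Polynomial.natDegree_C_mul_le _ _).trans (Polynomial.natDegree_X_sub_C_le _))).trans ?_
      exact (mul_one (l i.succ)).le
  have hS (k : Fin M) : (Polynomial.X * q.2 (some (Sum.inr k))).natDegree ≤ r k :=
    natDegree_X_mul_le (hq (some (Sum.inr k)))
  refine ⟨q.1 + ∑ i, (R i).coeff 0, fun i j => (R i).coeff (l i - j),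
    fun k j => (Polynomial.X * q.2 (some (Sum.inr k))).coeff (r k - j), fun x hx => ?_⟩
  have hx0 := notMem_lattice_of_notMem hx
  have hhalf (i : Fin 3) : Polynomial.eval (L.weierstrassP x - halfValue L i.succ)⁻¹
      (Polynomial.X * q.2 (some (Sum.inl i)))
        = (R i.succ).eval (L.weierstrassP (x + halfPeriod L i.succ)) := by
    have h := weierstrassP_add_half L hx0 (i := i) (add_halfPeriod_notMem hx _)
    have hc := halfConst_ne_zero L i
    simp only [R, Fin.cons_succ, Polynomial.eval_comp, Polynomial.eval_mul, Polynomial.eval_C,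
      Polynomial.eval_sub, Polynomial.eval_X, h, add_sub_cancel_left, inv_mul_cancel_left₀ hc]
  have hzero : Polynomial.eval (L.weierstrassP x) (Polynomial.X * q.2 none)
      = (R 0).eval (L.weierstrassP (x + halfPeriod L 0)) := by
    rw [show halfPeriod L 0 = 0 from rfl, add_zero]
    rfl
  have hsum : ∑ i, (R i).eval (L.weierstrassP (x + halfPeriod L i)) = ∑ i, (R i).coeff 0
      + ∑ i, ∑ j ∈ Finset.range (l i), (R i).coeff (l i - j)
        * L.weierstrassP (x + halfPeriod L i) ^ (l i - j) := by
    rw [← Finset.sum_add_distrib]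
    exact Finset.sum_congr rfl fun i _ => eval_eq_coeff_zero_add (hR i) _
  have hpole (k : Fin M) : Polynomial.eval
      (L.weierstrassP x - poles (halfValue L) b (Sum.inr k))⁻¹
      (Polynomial.X * q.2 (some (Sum.inr k)))
      = ∑ j ∈ Finset.range (r k), (Polynomial.X * q.2 (some (Sum.inr k))).coeff (r k - j)
        / (L.weierstrassP x - L.weierstrassP (δ k)) ^ (r k - j) := by
    rw [eval_eq_coeff_zero_add (hS k), Polynomial.coeff_X_mul_zero, zero_add, hb,
      show poles (halfValue L) b (Sum.inr k) = b k from rfl]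
    exact Finset.sum_congr rfl fun j _ => by rw [inv_pow, div_eq_mul_inv]
  rw [evalAt_ofParts, Fintype.sum_option, Fintype.sum_sum_type]
  simp only [evalAt_X_none, evalAt_X_some, Algebra.algebraMap_self, RingHom.id_apply, poles_inl,
    Polynomial.coe_aeval_eq_eval, hhalf, hzero]
  rw [← add_assoc (Polynomial.eval _ (R 0)), ← Fin.sum_univ_succ
    (f := fun i => (R i).eval (L.weierstrassP (x + halfPeriod L i))), hsum, expansion]
  rw [Finset.sum_congr rfl fun k _ => hpole k]
  ring

end Expansion

end TakemuraHeun

end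
theorem mainTheorem2 (L : PeriodPair) (l : Fin 4 → ℕ) (M : ℕ) (r : Fin M → ℕ)
    (hr : ∀ k, 0 < r k) (δ b s o : Fin M → ℂ) (p E : ℂ)
    -- `b k` is finite, different from `e₁, e₂, e₃`, and the `b k` are distinct
    (hδ : ∀ k, 2 * δ k ∉ L.lattice)
    (hb : ∀ k, L.weierstrassP (δ k) = b k)
    (hinj : Function.Injective b)
    -- the relation between the parameters of the Fuchsian equation and of its elliptic form
    (ho : ∀ k, o k = TakemuraHeun.accessoryO (TakemuraHeun.halfValue L) l r b s k)
    (hp : p = TakemuraHeun.accessoryP (TakemuraHeun.halfValue L) l r b E)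
    (happ : ∀ k, TakemuraHeun.IsApparent
      (TakemuraHeun.fuchsP (TakemuraHeun.halfValue L) l r b)
      (TakemuraHeun.fuchsQ (TakemuraHeun.halfValue L) l r b p o) (b k)) :
    ∃ Ξ : ℂ → ℂ,
      Meromorphic Ξ ∧
      -- nonzero, even, doubly periodic
      (∃ x, x ∉ TakemuraHeun.singularSet L δ ∧ Ξ x ≠ 0) ∧
      (∀ x, Ξ (-x) = Ξ x) ∧
      (∀ x, Ξ (x + L.ω₁) = Ξ x) ∧ (∀ x, Ξ (x + L.ω₂) = Ξ x) ∧
      -- the third-order equation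
      (∀ x, x ∉ TakemuraHeun.singularSet L δ →
        iteratedDeriv 3 Ξ x - 4 * (TakemuraHeun.potential L l r δ s x - E) * deriv Ξ x
          - 2 * deriv (TakemuraHeun.potential L l r δ s) x * Ξ x = 0) ∧
      -- the expansion
      (∃ (c₀ : ℂ) (β : Fin 4 → ℕ → ℂ) (d : Fin M → ℕ → ℂ),
        ∀ x, x ∉ TakemuraHeun.singularSet L δ →
          Ξ x = TakemuraHeun.expansion L l r δ c₀ β d x) := by
  open TakemuraHeun in
  obtain ⟨q, hq, hne, hsol⟩ := exists_rational_solution l r s E (halfValue_sum L)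
    (injective_poles hδ hb hinj) fun k => by
      have h := (happ k).2.2
      rwa [hp, show o = accessoryO (halfValue L) l r b s from funext ho] at h
  refine ⟨fun x => TakemuraHeun.evalAt (TakemuraHeun.poles (TakemuraHeun.halfValue L) b)
    (L.weierstrassP x) (TakemuraHeun.ofParts _ q), TakemuraHeun.meromorphic_evalAt _ _,
    TakemuraHeun.exists_evalAt_weierstrassP_ne_zero hδ hb hne, fun x => ?_, fun x => ?_,
    fun x => ?_, fun x hx => TakemuraHeun.third_order_equation l r s E hδ hb hx
      (hsol _ (TakemuraHeun.weierstrassP_ne_poles hδ hb hx)),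
    TakemuraHeun.evalAt_ofParts_eq_expansion l r hb hq⟩
  · simp only [L.weierstrassP_neg]
  · simp only [L.weierstrassP_add_coe x ⟨_, L.ω₁_mem_lattice⟩]
  · simp only [L.weierstrassP_add_coe x ⟨_, L.ω₂_mem_lattice⟩]
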